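/- **Setting.** Let $\Omega=(a,b)\times(c,d)$ with $a<b$, $c<d$, let $\Gamma_1$ be the union of its bottom and top sides, and identify the left and the right side (periodicity). Let $\alpha,\beta,\lambda>0$ and $\varrho>0$. Let $\mathcal T_h$ be a finite set of disjoint open triangles with $\overline\Omega=\bigcup_{T\in\mathcal T_h}\overline T$, let $h=\max_T \operatorname{diam} T$, and assume that $\mathcal T_h$ is quasi-uniform with constant $\varrho$: every $T\in\mathcal T_h$ contains a ball of radius $\varrho h$. For an integer $p\ge 1$, $V^p(\mathcal T_h)$ is the space of functions on $\Omega$ whose restriction to each $T$ is a polynomial of total degree at most $p$. Let $\mathcal E_h$ be the set of interior edges $\overline{T^+}\cap\overline{T^-}$ (for $T^+\ne T^-$) together with the periodic edges, which are the intersections of a triangle at the left side with a triangle at the right side after the two sides are identified (only intersections of positive length matter). Let $\mathcal E_h^{\Gamma_1}$ be the set of edges of triangles lying on $\Gamma_1$, and let $\mathcal R_h$ be the set of mesh vertices on $\Gamma_1$, where the two corners of each horizontal side are identified. On $e\in\mathcal E_h$ set $[v]=v^+n^++v^-n^-$ and $\{\nabla v\}=\frac12(\nabla v^++\nabla v^-)$,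 where $n^\pm$ is the unit normal pointing out of $T^\pm$. At $r\in\mathcal R_h$, which is shared by the edges $e^\pm\in\mathcal E_h^{\Gamma_1}$, set $[v]=v^+(r)n_r^++v^-(r)n_r^-$ and $\{\nabla_\Gamma v\}=\frac12(\nabla_\Gamma v^+(r)+\nabla_\Gamma v^-(r))$, where $v^\pm=v|_{e^\pm}$, $n_r^\pm$ is the unit tangent vector pointing out of $e^\pm$ at $r$, and $\nabla_\Gamma$ is the tangential gradient. Write $(\cdot,\cdot)_{\mathcal E_h}$, $(\cdot,\cdot)_{\mathcal E_h^{\Gamma_1}}$ for sums over the edges of $L^2$ inner products, $(\cdot,\cdot)_{\mathcal R_h}$ for sums of point values over the vertices in $\mathcal R_h$, and $\|\cdot\|_{\mathcal E_h}$, $\|\cdot\|_{\mathcal E_h^{\Gamma_1}}$, $\|\cdot\|_{\mathcal R_h}$ for the corresponding norms. For $\gamma>0$ and $\sigma=\gamma/h$ define $$\mathcal A_h(v,w)=\sum_T(\nabla v,\nabla w)_T-([v],\{\nabla w\})_{\mathcal E_h}-([w],\{\nabla v\})_{\mathcal E_h}+\sigma([v],[w])_{\mathcal E_h}+\alpha(v,w)_{L^2(\Gamma_1)}$$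 $$\qquad+\beta\Big((\nabla_\Gamma v,\nabla_\Gamma w)_{\mathcal E_h^{\Gamma_1}}-([v],\{\nabla_\Gamma w\})_{\mathcal R_h}-([w],\{\nabla_\Gamma v\})_{\mathcal R_h}+\sigma([v],[w])_{\mathcal R_h}\Big),$$ $$|||w|||^2=\sum_T\|\nabla w\|_{L^2(T)}^2+\sigma\|[w]\|_{\mathcal E_h}^2+\tfrac1\sigma\|\{\nabla w\}\|_{\mathcal E_h}^2+\alpha\|w\|_{L^2(\Gamma_1)}^2+\beta\|\nabla_\Gamma w\|_{\mathcal E_h^{\Gamma_1}}^2+\beta\sigma\|[w]\|_{\mathcal R_h}^2+\tfrac\beta\sigma\|\{\nabla_\Gamma w\}\|_{\mathcal R_h}^2,$$ and $\|w\|_{L^2_\lambda}^2=\|w\|_{L^2(\Omega)}^2+\lambda\|w\|_{L^2(\Gamma_1)}^2$. Let $T>0$, $\Delta t>0$ and $K\in\mathbb N$ with $K\Delta t=T$, let $t_k=k\Delta t$, and let $f^k=f(t_k)\in L^2(\Omega)$ and $g^k=g(t_k)\in L^2(\Gamma_1)$ for $1\le k\le K$. Let $u_h^0=u_{h0}\in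 V^p(\mathcal T_h)$, and let $u_h^1,\dots,u_h^K\in V^p(\mathcal T_h)$ solve the backward Euler scheme: for $0\le k\le K-1$ and all $v_h\in V^p(\mathcal T_h)$, $$\Big(\tfrac{u_h^{k+1}-u_h^k}{\Delta t},v_h\Big)_{L^2(\Omega)}+\lambda\Big(\tfrac{u_h^{k+1}-u_h^k}{\Delta t},v_h\Big)_{L^2(\Gamma_1)}+\mathcal A_h(u_h^{k+1},v_h)=(f^{k+1},v_h)_{L^2(\Omega)}+(g^{k+1},v_h)_{L^2(\Gamma_1)}.$$ **Claim.** There is a constant $C>0$ depending only on $\Omega,\alpha,\beta,\lambda,\varrho$, and for every $p\ge1$ a threshold $\gamma_0>0$ depending only on $p$ and on these data, such that for all $\gamma\ge\gamma_0$ and all $\mathcal T_h$, $T$, $\Delta t$, $K$, $f$, $g$, $u_{h0}$ as above, $$\|u_h^K\|_{L^2_\lambda}^2+\Delta t\sum_{k=1}^K|||u_h^k|||^2\le C\Big(\|u_{h0}\|_{L^2_\lambda}^2+\Delta t\sum_{k=1}^K\big(\|f^k\|_{L^2(\Omega)}^2+\|g^k\|_{L^2(\Gamma_1)}^2\big)\Big).$$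 -/

import Mathlib

open MeasureTheory

noncomputable section

/-- The Euclidean plane. -/
abbrev Plane : Type := EuclideanSpace ℝ (Fin 2)

namespace DG

/-- The open rectangle `Ω = (a,b) × (c,d)`. -/
def Omega (a b c d : ℝ) : Set Plane :=
  {x | x 0 ∈ Set.Ioo a b ∧ x 1 ∈ Set.Ioo c d}

/-- `Γ₁`: the union of the bottom and the top side of the rectangle. -/
def Gamma1 (a b c d : ℝ) : Set Plane :=
  {x | x 0 ∈ Set.Icc a b ∧ (x 1 = c ∨ x 1 = d)}

/-- The squared norm of `L²(Ω)`. -/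
def normSqOmega (a b c d : ℝ) (f : Plane → ℝ) : ℝ :=
  ∫ x in Omega a b c d, f x ^ 2

/-- The squared norm of `L²(Γ₁)` (with respect to arc length). -/
def normSqGamma1 (a b c d : ℝ) (g : Plane → ℝ) : ℝ :=
  ∫ x in Gamma1 a b c d, g x ^ 2 ∂(μH[1] : Measure Plane)

/-- The unit vectors `n` that are outward normal to the convex set `S` at `x`. -/
def IsOutwardNormal (S : Set Plane) (x n : Plane) : Prop :=
  ‖n‖ = 1 ∧ ∀ y ∈ S, inner ℝ n (y - x) ≤ 0

/-- The outward unit normal of a triangle `S` at the boundary point `x`. It is uniquely determined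
unless `x` is a vertex; vertices are irrelevant for integrals over edges. -/
def outwardNormal (S : Set Plane) (x : Plane) : Plane :=
  Classical.epsilon (IsOutwardNormal S x)

/-- Value at `x` of a polynomial in two variables. -/
def val (q : MvPolynomial (Fin 2) ℝ) (x : Plane) : ℝ :=
  MvPolynomial.eval (fun k => x k) q

/-- Gradient at `x` of a polynomial in two variables. -/
def grad (q : MvPolynomial (Fin 2) ℝ) (x : Plane) : Plane :=
  !₂[val (MvPolynomial.pderiv 0 q) x, val (MvPolynomial.pderiv 1 q) x]

/-- The tangential gradient `∇_Γ q = (I - n ⊗ n) ∇q` on `Γ₁`, where `n = ±(0,1)`. -/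
def tangGrad (q : MvPolynomial (Fin 2) ℝ) (x : Plane) : Plane :=
  grad q x - (inner ℝ (!₂[0, 1] : Plane) (grad q x)) • (!₂[0, 1] : Plane)

/-- A partition of the rectangle `(a,b) × (c,d)` into finitely many disjoint open triangles, each
given by its vertices, whose closures cover the closed rectangle. -/
structure Mesh (a b c d : ℝ) where
  N : ℕ
  vert : Fin N → Fin 3 → Plane
  affineIndependent : ∀ i, AffineIndependent ℝ (vert i)
  disjoint : ∀ i j, i ≠ j → Disjoint (interior (convexHull ℝ (Set.range (vert i))))
    (interior (convexHull ℝ (Set.range (vert j))))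
  cover : ⋃ i, convexHull ℝ (Set.range (vert i)) = closure (Omega a b c d)

namespace Mesh

variable {a b c d : ℝ} (M : Mesh a b c d)

/-- The closed triangle number `i`. -/
def closedTri (i : Fin M.N) : Set Plane := convexHull ℝ (Set.range (M.vert i))

/-- The (open) triangle number `i`. -/
def tri (i : Fin M.N) : Set Plane := interior (M.closedTri i)

/-- The mesh size: the largest diameter of a triangle. -/
def h : ℝ := ⨆ i, Metric.diam (M.closedTri i)

/-- Quasi-uniformity with constant `ρ`: every triangle contains a ball of radius `ρ h`, where `h`
is the global mesh size. -/
def QuasiUniform (ρ : ℝ) : Prop := ∀ i, ∃ x, Metric.ball x (ρ * M.h) ⊆ M.tri i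

/-- Piecewise polynomial functions, given by their polynomial on each triangle. -/
abbrev PiecewisePoly : Type := Fin M.N → MvPolynomial (Fin 2) ℝ

/-- The discontinuous space `V^p`: total degree at most `p` on each triangle, no continuity. -/
def V (p : ℕ) : Submodule ℝ M.PiecewisePoly :=
  Submodule.pi Set.univ fun _ => MvPolynomial.restrictTotalDegree (Fin 2) ℝ p

/-- `(f, v)_{L²(Ω)}` for a function `f` and a piecewise polynomial `v`. -/
def pairOmega (f : Plane → ℝ) (v : M.PiecewisePoly) : ℝ :=
  ∑ i, ∫ x in M.tri i, f x * val (v i) x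

/-- `(v, w)_{L²(Ω)}`. -/
def innerOmega (v w : M.PiecewisePoly) : ℝ :=
  ∑ i, ∫ x in M.tri i, val (v i) x * val (w i) x

/-- The sum over the edges on `Γ₁` of the integral of `F i`, where the `i`-th triangle is the one
that has the edge. (Triangles that only touch `Γ₁` in a point contribute zero.) -/
def sumGamma1 (F : Fin M.N → Plane → ℝ) : ℝ :=
  ∑ i, ∫ x in M.closedTri i ∩ Gamma1 a b c d, F i x ∂(μH[1] : Measure Plane)

/-- `(g, v)_{L²(Γ₁)}` for a function `g` and a piecewise polynomial `v`. -/
def pairGamma1 (g : Plane → ℝ) (v : M.PiecewisePoly) : ℝ :=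
  M.sumGamma1 fun i x => g x * val (v i) x

/-- `(v, w)_{L²(Γ₁)}`. -/
def innerGamma1 (v w : M.PiecewisePoly) : ℝ :=
  M.sumGamma1 fun i x => val (v i) x * val (w i) x

/-- The squared norm of `L²_λ(Ω, Γ₁)`. -/
def normSqLam (lam : ℝ) (v : M.PiecewisePoly) : ℝ :=
  M.innerOmega v v + lam * M.innerGamma1 v v

/-! Interior edges and periodic edges are treated together. For a shift `τ`, the two triangles `i`
and `j` share the set of those `x` in the closure of triangle `i` for which `x + τ` is in the
closure of triangle `j`. The shift `τ = 0` gives the interior edges, and the shift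
`τ = (b - a, 0)`, which identifies the left with the right side, gives the periodic edges on `Γ₂`.
Sets that are empty or a single point contribute zero to integrals with respect to arc length. -/

/-- The edge shared by triangles `i` and `j` up to the shift `τ`. -/
def edge (i j : Fin M.N) (τ : Plane) : Set Plane :=
  {x | x ∈ M.closedTri i ∧ x + τ ∈ M.closedTri j}

/-- The period `(b - a, 0)`. -/
def period (_M : Mesh a b c d) : Plane := !₂[b - a, 0]

/-- The jump `[v] = v⁺ n⁺ + v⁻ n⁻` at a point of the edge shared by triangles `i` and `j`. -/
def jump (v : M.PiecewisePoly) (i j : Fin M.N) (τ x : Plane) : Plane :=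
  val (v i) x • outwardNormal (M.closedTri i) x +
    val (v j) (x + τ) • outwardNormal (M.closedTri j) (x + τ)

/-- The average `{∇v}` at a point of the edge shared by triangles `i` and `j`. -/
def avgGrad (v : M.PiecewisePoly) (i j : Fin M.N) (τ x : Plane) : Plane :=
  (1 / 2 : ℝ) • (grad (v i) x + grad (v j) (x + τ))

/-- Sum over all interior edges (each unordered pair of triangles is counted once) and all periodic
edges (triangle `i` on the left side, triangle `j` on the right side) of the integral of `F`. -/
def sumEdges (F : Fin M.N → Fin M.N → Plane → Plane → ℝ) : ℝ :=
  (∑ i, ∑ j, if i < j then ∫ x in M.edge i j 0, F i j 0 x ∂(μH[1] : Measure Plane) else 0) +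
    ∑ i, ∑ j, ∫ x in M.edge i j M.period, F i j M.period x ∂(μH[1] : Measure Plane)

/-- The broken Dirichlet form `∑_T (∇v, ∇w)_T`. -/
def gradForm (v w : M.PiecewisePoly) : ℝ :=
  ∑ i, ∫ x in M.tri i, inner ℝ (grad (v i) x) (grad (w i) x)

/-- `([v], {∇w})` over interior and periodic edges. -/
def jumpAvg (v w : M.PiecewisePoly) : ℝ :=
  M.sumEdges fun i j τ x => inner ℝ (M.jump v i j τ x) (M.avgGrad w i j τ x)

/-- `([v], [w])` over interior and periodic edges. -/
def jumpJump (v w : M.PiecewisePoly) : ℝ :=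
  M.sumEdges fun i j τ x => inner ℝ (M.jump v i j τ x) (M.jump w i j τ x)

/-- `({∇v}, {∇w})` over interior and periodic edges. -/
def avgAvg (v w : M.PiecewisePoly) : ℝ :=
  M.sumEdges fun i j τ x => inner ℝ (M.avgGrad v i j τ x) (M.avgGrad w i j τ x)

/-- The interior penalty form `B_h` with penalty `σ`. -/
def Bh (σ : ℝ) (v w : M.PiecewisePoly) : ℝ :=
  M.gradForm v w - M.jumpAvg v w - M.jumpAvg w v + σ * M.jumpJump v w

/-! On `Γ₁`. The height `s` is `c` (bottom) or `d` (top). -/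

/-- Abscissa of the left end of the intersection of triangle `i` with the line at height `s`. -/
def leftEnd (i : Fin M.N) (s : ℝ) : ℝ := sInf {t : ℝ | (!₂[t, s] : Plane) ∈ M.closedTri i}

/-- Abscissa of the right end of the intersection of triangle `i` with the line at height `s`. -/
def rightEnd (i : Fin M.N) (s : ℝ) : ℝ := sSup {t : ℝ | (!₂[t, s] : Plane) ∈ M.closedTri i}

/-- Triangles `i` and `j` have edges `e⁻` and `e⁺` on the side of `Γ₁` at height `s`, and the right
end of `e⁻` is the left end of `e⁺`, where the corners of that side are identified. Such pairs
correspond to the ridges, i.e. to the mesh vertices on `Γ₁` modulo the identification. -/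
def IsRidge (s : ℝ) (i j : Fin M.N) : Prop :=
  M.leftEnd i s < M.rightEnd i s ∧ M.leftEnd j s < M.rightEnd j s ∧
    (M.rightEnd i s = M.leftEnd j s ∨ (M.rightEnd i s = b ∧ M.leftEnd j s = a))

/-- The jump `v⁺(r) n⁺ + v⁻(r) n⁻` at a ridge; the unit tangent vector pointing out of the left edge
is `(1,0)`, the one pointing out of the right edge is `(-1,0)`. -/
def ridgeJump (v : M.PiecewisePoly) (s : ℝ) (i j : Fin M.N) : Plane :=
  val (v j) !₂[M.leftEnd j s, s] • (!₂[-1, 0] : Plane) +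
    val (v i) !₂[M.rightEnd i s, s] • (!₂[1, 0] : Plane)

/-- The average of the tangential gradient at a ridge. -/
def ridgeAvg (v : M.PiecewisePoly) (s : ℝ) (i j : Fin M.N) : Plane :=
  (1 / 2 : ℝ) •
    (tangGrad (v j) !₂[M.leftEnd j s, s] + tangGrad (v i) !₂[M.rightEnd i s, s])

open Classical in
/-- Sum over all ridges. -/
def sumRidges (F : ℝ → Fin M.N → Fin M.N → ℝ) : ℝ :=
  ∑ i, ∑ j, ((if M.IsRidge c i j then F c i j else 0) + (if M.IsRidge d i j then F d i j else 0))

/-- `(∇_Γ v, ∇_Γ w)` over the edges on `Γ₁`. -/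
def tangForm (v w : M.PiecewisePoly) : ℝ :=
  M.sumGamma1 fun i x => inner ℝ (tangGrad (v i) x) (tangGrad (w i) x)

/-- `([v], {∇_Γ w})` over the ridges. -/
def ridgeJumpAvg (v w : M.PiecewisePoly) : ℝ :=
  M.sumRidges fun s i j => inner ℝ (M.ridgeJump v s i j) (M.ridgeAvg w s i j)

/-- `([v], [w])` over the ridges. -/
def ridgeJumpJump (v w : M.PiecewisePoly) : ℝ :=
  M.sumRidges fun s i j => inner ℝ (M.ridgeJump v s i j) (M.ridgeJump w s i j)

/-- `({∇_Γ v}, {∇_Γ w})` over the ridges. -/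
def ridgeAvgAvg (v w : M.PiecewisePoly) : ℝ :=
  M.sumRidges fun s i j => inner ℝ (M.ridgeAvg v s i j) (M.ridgeAvg w s i j)

/-- The interior penalty form `b_h` on `Γ₁` with penalty `σ`. -/
def bh (σ : ℝ) (v w : M.PiecewisePoly) : ℝ :=
  M.tangForm v w - M.ridgeJumpAvg v w - M.ridgeJumpAvg w v + σ * M.ridgeJumpJump v w

/-- The form `A_h = B_h + α (·,·)_{L²(Γ₁)} + β b_h` with penalty `σ = γ / h`. -/
def Ah (α β γ : ℝ) (v w : M.PiecewisePoly) : ℝ :=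
  M.Bh (γ / M.h) v w + α * M.innerGamma1 v w + β * M.bh (γ / M.h) v w

/-- The square of the energy norm, with `σ = γ / h`. -/
def energySq (α β γ : ℝ) (w : M.PiecewisePoly) : ℝ :=
  (M.gradForm w w + γ / M.h * M.jumpJump w w + 1 / (γ / M.h) * M.avgAvg w w) +
    α * M.innerGamma1 w w + β * M.tangForm w w + β * (γ / M.h) * M.ridgeJumpJump w w +
    β / (γ / M.h) * M.ridgeAvgAvg w w

/-- `u 0, …, u K` solve the backward Euler discontinuous Galerkin scheme with time step `Δt`,
source `f` and boundary source `g`; the initial value `u 0` is any element of `V^p`. -/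
def IsBackwardEulerSolution (α β lam γ : ℝ) (p : ℕ) (Δt : ℝ) (K : ℕ) (f g : ℝ → Plane → ℝ)
    (u : ℕ → M.PiecewisePoly) : Prop :=
  (∀ k ≤ K, u k ∈ M.V p) ∧
    ∀ k < K, ∀ v ∈ M.V p,
      M.innerOmega (Δt⁻¹ • (u (k + 1) - u k)) v + lam * M.innerGamma1 (Δt⁻¹ • (u (k + 1) - u k)) v +
          M.Ah α β γ (u (k + 1)) v =
        M.pairOmega (f ((k + 1 : ℕ) * Δt)) v + M.pairGamma1 (g ((k + 1 : ℕ) * Δt)) v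

end Mesh

end DG

end

noncomputable section

namespace DG

/-! ### Polynomials on the plane -/

/-! The scheme is tested with its own solution `w = u (k+1)`. The time difference then dominates
half the increment of the squared `L²_λ` norm, because `(w - u) w - (w² - u²) / 2 = (w - u)² / 2`.
The form dominates half the squared energy norm (`exists_coercive`). The sources are split by
Young's inequality, and their `w`-part is absorbed into the energy. Summing over the time steps
telescopes.

Coercivity is the usual interior penalty argument. Young's inequality bounds the mixed terms by
jumps and averages of gradients. Inverse inequalities bound the averages by `C / h` times the
Dirichlet terms (`exists_avgAvg_le`, `exists_ridgeAvgAvg_le`), so that with `σ = γ / h` a large `γ`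
makes them small. The inverse inequalities come from finite dimensionality and scaling. They need
only a ball of radius `ρ h` in each triangle or, on `Γ₁`, a lower bound `ρ h` for the length of the
boundary edges. This is the only place where the degree `p` enters, and it affects only the
threshold `γ₀`.

Absorbing the source `f` requires the energy norm to control the `L²(Ω)` norm. Since `C` must not
depend on `p`, this is proved without inverse inequalities (`innerOmega_le`). On almost every
vertical line the function is bounded by its value on the bottom side plus its oscillations and
jumps along the line. Such a line meets at most `C / h` triangles, so Cauchy-Schwarz loses a factor
`1 / h`. For the oscillations it is recovered from the height of a slice, which is at most `h`; for
the jumps it is supplied by the penalty `γ / h`. Integration over the abscissa turns these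
quantities into area integrals and edge integrals, since projection to the horizontal axis does not
increase length.

Neither conformity nor a bound on the number of neighbours is assumed. All cardinalities come from
comparing areas: the open triangles are disjoint and each contains a ball of radius `ρ h`. -/

lemma continuous_val (q : MvPolynomial (Fin 2) ℝ) : Continuous (val q) := by
  unfold val
  exact (MvPolynomial.continuous_eval q).comp (by fun_prop)

@[fun_prop]
lemma continuous_val_comp {X : Type*} [TopologicalSpace X] (q : MvPolynomial (Fin 2) ℝ)
    {f : X → Plane} (hf : Continuous f) : Continuous fun x => val q (f x) :=
  (continuous_val q).comp hf

lemma val_sub (q r : MvPolynomial (Fin 2) ℝ) (x : Plane) : val (q - r) x = val q x - val r x := by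
  simp [val]

lemma val_smul (t : ℝ) (q : MvPolynomial (Fin 2) ℝ) (x : Plane) : val (t • q) x = t * val q x := by
  simp [val, MvPolynomial.smul_eval]

@[fun_prop]
lemma continuous_mkPlane {X : Type*} [TopologicalSpace X] {f g : X → ℝ}
    (hf : Continuous f) (hg : Continuous g) : Continuous fun x => (!₂[f x, g x] : Plane) := by
  refine (PiLp.continuous_toLp 2 _).comp (continuous_pi fun i => ?_)
  fin_cases i
  · exact hf
  · exact hg

@[fun_prop]
lemma continuous_grad_comp {X : Type*} [TopologicalSpace X] (q : MvPolynomial (Fin 2) ℝ)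
    {f : X → Plane} (hf : Continuous f) : Continuous fun x => grad q (f x) := by
  unfold grad
  fun_prop

@[fun_prop]
lemma continuous_tangGrad_comp {X : Type*} [TopologicalSpace X] (q : MvPolynomial (Fin 2) ℝ)
    {f : X → Plane} (hf : Continuous f) : Continuous fun x => tangGrad q (f x) := by
  unfold tangGrad
  fun_prop

lemma norm_sq_plane (x : Plane) : ‖x‖ ^ 2 = x 0 ^ 2 + x 1 ^ 2 := by
  simp [EuclideanSpace.norm_sq_eq]

lemma inner_plane (x y : Plane) : inner ℝ x y = x 0 * y 0 + x 1 * y 1 := by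
  simp [PiLp.inner_apply]
  ring

lemma plane_ext {x y : Plane} (h0 : x 0 = y 0) (h1 : x 1 = y 1) : x = y := by
  ext i
  fin_cases i
  · exact h0
  · exact h1

lemma grad_norm_sq (q : MvPolynomial (Fin 2) ℝ) (x : Plane) :
    ‖grad q x‖ ^ 2 = val (MvPolynomial.pderiv 0 q) x ^ 2 + val (MvPolynomial.pderiv 1 q) x ^ 2 := by
  simp [norm_sq_plane, grad]

lemma tangGrad_eq (q : MvPolynomial (Fin 2) ℝ) (x : Plane) :
    tangGrad q x = !₂[val (MvPolynomial.pderiv 0 q) x, 0] := by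
  apply plane_ext <;> simp [tangGrad, grad, inner_plane]

lemma tangGrad_norm_sq (q : MvPolynomial (Fin 2) ℝ) (x : Plane) :
    ‖tangGrad q x‖ ^ 2 = val (MvPolynomial.pderiv 0 q) x ^ 2 := by
  simp [norm_sq_plane, tangGrad_eq]

/-! ### The plane as a product -/

/-- Cartesian coordinates as a measurable equivalence. -/
def coords : Plane ≃ᵐ ℝ × ℝ :=
  (MeasurableEquiv.toLp 2 (Fin 2 → ℝ)).symm.trans MeasurableEquiv.finTwoArrow

lemma coords_apply (x : Plane) : coords x = (x 0, x 1) := rfl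

lemma measurePreserving_coords : MeasurePreserving coords := by
  unfold coords
  exact (PiLp.volume_preserving_ofLp (Fin 2)).trans (volume_preserving_finTwoArrow ℝ)

lemma volume_box (a b c d : ℝ) :
    volume {x : Plane | x 0 ∈ Set.Icc a b ∧ x 1 ∈ Set.Icc c d} =
      ENNReal.ofReal (b - a) * ENNReal.ofReal (d - c) := by
  have : {x : Plane | x 0 ∈ Set.Icc a b ∧ x 1 ∈ Set.Icc c d} =
      coords ⁻¹' (Set.Icc a b ×ˢ Set.Icc c d) := by
    ext x; simp [coords_apply, and_and_and_comm]
  rw [this, measurePreserving_coords.measure_preimage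
    (measurableSet_Icc.prod measurableSet_Icc).nullMeasurableSet, Measure.volume_eq_prod,
    Measure.prod_prod, Real.volume_Icc, Real.volume_Icc]

/-! ### The rectangle -/

lemma Omega_eq_preimage (a b c d : ℝ) :
    Omega a b c d = (fun x : Plane => x 0) ⁻¹' Set.Ioo a b ∩ (fun x : Plane => x 1) ⁻¹' Set.Ioo c d :=
  rfl

lemma isOpen_Omega (a b c d : ℝ) : IsOpen (Omega a b c d) := by
  rw [Omega_eq_preimage]
  exact (isOpen_Ioo.preimage (by fun_prop)).inter (isOpen_Ioo.preimage (by fun_prop))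

lemma convex_Omega (a b c d : ℝ) : Convex ℝ (Omega a b c d) := by
  rw [Omega_eq_preimage]
  exact ((convex_Ioo a b).linear_preimage (EuclideanSpace.proj (𝕜 := ℝ) (0 : Fin 2)).toLinearMap).inter
    ((convex_Ioo c d).linear_preimage (EuclideanSpace.proj (𝕜 := ℝ) (1 : Fin 2)).toLinearMap)

lemma Omega_nonempty {a b c d : ℝ} (hab : a < b) (hcd : c < d) : (Omega a b c d).Nonempty :=
  ⟨!₂[(a + b) / 2, (c + d) / 2], by
    simp only [Omega, Set.mem_ofPred_eq, Set.mem_Ioo]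
    simp
    refine ⟨⟨?_, ?_⟩, ?_, ?_⟩ <;> linarith⟩

lemma interior_closure_Omega (a b c d : ℝ) : interior (closure (Omega a b c d)) = Omega a b c d := by
  by_cases hne : (Omega a b c d).Nonempty
  · rw [(convex_Omega a b c d).interior_closure_eq_interior_of_nonempty_interior
      (by rwa [(isOpen_Omega a b c d).interior_eq]), (isOpen_Omega a b c d).interior_eq]
  · rw [Set.not_nonempty_iff_eq_empty] at hne
    simp [hne]

lemma mem_closure_Omega_iff {a b c d : ℝ} (hab : a < b) (hcd : c < d) {x : Plane} :
    x ∈ closure (Omega a b c d) ↔ x 0 ∈ Set.Icc a b ∧ x 1 ∈ Set.Icc c d := by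
  constructor
  · intro hx
    have hcl : IsClosed {x : Plane | x 0 ∈ Set.Icc a b ∧ x 1 ∈ Set.Icc c d} :=
      (isClosed_Icc.preimage (f := fun x : Plane => x 0) (by fun_prop)).inter
        (isClosed_Icc.preimage (f := fun x : Plane => x 1) (by fun_prop))
    refine closure_minimal ?_ hcl hx
    exact fun y hy => ⟨Set.Ioo_subset_Icc_self hy.1, Set.Ioo_subset_Icc_self hy.2⟩
  · rintro ⟨h0, h1⟩
    rw [← closure_Ioo hab.ne] at h0
    rw [← closure_Ioo hcd.ne] at h1
    have hmem : ((x 0, x 1) : ℝ × ℝ) ∈ closure (Set.Ioo a b ×ˢ Set.Ioo c d) := by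
      rw [closure_prod_eq]; exact ⟨h0, h1⟩
    have hcont : Continuous fun z : ℝ × ℝ => (!₂[z.1, z.2] : Plane) := by fun_prop
    have := image_closure_subset_closure_image hcont (Set.mem_image_of_mem _ hmem)
    have hx : (!₂[x 0, x 1] : Plane) = x := by apply plane_ext <;> simp
    rw [← hx]
    refine closure_mono ?_ this
    rintro _ ⟨z, hz, rfl⟩
    exact ⟨by simpa using hz.1, by simpa using hz.2⟩

/-! ### Triangles of a mesh -/

namespace Mesh

variable {a b c d : ℝ} (M : Mesh a b c d)

lemma convex_closedTri (i : Fin M.N) : Convex ℝ (M.closedTri i) := convex_convexHull ℝ _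

lemma isCompact_closedTri (i : Fin M.N) : IsCompact (M.closedTri i) :=
  (Set.finite_range _).isCompact_convexHull ℝ

lemma isClosed_closedTri (i : Fin M.N) : IsClosed (M.closedTri i) := (M.isCompact_closedTri i).isClosed

lemma vert_mem (i : Fin M.N) (k : Fin 3) : M.vert i k ∈ M.closedTri i :=
  subset_convexHull ℝ _ (Set.mem_range_self k)

lemma isOpen_tri (i : Fin M.N) : IsOpen (M.tri i) := isOpen_interior

lemma tri_subset (i : Fin M.N) : M.tri i ⊆ M.closedTri i := interior_subset

lemma tri_nonempty (i : Fin M.N) : (M.tri i).Nonempty := by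
  unfold tri closedTri
  rw [interior_convexHull_nonempty_iff_affineSpan_eq_top]
  rw [(M.affineIndependent i).affineSpan_eq_top_iff_card_eq_finrank_add_one]
  simp

lemma closedTri_subset (i : Fin M.N) : M.closedTri i ⊆ closure (Omega a b c d) := by
  rw [← M.cover]
  exact Set.subset_iUnion (fun i => convexHull ℝ (Set.range (M.vert i))) i

lemma tri_subset_Omega (i : Fin M.N) : M.tri i ⊆ Omega a b c d := by
  rw [← interior_closure_Omega]
  exact interior_mono (M.closedTri_subset i)

lemma closure_tri (i : Fin M.N) : closure (M.tri i) = M.closedTri i := by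
  unfold tri
  rw [(M.convex_closedTri i).closure_interior_eq_closure_of_nonempty_interior (M.tri_nonempty i),
    (M.isClosed_closedTri i).closure_eq]

lemma disjoint_tri {i j : Fin M.N} (hij : i ≠ j) : Disjoint (M.tri i) (M.tri j) :=
  M.disjoint i j hij

lemma diam_le_h (i : Fin M.N) : Metric.diam (M.closedTri i) ≤ M.h :=
  le_ciSup (f := fun i => Metric.diam (M.closedTri i)) (Set.finite_range _).bddAbove i

lemma dist_le_h {i : Fin M.N} {x y : Plane} (hx : x ∈ M.closedTri i) (hy : y ∈ M.closedTri i) :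
    dist x y ≤ M.h :=
  (Metric.dist_le_diam_of_mem (M.isCompact_closedTri i).isBounded hx hy).trans (M.diam_le_h i)

lemma exists_mem_closedTri {x : Plane} (hx : x ∈ closure (Omega a b c d)) :
    ∃ i, x ∈ M.closedTri i := by
  rw [← M.cover] at hx
  exact Set.mem_iUnion.1 hx

lemma h_pos_of_index (i : Fin M.N) : 0 < M.h := by
  have hne : M.vert i 0 ≠ M.vert i 1 := fun h => by
    have := (M.affineIndependent i).injective h
    exact absurd this (by decide)
  exact (dist_pos.2 hne).trans_le (M.dist_le_h (M.vert_mem i 0) (M.vert_mem i 1))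

lemma h_pos (hab : a < b) (hcd : c < d) : 0 < M.h := by
  obtain ⟨x, hx⟩ := Omega_nonempty hab hcd
  obtain ⟨i, -⟩ := M.exists_mem_closedTri (subset_closure hx)
  exact M.h_pos_of_index i

/-! ### Counting triangles by area -/

variable {M}

/-- The inscribed balls lie in disjoint open triangles, so their areas add up to at most the area of
`U`. Every later bound on a number of triangles is an instance of this. -/
lemma card_mul_area_le {ρ : ℝ} (hQ : M.QuasiUniform ρ) (S : Finset (Fin M.N)) {U : Set Plane}
    (hU : ∀ i ∈ S, M.closedTri i ⊆ U) :
    (S.card : ENNReal) * (ENNReal.ofReal (ρ * M.h) ^ 2 * ENNReal.ofReal Real.pi) ≤ volume U := by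
  choose z hz using hQ
  calc (S.card : ENNReal) * (ENNReal.ofReal (ρ * M.h) ^ 2 * ENNReal.ofReal Real.pi)
      = ∑ i ∈ S, volume (Metric.ball (z i) (ρ * M.h)) := by
        simp only [EuclideanSpace.volume_ball_fin_two]
        rw [Finset.sum_const, nsmul_eq_mul]
    _ ≤ ∑ i ∈ S, volume (M.tri i) := Finset.sum_le_sum fun i _ => measure_mono (hz i)
    _ = volume (⋃ i ∈ S, M.tri i) := by
        rw [measure_biUnion_finset]
        · exact fun i _ j _ hij => M.disjoint_tri hij
        · exact fun i _ => (M.isOpen_tri i).measurableSet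
    _ ≤ volume U := measure_mono (Set.iUnion₂_subset fun i hi => (M.tri_subset i).trans (hU i hi))

lemma card_mul_area_le_real {ρ : ℝ} (hρ : 0 < ρ) (hQ : M.QuasiUniform ρ) (S : Finset (Fin M.N))
    {U : Set Plane} {A : ℝ} (hA : 0 ≤ A) (hU : ∀ i ∈ S, M.closedTri i ⊆ U)
    (hvol : volume U ≤ ENNReal.ofReal A) : (S.card : ℝ) * ((ρ * M.h) ^ 2 * Real.pi) ≤ A := by
  rcases S.eq_empty_or_nonempty with rfl | ⟨i, hi⟩
  · simpa using hA
  have hh := M.h_pos_of_index i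
  have h1 := (card_mul_area_le hQ S hU).trans hvol
  rw [← ENNReal.ofReal_pow (by positivity), ← ENNReal.ofReal_mul (by positivity),
    ← ENNReal.ofReal_natCast, ← ENNReal.ofReal_mul (by positivity)] at h1
  exact (ENNReal.ofReal_le_ofReal_iff hA).1 h1

lemma card_le_of_subset_closedBall {ρ : ℝ} (hρ : 0 < ρ) (hQ : M.QuasiUniform ρ)
    (S : Finset (Fin M.N)) {z : Plane} {k : ℝ} (hk : 0 ≤ k)
    (hS : ∀ i ∈ S, M.closedTri i ⊆ Metric.closedBall z (k * M.h)) : (S.card : ℝ) ≤ k ^ 2 / ρ ^ 2 := by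
  rcases S.eq_empty_or_nonempty with rfl | ⟨i, hi⟩
  · simp; positivity
  have hh := M.h_pos_of_index i
  have hvol : volume (Metric.closedBall z (k * M.h)) ≤
      ENNReal.ofReal ((k * M.h) ^ 2 * Real.pi) := by
    rw [EuclideanSpace.volume_closedBall_fin_two, ENNReal.ofReal_mul (p := (k * M.h) ^ 2)
      (by positivity), ENNReal.ofReal_pow (by positivity)]
  have h1 := card_mul_area_le_real hρ hQ S (by positivity) hS hvol
  rw [le_div_iff₀ (by positivity)]
  have h2 : 0 < M.h ^ 2 * Real.pi := by positivity
  refine le_of_mul_le_mul_right ?_ h2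
  calc (S.card : ℝ) * ρ ^ 2 * (M.h ^ 2 * Real.pi) = S.card * ((ρ * M.h) ^ 2 * Real.pi) := by ring
    _ ≤ _ := h1
    _ = _ := by ring

/-- A point lies in at most `1 / ρ²` closed triangles. -/
lemma card_le_of_mem {ρ : ℝ} (hρ : 0 < ρ) (hQ : M.QuasiUniform ρ) (S : Finset (Fin M.N)) {x : Plane}
    (hS : ∀ i ∈ S, x ∈ M.closedTri i) : (S.card : ℝ) ≤ 1 / ρ ^ 2 := by
  have := card_le_of_subset_closedBall hρ hQ S (z := x) (k := 1) zero_le_one fun i hi y hy => by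
    simpa using M.dist_le_h hy (hS i hi)
  simpa using this

/-- A triangle has at most `4 / ρ²` neighbours. -/
lemma card_le_of_edge_right {ρ : ℝ} (hρ : 0 < ρ) (hQ : M.QuasiUniform ρ) (S : Finset (Fin M.N))
    (i : Fin M.N) (τ : Plane) (hS : ∀ j ∈ S, (M.edge i j τ).Nonempty) :
    (S.card : ℝ) ≤ 4 / ρ ^ 2 := by
  have := card_le_of_subset_closedBall hρ hQ S (z := M.vert i 0 + τ) (k := 2) zero_le_two
    fun j hj y hy => by
      obtain ⟨x, hx, hx'⟩ := hS j hj
      have h1 := M.dist_le_h hy hx'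
      have h2 := M.dist_le_h hx (M.vert_mem i 0)
      rw [Metric.mem_closedBall]
      calc dist y (M.vert i 0 + τ) ≤ dist y (x + τ) + dist (x + τ) (M.vert i 0 + τ) :=
            dist_triangle _ _ _
        _ ≤ 2 * M.h := by rw [dist_add_right]; linarith
  norm_num at this
  exact this

lemma card_le_of_edge_left {ρ : ℝ} (hρ : 0 < ρ) (hQ : M.QuasiUniform ρ) (S : Finset (Fin M.N))
    (j : Fin M.N) (τ : Plane) (hS : ∀ i ∈ S, (M.edge i j τ).Nonempty) :
    (S.card : ℝ) ≤ 4 / ρ ^ 2 := by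
  have := card_le_of_subset_closedBall hρ hQ S (z := M.vert j 0 - τ) (k := 2) zero_le_two
    fun i hi y hy => by
      obtain ⟨x, hx, hx'⟩ := hS i hi
      have h1 := M.dist_le_h hy hx
      have h2 := M.dist_le_h hx' (M.vert_mem j 0)
      rw [Metric.mem_closedBall]
      calc dist y (M.vert j 0 - τ) ≤ dist y x + dist x (M.vert j 0 - τ) :=
            dist_triangle _ _ _
        _ ≤ 2 * M.h := by
          rw [← dist_add_right x _ τ, sub_add_cancel]; linarith
  norm_num at this
  exact this

/-- A vertical line meets at most `C / h` triangles. -/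
lemma card_mul_h_le_of_abscissa (hab : a < b) (hcd : c < d) {ρ : ℝ} (hρ : 0 < ρ)
    (hQ : M.QuasiUniform ρ) (S : Finset (Fin M.N)) (t : ℝ)
    (hS : ∀ i ∈ S, ∃ x ∈ M.closedTri i, x 0 = t) : S.card * M.h ≤ (d - c) / ρ ^ 2 := by
  have hh := M.h_pos hab hcd
  have hcd' : 0 < d - c := sub_pos.2 hcd
  have h1 := card_mul_area_le_real hρ hQ S (A := (2 * M.h) * (d - c)) (by positivity)
    (U := {x : Plane | x 0 ∈ Set.Icc (t - M.h) (t + M.h) ∧ x 1 ∈ Set.Icc c d})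
    (fun i hi y hy => by
      obtain ⟨x, hx, rfl⟩ := hS i hi
      refine ⟨?_, ((mem_closure_Omega_iff hab hcd).1 (M.closedTri_subset i hy)).2⟩
      have h2 := M.dist_le_h hy hx
      have h3 : |y 0 - x 0| ≤ dist y x := by
        rw [dist_eq_norm]
        simpa using PiLp.norm_apply_le (y - x) 0
      have := abs_le.1 (h3.trans h2)
      constructor <;> linarith)
    (by
      rw [volume_box, ← ENNReal.ofReal_mul (by linarith)]
      apply le_of_eq; congr 1; ring)
  rw [le_div_iff₀ (by positivity)]
  -- The triangles lie in a strip of width `2 h`; the factor `2` is absorbed by `2 ≤ π`.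
  have hpi : 2 ≤ Real.pi := Real.two_le_pi
  have h4 : 0 < 2 * M.h := by positivity
  refine le_of_mul_le_mul_left ?_ h4
  calc 2 * M.h * (S.card * M.h * ρ ^ 2) = S.card * ((ρ * M.h) ^ 2 * 2) := by ring
    _ ≤ S.card * ((ρ * M.h) ^ 2 * Real.pi) := by gcongr
    _ ≤ _ := h1

end Mesh
/-! ### One-dimensional Hausdorff measure in the plane -/

lemma abs_coord_sub_le (x y : Plane) (k : Fin 2) : |x k - y k| ≤ dist x y := by
  rw [dist_eq_norm]
  simpa using PiLp.norm_apply_le (x - y) k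

/-- Orthogonal projection is 1-Lipschitz, and one-dimensional Hausdorff measure on `ℝ` is Lebesgue
measure. This inequality alone transfers integrals over abscissae to integrals over edges; no arc
length formula is needed. -/
lemma volume_image_abscissa_le (E : Set Plane) :
    volume ((fun x : Plane => x 0) '' E) ≤ (μH[1] : Measure Plane) E := by
  have hL : LipschitzWith 1 (fun x : Plane => x 0) :=
    LipschitzWith.of_dist_le_mul fun x y => by
      simpa [Real.dist_eq] using abs_coord_sub_le x y 0
  have := hL.hausdorffMeasure_image_le (d := 1) zero_le_one E
  rw [hausdorffMeasure_real] at this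
  simpa using this

/-- The image of Lebesgue measure under a section of the first coordinate is dominated by
arc length. -/
lemma map_section_le {s : ℝ → Plane} (hs : Continuous s) (hs0 : ∀ t, s t 0 = t) {A : Set ℝ}
    {E : Set Plane} (hAE : ∀ t ∈ A, s t ∈ E) :
    Measure.map s (volume.restrict A) ≤ (μH[1] : Measure Plane).restrict E := by
  refine Measure.le_iff.2 fun B hB => ?_
  rw [Measure.map_apply hs.measurable hB, Measure.restrict_apply (hs.measurable hB),
    Measure.restrict_apply hB]
  refine le_trans (measure_mono ?_) (volume_image_abscissa_le (B ∩ E))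
  rintro t ⟨htB, htA⟩
  exact ⟨s t, ⟨htB, hAE t htA⟩, hs0 t⟩

lemma integral_section_le {s : ℝ → Plane} (hs : Continuous s) (hs0 : ∀ t, s t 0 = t) {A : Set ℝ}
    {E : Set Plane} (hAE : ∀ t ∈ A, s t ∈ E) {F : Plane → ℝ} (hF : Continuous F) (hF0 : ∀ x, 0 ≤ F x)
    (hFint : IntegrableOn F E (μH[1] : Measure Plane)) :
    ∫ t in A, F (s t) ≤ ∫ x in E, F x ∂(μH[1] : Measure Plane) := by
  rw [← integral_map hs.aemeasurable hF.aestronglyMeasurable]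
  exact integral_mono_measure (map_section_le hs hs0 hAE) (ae_of_all _ hF0) hFint

/-- The set is covered by the isometric image of `[-D, D]`, centred at one of its points. This gives
`2 D` instead of the sharp `D`, which only affects constants. -/
lemma hausdorffMeasure_le_of_subset_line {E : Set Plane} {n : Plane} {u D : ℝ} (hn : ‖n‖ = 1)
    (hE : ∀ x ∈ E, inner ℝ n x = u) (hD : ∀ x ∈ E, ∀ y ∈ E, dist x y ≤ D) :
    (μH[1] : Measure Plane) E ≤ ENNReal.ofReal (2 * D) := by
  rcases E.eq_empty_or_nonempty with rfl | ⟨z, hz⟩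
  · simp
  have hn2 : n 0 ^ 2 + n 1 ^ 2 = 1 := by rw [← norm_sq_plane, hn, one_pow]
  set e : Plane := !₂[-n 1, n 0] with he
  have he1 : ‖e‖ = 1 := by
    rw [← sq_eq_sq₀ (norm_nonneg _) zero_le_one, norm_sq_plane]
    simp [he]; linarith
  have hL : LipschitzWith 1 (fun t : ℝ => z + t • e) :=
    LipschitzWith.of_dist_le_mul fun s t => by
      rw [dist_add_left, dist_eq_norm, ← sub_smul, norm_smul, he1]
      simp [Real.dist_eq]
  have hsub : E ⊆ (fun t : ℝ => z + t • e) '' Set.Icc (-D) D := by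
    intro x hx
    have h1 : n 0 * (x 0 - z 0) + n 1 * (x 1 - z 1) = 0 := by
      have h2 := hE x hx
      have h3 := hE z hz
      rw [inner_plane] at h2 h3
      linarith
    refine ⟨inner ℝ e (x - z), ?_, ?_⟩
    · have := abs_real_inner_le_norm e (x - z)
      rw [he1, one_mul, ← dist_eq_norm] at this
      exact abs_le.1 (this.trans (hD x hx z hz))
    · apply plane_ext
      · simp [inner_plane, he]
        linear_combination (x 0 - z 0) * hn2 - n 0 * h1
      · simp [inner_plane, he]
        linear_combination (x 1 - z 1) * hn2 - n 1 * h1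
  have h4 := hL.hausdorffMeasure_image_le (d := 1) zero_le_one (Set.Icc (-D) D)
  rw [hausdorffMeasure_real, Real.volume_Icc] at h4
  refine (measure_mono hsub).trans (h4.trans ?_)
  simp only [ENNReal.coe_one, ENNReal.one_rpow, one_mul]
  apply ENNReal.ofReal_le_ofReal
  linarith

lemma integrableOn_of_continuous_of_isCompact {X G : Type*} [TopologicalSpace X] [MeasurableSpace X]
    [OpensMeasurableSpace X] [T2Space X] [NormedAddCommGroup G] [SecondCountableTopologyEither X G]
    {μ : Measure X} {E : Set X} (hE : IsCompact E) (hμ : μ E < ⊤) {F : X → G} (hF : Continuous F) :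
    IntegrableOn F E μ := by
  obtain ⟨B, hB⟩ := hE.exists_bound_of_continuousOn hF.continuousOn
  exact Measure.integrableOn_of_bounded hμ.ne hF.aestronglyMeasurable
    ((ae_restrict_iff' hE.measurableSet).2 (ae_of_all _ hB))

lemma isClosed_Gamma1 (a b c d : ℝ) : IsClosed (Gamma1 a b c d) :=
  (isClosed_Icc.preimage (f := fun x : Plane => x 0) (by fun_prop)).inter
    ((isClosed_eq (f := fun x : Plane => x 1) (by fun_prop) continuous_const).union
      (isClosed_eq (f := fun x : Plane => x 1) (by fun_prop) continuous_const))

lemma hausdorffMeasure_side_lt_top (a b s : ℝ) :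
    (μH[1] : Measure Plane) {x | x 0 ∈ Set.Icc a b ∧ x 1 = s} < ⊤ := by
  refine (hausdorffMeasure_le_of_subset_line (n := !₂[0, 1]) (u := s) (D := |b - a|) ?_ ?_ ?_).trans_lt
    ENNReal.ofReal_lt_top
  · rw [← sq_eq_sq₀ (norm_nonneg _) zero_le_one, norm_sq_plane]
    simp
  · rintro x ⟨-, hx⟩
    simp [inner_plane, hx]
  · rintro x ⟨hx0, hx⟩ y ⟨hy0, hy⟩
    have h1 : ‖x - y‖ ^ 2 = (x 0 - y 0) ^ 2 := by simp [norm_sq_plane, hx, hy]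
    have h2 : (x 0 - y 0) ^ 2 ≤ (b - a) ^ 2 :=
      sq_le_sq' (by linarith [hx0.1, hy0.2]) (by linarith [hx0.2, hy0.1])
    rw [dist_eq_norm]
    exact abs_le_of_sq_le_sq' (by rwa [h1, sq_abs]) (abs_nonneg _) |>.2

lemma hausdorffMeasure_Gamma1_lt_top (a b c d : ℝ) :
    (μH[1] : Measure Plane) (Gamma1 a b c d) < ⊤ := by
  have hsub : Gamma1 a b c d ⊆
      {x | x 0 ∈ Set.Icc a b ∧ x 1 = c} ∪ {x | x 0 ∈ Set.Icc a b ∧ x 1 = d} := fun x hx =>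
    hx.2.elim (fun h => Or.inl ⟨hx.1, h⟩) (fun h => Or.inr ⟨hx.1, h⟩)
  exact ((measure_mono hsub).trans (measure_union_le _ _)).trans_lt (ENNReal.add_lt_top.2
    ⟨hausdorffMeasure_side_lt_top a b c, hausdorffMeasure_side_lt_top a b d⟩)

namespace Mesh

variable {a b c d : ℝ} (M : Mesh a b c d)

lemma isCompact_closedTri_inter_Gamma1 (i : Fin M.N) :
    IsCompact (M.closedTri i ∩ Gamma1 a b c d) :=
  (M.isCompact_closedTri i).inter_right (isClosed_Gamma1 a b c d)

lemma integrableOn_Gamma1 {G : Type*} [NormedAddCommGroup G] [SecondCountableTopologyEither Plane G]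
    (i : Fin M.N) {F : Plane → G} (hF : Continuous F) :
    IntegrableOn F (M.closedTri i ∩ Gamma1 a b c d) (μH[1] : Measure Plane) :=
  integrableOn_of_continuous_of_isCompact (M.isCompact_closedTri_inter_Gamma1 i)
    ((measure_mono Set.inter_subset_right).trans_lt (hausdorffMeasure_Gamma1_lt_top a b c d)) hF

lemma integrableOn_tri {G : Type*} [NormedAddCommGroup G] [SecondCountableTopologyEither Plane G]
    (i : Fin M.N) {F : Plane → G} (hF : Continuous F) : IntegrableOn F (M.tri i) :=
  (integrableOn_of_continuous_of_isCompact (M.isCompact_closedTri i)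
    (M.isCompact_closedTri i).measure_lt_top hF).mono_set (M.tri_subset i)

/-! ### Edges -/

lemma edge_eq (i j : Fin M.N) (τ : Plane) :
    M.edge i j τ = M.closedTri i ∩ (fun x => x + τ) ⁻¹' M.closedTri j := rfl

lemma isCompact_edge (i j : Fin M.N) (τ : Plane) : IsCompact (M.edge i j τ) := by
  rw [edge_eq]
  exact (M.isCompact_closedTri i).inter_right ((M.isClosed_closedTri j).preimage (by fun_prop))

/-- Triangle `i` and the translate by `-τ` of triangle `j` do not overlap. -/
def NonOverlapping (i j : Fin M.N) (τ : Plane) : Prop :=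
  Disjoint (M.tri i) ((fun x => x + τ) ⁻¹' M.tri j)

variable {M}

lemma nonOverlapping_zero {i j : Fin M.N} (hij : i ≠ j) : M.NonOverlapping i j 0 := by
  simpa [NonOverlapping] using M.disjoint_tri hij

lemma nonOverlapping_period (i j : Fin M.N) : M.NonOverlapping i j M.period := by
  refine Set.disjoint_left.2 fun x hx hx' => ?_
  have h1 := (M.tri_subset_Omega i hx).1
  have h2 := (M.tri_subset_Omega j hx').1
  simp [period] at h1 h2
  linarith

/-- Hahn-Banach separation of two convex sets, one of which has interior points. The separating line
contains the common edge, and its normal is the outward normal of one triangle and the inward normal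
of the other. -/
lemma NonOverlapping.exists_separating {i j : Fin M.N} {τ : Plane} (hO : M.NonOverlapping i j τ) :
    ∃ (n : Plane) (u : ℝ), ‖n‖ = 1 ∧ (∀ x ∈ M.closedTri i, inner ℝ n x ≤ u) ∧
      ∀ x, x + τ ∈ M.closedTri j → u ≤ inner ℝ n x := by
  have hconv : Convex ℝ ((fun x : Plane => x + τ) ⁻¹' M.closedTri j) :=
    (M.convex_closedTri j).translate_preimage_left τ
  -- An open set disjoint from a set is disjoint from its closure, so the second open triangle may
  -- be replaced by the closed one.
  have hdisj : Disjoint (interior (M.closedTri i)) ((fun x : Plane => x + τ) ⁻¹' M.closedTri j) := by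
    have h1 := hO.closure_right (M.isOpen_tri i)
    have h2 : closure ((fun x : Plane => x + τ) ⁻¹' M.tri j) =
        (fun x : Plane => x + τ) ⁻¹' M.closedTri j := by
      rw [← M.closure_tri j]
      exact ((Homeomorph.addRight τ).preimage_closure (M.tri j)).symm
    rwa [h2] at h1
  obtain ⟨f, u, hf0, hi, hj⟩ := geometric_hahn_banach_of_nonempty_interior (M.convex_closedTri i)
    hconv hdisj (M.tri_nonempty i) ⟨M.vert j 0 - τ, by simpa using M.vert_mem j 0⟩
  set m : Plane := (InnerProductSpace.toDual ℝ Plane).symm f with hm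
  have hmf (x : Plane) : inner ℝ m x = f x := by rw [hm, InnerProductSpace.toDual_symm_apply]
  have hm0 : m ≠ 0 := by simpa [hm] using hf0
  have hpos : 0 < ‖m‖ := norm_pos_iff.2 hm0
  refine ⟨‖m‖⁻¹ • m, ‖m‖⁻¹ * u, ?_, fun x hx => ?_, fun x hx => ?_⟩
  · rw [norm_smul, norm_inv, norm_norm, inv_mul_cancel₀ hpos.ne']
  · rw [real_inner_smul_left, hmf]
    exact mul_le_mul_of_nonneg_left (hi x hx) (by positivity)
  · rw [real_inner_smul_left, hmf]
    exact mul_le_mul_of_nonneg_left (hj x hx) (by positivity)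

/-- Away from the vertices the outward normal of a triangle is unique. -/
lemma outwardNormal_eq {i : Fin M.N} {x n : Plane} (hx : x ∈ M.closedTri i)
    (hxv : x ∉ Set.range (M.vert i)) (hn : IsOutwardNormal (M.closedTri i) x n) :
    outwardNormal (M.closedTri i) x = n := by
  have hm : IsOutwardNormal (M.closedTri i) x (outwardNormal (M.closedTri i) x) :=
    Classical.epsilon_spec (p := IsOutwardNormal (M.closedTri i) x) ⟨n, hn⟩
  set m := outwardNormal (M.closedTri i) x
  -- The extreme points of a triangle are vertices, so `x` is inside a nondegenerate segment of the
  -- triangle. Every outward normal at `x` is orthogonal to that segment, and in the plane this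
  -- leaves only two opposite unit vectors.
  have hext : x ∉ Set.extremePoints ℝ (M.closedTri i) := fun h =>
    hxv (extremePoints_convexHull_subset h)
  rw [mem_extremePoints] at hext
  push Not at hext
  obtain ⟨y, hy, z, hz, ⟨s, t, hs, ht, hst, hxyz⟩, hne⟩ := hext hx
  have key (k : Plane) (hk : IsOutwardNormal (M.closedTri i) x k) :
      inner ℝ k (y - x) = 0 ∧ inner ℝ k (z - x) = 0 := by
    have h1 := hk.2 y hy
    have h2 := hk.2 z hz
    have h3 : s * inner ℝ k (y - x) + t * inner ℝ k (z - x) = 0 := by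
      rw [← real_inner_smul_right, ← real_inner_smul_right, ← inner_add_right, smul_sub, smul_sub,
        sub_add_sub_comm, hxyz, ← add_smul, hst, one_smul, sub_self, inner_zero_right]
    constructor
    · nlinarith
    · nlinarith
  obtain ⟨w, hw, hmw, hnw⟩ : ∃ w : Plane, w ≠ 0 ∧ inner ℝ m w = 0 ∧ inner ℝ n w = 0 := by
    by_cases hyx : y = x
    · exact ⟨z - x, sub_ne_zero.2 (hne hyx), (key m hm).2, (key n hn).2⟩
    · exact ⟨y - x, sub_ne_zero.2 hyx, (key m hm).1, (key n hn).1⟩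
  rw [inner_plane] at hmw hnw
  have hdet : m 0 * n 1 - m 1 * n 0 = 0 := by
    by_contra hd
    apply hw
    apply plane_ext
    · have : (m 0 * n 1 - m 1 * n 0) * w 0 = 0 := by linear_combination n 1 * hmw - m 1 * hnw
      simpa [hd] using this
    · have : (m 0 * n 1 - m 1 * n 0) * w 1 = 0 := by linear_combination m 0 * hnw - n 0 * hmw
      simpa [hd] using this
  have hm1 : m 0 ^ 2 + m 1 ^ 2 = 1 := by rw [← norm_sq_plane, hm.1, one_pow]
  have hn1 : n 0 ^ 2 + n 1 ^ 2 = 1 := by rw [← norm_sq_plane, hn.1, one_pow]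
  -- Lagrange's identity with vanishing determinant: the inner product of the two unit vectors is
  -- `1` or `-1`.
  have hsq : (m 0 * n 0 + m 1 * n 1 - 1) * (m 0 * n 0 + m 1 * n 1 + 1) = 0 := by
    linear_combination hm1 * (n 0 ^ 2 + n 1 ^ 2) + hn1 - (m 0 * n 1 - m 1 * n 0) * hdet
  rcases mul_eq_zero.1 hsq with h | h
  · have h0 : (m 0 - n 0) ^ 2 + (m 1 - n 1) ^ 2 = 0 := by linear_combination hm1 + hn1 - 2 * h
    apply plane_ext
    · nlinarith [sq_nonneg (m 0 - n 0), sq_nonneg (m 1 - n 1)]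
    · nlinarith [sq_nonneg (m 0 - n 0), sq_nonneg (m 1 - n 1)]
  · exfalso
    have h0 : (m 0 + n 0) ^ 2 + (m 1 + n 1) ^ 2 = 0 := by linear_combination hm1 + hn1 + 2 * h
    have hmn : m = -n := by
      apply plane_ext
      · simp; nlinarith [sq_nonneg (m 0 + n 0), sq_nonneg (m 1 + n 1)]
      · simp; nlinarith [sq_nonneg (m 0 + n 0), sq_nonneg (m 1 + n 1)]
    -- If both `n` and `-n` were outward normals, the triangle would lie in a line, contradicting
    -- its nonempty interior.
    have hzero : ∀ y ∈ M.closedTri i, inner ℝ n (y - x) = 0 := fun y hy => by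
      have h1 := hm.2 y hy
      have h2 := hn.2 y hy
      rw [hmn, inner_neg_left] at h1
      linarith
    obtain ⟨z, hz⟩ := M.tri_nonempty i
    obtain ⟨ε, hε, hball⟩ := Metric.isOpen_iff.1 (M.isOpen_tri i) z hz
    have hz' : z + (ε / 2) • n ∈ M.closedTri i := by
      apply M.tri_subset i
      apply hball
      rw [Metric.mem_ball, dist_eq_norm, add_sub_cancel_left, norm_smul, hn.1, mul_one,
        Real.norm_eq_abs, abs_of_pos (by positivity)]
      linarith
    have h1 := hzero _ hz'
    have h2 := hzero _ (M.tri_subset i hz)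
    rw [add_sub_right_comm, inner_add_right, h2, real_inner_smul_right, real_inner_self_eq_norm_sq,
      hn.1] at h1
    linarith

/-- An edge lies on a line, has length at most `2 h`, and carries a constant unit normal; off a
finite set of abscissae it is a graph over the horizontal axis. -/
lemma NonOverlapping.edge_structure {i j : Fin M.N} {τ : Plane} (hO : M.NonOverlapping i j τ) :
    ∃ (n : Plane) (u : ℝ), ‖n‖ = 1 ∧ (∀ x ∈ M.edge i j τ, inner ℝ n x = u) ∧
      (μH[1] : Measure Plane) (M.edge i j τ) ≤ ENNReal.ofReal (2 * M.h) ∧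
      ∀ v : M.PiecewisePoly, ∀ᵐ x ∂(μH[1] : Measure Plane).restrict (M.edge i j τ),
        M.jump v i j τ x = (val (v i) x - val (v j) (x + τ)) • n := by
  obtain ⟨n, u, hn, hi, hj⟩ := hO.exists_separating
  have hline : ∀ x ∈ M.edge i j τ, inner ℝ n x = u := fun x hx =>
    le_antisymm (hi x hx.1) (hj x hx.2)
  refine ⟨n, u, hn, hline, hausdorffMeasure_le_of_subset_line hn hline
    fun x hx y hy => M.dist_le_h hx.1 hy.1, fun v => ?_⟩
  have := Measure.nullSingletonClass_hausdorff Plane (d := 1) one_pos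
  have hfin : (Set.range (M.vert i) ∪ (fun x => x + τ) ⁻¹' Set.range (M.vert j)).Finite :=
    (Set.finite_range _).union ((Set.finite_range _).preimage (add_left_injective τ).injOn)
  have hnull : ∀ᵐ x ∂(μH[1] : Measure Plane).restrict (M.edge i j τ),
      x ∉ Set.range (M.vert i) ∪ (fun x => x + τ) ⁻¹' Set.range (M.vert j) := by
    exact ae_restrict_of_ae (measure_eq_zero_iff_ae_notMem.1 (hfin.measure_zero _))
  filter_upwards [hnull, ae_restrict_mem (M.isCompact_edge i j τ).measurableSet] with x hx hxe
  simp only [Set.mem_union, not_or] at hx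
  have h1 : outwardNormal (M.closedTri i) x = n := by
    refine outwardNormal_eq hxe.1 hx.1 ⟨hn, fun y hy => ?_⟩
    rw [inner_sub_right, hline x hxe]
    linarith [hi y hy]
  have h2 : outwardNormal (M.closedTri j) (x + τ) = -n := by
    refine outwardNormal_eq hxe.2 hx.2 ⟨by rwa [norm_neg], fun y hy => ?_⟩
    have h3 := hj (y - τ) (by simpa using hy)
    rw [inner_neg_left, inner_sub_right, inner_add_right, hline x hxe]
    rw [inner_sub_right] at h3
    linarith
  rw [jump, h1, h2, smul_neg, sub_smul, sub_eq_add_neg]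

lemma NonOverlapping.integrableOn_edge {G : Type*} [NormedAddCommGroup G]
    [SecondCountableTopologyEither Plane G] {i j : Fin M.N} {τ : Plane}
    (hO : M.NonOverlapping i j τ) {F : Plane → G} (hF : Continuous F) :
    IntegrableOn F (M.edge i j τ) (μH[1] : Measure Plane) := by
  obtain ⟨-, -, -, -, hμ, -⟩ := hO.edge_structure
  exact integrableOn_of_continuous_of_isCompact (M.isCompact_edge i j τ)
    (hμ.trans_lt ENNReal.ofReal_lt_top) hF

end Mesh
/-! ### Inverse inequalities for polynomials -/

/-- `A` factors through the range of `B`, and a linear map on a finite-dimensional normed space is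
bounded. Injectivity of `B` is not required; this matters for restrictions to a line, where nonzero
polynomials may vanish. -/
lemma exists_norm_le_of_ker_le {V X Y : Type*} [AddCommGroup V] [Module ℝ V] [FiniteDimensional ℝ V]
    [NormedAddCommGroup X] [NormedSpace ℝ X] [NormedAddCommGroup Y] [NormedSpace ℝ Y]
    (A : V →ₗ[ℝ] X) (B : V →ₗ[ℝ] Y) (hAB : LinearMap.ker B ≤ LinearMap.ker A) :
    ∃ C : ℝ, 0 < C ∧ ∀ v, ‖A v‖ ≤ C * ‖B v‖ := by
  let L : LinearMap.range B →ₗ[ℝ] X :=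
    (LinearMap.ker B).liftQ A hAB ∘ₗ B.quotKerEquivRange.symm.toLinearMap
  have hL (v : V) : L ⟨B v, LinearMap.mem_range_self B v⟩ = A v := by
    have : B.quotKerEquivRange.symm ⟨B v, LinearMap.mem_range_self B v⟩ =
        (LinearMap.ker B).mkQ v := B.quotKerEquivRange_symm_apply_image v _
    simp [L, this]
  let L' := LinearMap.toContinuousLinearMap L
  refine ⟨‖L'‖ + 1, by positivity, fun v => ?_⟩
  rw [← hL v]
  refine (L'.le_opNorm ⟨B v, LinearMap.mem_range_self B v⟩).trans ?_
  have : ‖(⟨B v, LinearMap.mem_range_self B v⟩ : LinearMap.range B)‖ = ‖B v‖ := rfl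
  rw [this]
  gcongr
  linarith

/-- On a finite-dimensional space of continuous functions the supremum over a compact set `K` is
controlled by the `L²` norm on `S`, as soon as functions vanishing on `S` vanish on `K`. -/
lemma exists_sq_le_integral {V Y : Type*} [AddCommGroup V] [Module ℝ V] [FiniteDimensional ℝ V]
    [TopologicalSpace Y] [MeasurableSpace Y] (ev : V →ₗ[ℝ] C(Y, ℝ)) {K S : Set Y} (hK : IsCompact K)
    {μ : Measure Y} (hS : ∀ v, MemLp (ev v) 2 (μ.restrict S))
    (hvan : ∀ v, (∀ᵐ y ∂μ.restrict S, ev v y = 0) → ∀ x ∈ K, ev v x = 0) :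
    ∃ C : ℝ, 0 < C ∧ ∀ v, ∀ x ∈ K, ev v x ^ 2 ≤ C * ∫ y in S, ev v y ^ 2 ∂μ := by
  have : CompactSpace K := isCompact_iff_compactSpace.1 hK
  let A : V →ₗ[ℝ] C(K, ℝ) :=
    { toFun := fun v => (ev v).restrict K
      map_add' := fun v w => by ext; simp
      map_smul' := fun t v => by ext; simp }
  let B : V →ₗ[ℝ] Lp ℝ 2 (μ.restrict S) :=
    { toFun := fun v => (hS v).toLp _
      map_add' := fun v w => by
        rw [← MemLp.toLp_add]
        exact MemLp.toLp_congr _ _ (ae_of_all _ fun y => by simp)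
      map_smul' := fun t v => by
        rw [RingHom.id_apply, ← MemLp.toLp_const_smul]
        exact MemLp.toLp_congr _ _ (ae_of_all _ fun y => by simp) }
  obtain ⟨C, hC, hAB⟩ := exists_norm_le_of_ker_le A B fun v hv => by
    rw [LinearMap.mem_ker] at hv ⊢
    ext x
    refine hvan v ?_ x x.2
    have h1 : (hS v).toLp _ = 0 := hv
    have h2 := (hS v).coeFn_toLp
    rw [h1] at h2
    filter_upwards [h2, Lp.coeFn_zero ℝ 2 (μ.restrict S)] with y hy hy'
    rw [← hy, hy', Pi.zero_apply]
  refine ⟨C ^ 2, by positivity, fun v x hx => ?_⟩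
  have h1 : |ev v x| ≤ C * ‖B v‖ := ((A v).norm_coe_le_norm ⟨x, hx⟩).trans (hAB v)
  have h2 : ‖B v‖ ^ 2 = ∫ y in S, ev v y ^ 2 ∂μ := by
    rw [← real_inner_self_eq_norm_sq, L2.inner_def]
    refine integral_congr_ae ?_
    filter_upwards [(hS v).coeFn_toLp] with y hy
    change inner ℝ ((hS v).toLp _ y) ((hS v).toLp _ y) = _
    rw [hy]
    simp [sq]
  rw [← h2, ← mul_pow, ← sq_abs]
  exact pow_le_pow_left₀ (abs_nonneg _) h1 2

/-- Composition of a polynomial with `y ↦ z + r y`. -/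
def rescale (q : MvPolynomial (Fin 2) ℝ) (z : Plane) (r : ℝ) : MvPolynomial (Fin 2) ℝ :=
  MvPolynomial.aeval (fun k => MvPolynomial.C (z k) + MvPolynomial.C r * MvPolynomial.X k) q

lemma val_rescale (q : MvPolynomial (Fin 2) ℝ) (z : Plane) (r : ℝ) (y : Plane) :
    val (rescale q z r) y = val q (z + r • y) := by
  unfold val rescale
  induction q using MvPolynomial.induction_on with
  | C t => simp
  | add q₁ q₂ h₁ h₂ => rw [map_add, map_add, map_add, h₁, h₂]
  | mul_X q k hq => rw [map_mul, map_mul, map_mul, hq]; simp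

lemma totalDegree_rescale_le {q : MvPolynomial (Fin 2) ℝ} {p : ℕ} (hq : q.totalDegree ≤ p)
    (z : Plane) (r : ℝ) : (rescale q z r).totalDegree ≤ p := by
  unfold rescale
  rw [MvPolynomial.aeval_def, MvPolynomial.eval₂_eq']
  refine MvPolynomial.totalDegree_finsetSum_le fun m hm => ?_
  refine (MvPolynomial.totalDegree_mul _ _).trans ?_
  rw [MvPolynomial.algebraMap_eq, MvPolynomial.totalDegree_C, zero_add]
  refine (MvPolynomial.totalDegree_finsetProd _ _).trans ?_
  refine le_trans (Finset.sum_le_sum (g := fun k => m k) fun k _ => ?_) ?_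
  · refine (MvPolynomial.totalDegree_pow _ _).trans ?_
    have : (MvPolynomial.C (z k) + MvPolynomial.C r * MvPolynomial.X k :
        MvPolynomial (Fin 2) ℝ).totalDegree ≤ 1 := by
      refine (MvPolynomial.totalDegree_add _ _).trans (max_le (by simp) ?_)
      exact (MvPolynomial.totalDegree_mul _ _).trans (by simp)
    calc m k * _ ≤ m k * 1 := Nat.mul_le_mul_left _ this
      _ = m k := mul_one _
  · have h1 := MvPolynomial.le_totalDegree hm
    rw [Finsupp.sum_fintype _ _ (fun _ => rfl)] at h1
    exact h1.trans hq

lemma totalDegree_pderiv_le {q : MvPolynomial (Fin 2) ℝ} {p : ℕ} (hq : q.totalDegree ≤ p)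
    (k : Fin 2) : (MvPolynomial.pderiv k q).totalDegree ≤ p := by
  conv_lhs => rw [q.as_sum, map_sum]
  refine MvPolynomial.totalDegree_finsetSum_le fun m hm => ?_
  rw [MvPolynomial.pderiv_monomial]
  refine (MvPolynomial.totalDegree_monomial_le _ _).trans ?_
  have h1 := MvPolynomial.le_totalDegree hm
  rw [Finsupp.sum_fintype _ _ (fun _ => rfl)] at h1 ⊢
  refine le_trans (Finset.sum_le_sum fun l _ => ?_) (h1.trans hq)
  simp

/-- Evaluation of polynomials of bounded degree along a continuous map. -/
def evalAlong {Y : Type*} [TopologicalSpace Y] (p : ℕ) (φ : C(Y, Plane)) :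
    MvPolynomial.restrictTotalDegree (Fin 2) ℝ p →ₗ[ℝ] C(Y, ℝ) where
  toFun q := ⟨fun y => val q.1 (φ y), by fun_prop⟩
  map_add' q r := by ext; simp [val]
  map_smul' t q := by ext; simp [val_smul]

/-- By continuity the polynomial vanishes on the whole ball, hence on a product of two intervals,
and a polynomial vanishing on a product of infinite sets is zero. -/
lemma eq_zero_of_ae_zero_ball {q : MvPolynomial (Fin 2) ℝ} {ρ : ℝ} (hρ : 0 < ρ)
    (hq : ∀ᵐ y ∂(volume : Measure Plane).restrict (Metric.ball 0 ρ), val q y = 0) : q = 0 := by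
  have h1 : Set.EqOn (val q) (fun _ => 0) (Metric.ball 0 ρ) :=
    Measure.eqOn_open_of_ae_eq hq Metric.isOpen_ball (continuous_val q).continuousOn
      continuousOn_const
  refine MvPolynomial.funext_set (fun _ => Set.Ioo (-(ρ / 2)) (ρ / 2))
    (fun _ => Set.Ioo_infinite (by linarith)) fun x hx => ?_
  have h2 := h1 (x := WithLp.toLp 2 x) (by
    rw [mem_ball_zero_iff, ← abs_of_pos hρ, ← abs_of_nonneg (norm_nonneg _), ← sq_lt_sq,
      norm_sq_plane]
    have h0 := hx 0 (Set.mem_univ _)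
    have h1 := hx 1 (Set.mem_univ _)
    have h0' : x 0 ^ 2 < (ρ / 2) ^ 2 := sq_lt_sq' h0.1 h0.2
    have h1' : x 1 ^ 2 < (ρ / 2) ^ 2 := sq_lt_sq' h1.1 h1.2
    simp only
    nlinarith)
  simpa [val] using h2

lemma setIntegral_ball_rescale (F : Plane → ℝ) (z : Plane) (ρ : ℝ) {r : ℝ} (hr : 0 < r) :
    r ^ 2 * ∫ y in Metric.ball 0 ρ, F (z + r • y) = ∫ x in Metric.ball z (ρ * r), F x := by
  rw [Measure.setIntegral_comp_smul_of_pos volume (fun y => F (z + y)) _ hr, finrank_euclideanSpace,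
    Fintype.card_fin, smul_eq_mul, mul_inv_cancel_left₀ (by positivity), smul_ball hr.ne', smul_zero,
    Real.norm_eq_abs, abs_of_pos hr, mul_comm r ρ]
  have h1 := (measurePreserving_add_left (volume : Measure Plane) z).setIntegral_preimage_emb
    (measurableEmbedding_addLeft z) F (Metric.ball z (ρ * r))
  rw [← h1]
  congr 2
  ext y
  simp [dist_eq_norm]

/-- For `z = 0`, `r = 1` this is equivalence of norms on polynomials of degree at most `p`; the
substitution `y ↦ z + r y` preserves the degree and gives the general case. Balls serve as reference
domains in place of a reference triangle, so no affine map to the triangle has to be controlled. -/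
lemma exists_inverse_inequality (p : ℕ) {ρ : ℝ} (hρ : 0 < ρ) :
    ∃ C : ℝ, 0 < C ∧ ∀ q : MvPolynomial (Fin 2) ℝ, q.totalDegree ≤ p → ∀ (z : Plane) (r : ℝ), 0 < r →
      ∀ x ∈ Metric.closedBall z r,
        r ^ 2 * val q x ^ 2 ≤ C * ∫ y in Metric.ball z (ρ * r), val q y ^ 2 := by
  obtain ⟨C, hC, H⟩ := exists_sq_le_integral (evalAlong p (ContinuousMap.id Plane))
    (isCompact_closedBall (0 : Plane) 1) (μ := volume) (S := Metric.ball 0 ρ)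
    (fun q => (memLp_two_iff_integrable_sq
      (ContinuousMap.continuous _).aestronglyMeasurable).2
      ((integrableOn_of_continuous_of_isCompact (isCompact_closedBall (0 : Plane) ρ)
        (isCompact_closedBall _ _).measure_lt_top (by fun_prop)).mono_set Metric.ball_subset_closedBall))
    (fun q hq x _ => by
      have : q.1 = 0 := eq_zero_of_ae_zero_ball hρ hq
      simp [evalAlong, this, val])
  refine ⟨C, hC, fun q hq z r hr x hx => ?_⟩
  have hq' := (MvPolynomial.mem_restrictTotalDegree (Fin 2) p _).2 (totalDegree_rescale_le hq z r)
  have h1 := H ⟨_, hq'⟩ (r⁻¹ • (x - z)) (by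
    rw [mem_closedBall_zero_iff, norm_smul, norm_inv, Real.norm_eq_abs, abs_of_pos hr,
      inv_mul_le_iff₀ hr, mul_one, ← dist_eq_norm]
    exact hx)
  simp only [evalAlong, LinearMap.coe_mk, AddHom.coe_mk, ContinuousMap.coe_mk, ContinuousMap.id_apply,
    val_rescale, smul_inv_smul₀ hr.ne', add_sub_cancel] at h1
  rw [← setIntegral_ball_rescale (fun y => val q y ^ 2) z ρ hr]
  calc r ^ 2 * val q x ^ 2 ≤ r ^ 2 * (C * ∫ y in Metric.ball 0 ρ, val q (z + r • y) ^ 2) := by gcongr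
    _ = _ := by ring

/-- The reference segment is `[0, 1] × {0}`. Polynomials such as the second coordinate vanish on it,
so the `L²` norm is only a seminorm on the polynomial space, but the supremum has the same kernel.
-/
lemma exists_inverse_inequality_line (p : ℕ) :
    ∃ C : ℝ, 0 < C ∧ ∀ q : MvPolynomial (Fin 2) ℝ, q.totalDegree ≤ p → ∀ l r s : ℝ, l < r →
      ∀ t ∈ Set.Icc l r,
        (r - l) * val q !₂[t, s] ^ 2 ≤ C * ∫ y in Set.Icc l r, val q !₂[y, s] ^ 2 := by
  let φ : C(ℝ, Plane) := ⟨fun t => !₂[t, 0], by fun_prop⟩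
  obtain ⟨C, hC, H⟩ := exists_sq_le_integral (evalAlong p φ)
    (isCompact_Icc (a := (0 : ℝ)) (b := 1)) (μ := volume) (S := Set.Icc 0 1)
    (fun q => (memLp_two_iff_integrable_sq
      (ContinuousMap.continuous _).aestronglyMeasurable).2
      (integrableOn_of_continuous_of_isCompact isCompact_Icc
        isCompact_Icc.measure_lt_top (by fun_prop)))
    (fun q hq => Measure.eqOn_of_ae_eq hq (ContinuousMap.continuous _).continuousOn
      continuousOn_const (by rw [interior_Icc, closure_Ioo zero_ne_one]))
  refine ⟨C, hC, fun q hq l r s hlr t ht => ?_⟩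
  have hpos : 0 < r - l := sub_pos.2 hlr
  have hq' := (MvPolynomial.mem_restrictTotalDegree (Fin 2) p _).2
    (totalDegree_rescale_le hq !₂[l, s] (r - l))
  have hpt (y : ℝ) : (!₂[l, s] : Plane) + (r - l) • (!₂[y, 0] : Plane) = !₂[(r - l) * y + l, s] := by
    apply plane_ext <;> simp; ring
  have h1 := H ⟨_, hq'⟩ ((t - l) / (r - l)) (by
    constructor
    · exact div_nonneg (by linarith [ht.1]) hpos.le
    · rw [div_le_one hpos]; linarith [ht.2])
  simp only [evalAlong, LinearMap.coe_mk, AddHom.coe_mk, ContinuousMap.coe_mk, φ,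
    val_rescale, hpt, mul_div_cancel₀ _ hpos.ne', sub_add_cancel] at h1
  rw [integral_Icc_eq_integral_Ioc, ← intervalIntegral.integral_of_le zero_le_one,
    intervalIntegral.integral_comp_mul_add (fun y => val q !₂[y, s] ^ 2) hpos.ne' l] at h1
  rw [integral_Icc_eq_integral_Ioc, ← intervalIntegral.integral_of_le hlr.le]
  simp only [mul_zero, zero_add, mul_one, sub_add_cancel, smul_eq_mul] at h1
  calc (r - l) * val q !₂[t, s] ^ 2
      ≤ (r - l) * (C * ((r - l)⁻¹ * ∫ y in l..r, val q !₂[y, s] ^ 2)) := by gcongr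
    _ = _ := by field_simp

/-! ### Double counting over pairs of neighbours -/

/-- Each `g i` occurs once for every partner of `i`, at most `K` times in the first position and at
most `K` times in the second. -/
lemma sum_relation_le {ι : Type*} [Fintype ι] (R : ι → ι → Prop) [∀ i j, Decidable (R i j)]
    {g : ι → ℝ} (hg : ∀ i, 0 ≤ g i) {K : ℝ}
    (hrow : ∀ (i : ι) (S : Finset ι), (∀ j ∈ S, R i j) → (S.card : ℝ) ≤ K)
    (hcol : ∀ (j : ι) (S : Finset ι), (∀ i ∈ S, R i j) → (S.card : ℝ) ≤ K) :
    ∑ i, ∑ j, (if R i j then g i + g j else 0) ≤ 2 * K * ∑ i, g i := by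
  have h1 : ∑ i, ∑ j, (if R i j then g i + g j else 0) =
      ∑ i, ∑ j, (if R i j then g i else 0) + ∑ j, ∑ i, (if R i j then g j else 0) := by
    rw [Finset.sum_comm (f := fun j i => if R i j then g j else 0), ← Finset.sum_add_distrib]
    refine Finset.sum_congr rfl fun i _ => ?_
    rw [← Finset.sum_add_distrib]
    refine Finset.sum_congr rfl fun j _ => ?_
    split_ifs <;> simp
  have h2 : ∑ i, ∑ j, (if R i j then g i else 0) ≤ K * ∑ i, g i := by
    rw [Finset.mul_sum]
    refine Finset.sum_le_sum fun i _ => ?_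
    rw [← Finset.sum_filter, Finset.sum_const, nsmul_eq_mul]
    exact mul_le_mul_of_nonneg_right (hrow i _ (by simp)) (hg i)
  have h3 : ∑ j, ∑ i, (if R i j then g j else 0) ≤ K * ∑ i, g i := by
    rw [Finset.mul_sum]
    refine Finset.sum_le_sum fun j _ => ?_
    rw [← Finset.sum_filter, Finset.sum_const, nsmul_eq_mul]
    exact mul_le_mul_of_nonneg_right (hcol j _ (by simp)) (hg j)
  rw [h1]
  linarith

lemma norm_half_smul_add_sq_le {E : Type*} [NormedAddCommGroup E] [InnerProductSpace ℝ E] (x y : E) :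
    ‖(1 / 2 : ℝ) • (x + y)‖ ^ 2 ≤ 1 / 2 * (‖x‖ ^ 2 + ‖y‖ ^ 2) := by
  have h := parallelogram_law_with_norm ℝ x y
  rw [norm_smul, mul_pow, Real.norm_eq_abs, sq_abs]
  nlinarith [sq_nonneg ‖x - y‖]

namespace Mesh

variable {a b c d : ℝ} {M : Mesh a b c d}

lemma totalDegree_le_of_mem_V {p : ℕ} {v : M.PiecewisePoly} (hv : v ∈ M.V p) (i : Fin M.N) :
    (v i).totalDegree ≤ p :=
  (MvPolynomial.mem_restrictTotalDegree (Fin 2) p _).1 (hv i (Set.mem_univ i))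

/-! ### The averages of the gradients on edges -/

/-- The pointwise inverse inequality on a triangle. -/
lemma exists_grad_sq_le (p : ℕ) {ρ : ℝ} (hρ : 0 < ρ) :
    ∃ C : ℝ, 0 < C ∧ ∀ (a b c d : ℝ) (M : Mesh a b c d), M.QuasiUniform ρ → ∀ v ∈ M.V p, ∀ i,
      ∀ x ∈ M.closedTri i, M.h ^ 2 * ‖grad (v i) x‖ ^ 2 ≤ C * ∫ y in M.tri i, ‖grad (v i) y‖ ^ 2 := by
  obtain ⟨C, hC, H⟩ := exists_inverse_inequality p hρ
  refine ⟨C, hC, fun a b c d M hQ v hv i x hx => ?_⟩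
  obtain ⟨z, hz⟩ := hQ i
  have hh := M.h_pos_of_index i
  have hzT : z ∈ M.closedTri i := M.tri_subset i (hz (Metric.mem_ball_self (by positivity)))
  have hxz : x ∈ Metric.closedBall z M.h := M.dist_le_h hx hzT
  have key (k : Fin 2) := H (MvPolynomial.pderiv k (v i))
    (totalDegree_pderiv_le (totalDegree_le_of_mem_V hv i) k) z M.h hh x hxz
  have hFint (k : Fin 2) : IntegrableOn (fun y => val (MvPolynomial.pderiv k (v i)) y ^ 2)
      (Metric.ball z (ρ * M.h)) :=
    (M.integrableOn_tri i (by fun_prop)).mono_set hz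
  calc M.h ^ 2 * ‖grad (v i) x‖ ^ 2
      = M.h ^ 2 * val (MvPolynomial.pderiv 0 (v i)) x ^ 2 +
        M.h ^ 2 * val (MvPolynomial.pderiv 1 (v i)) x ^ 2 := by rw [grad_norm_sq]; ring
    _ ≤ C * ∫ y in Metric.ball z (ρ * M.h), ‖grad (v i) y‖ ^ 2 := by
        simp_rw [grad_norm_sq]
        rw [integral_add (hFint 0) (hFint 1), mul_add]
        exact add_le_add (key 0) (key 1)
    _ ≤ C * ∫ y in M.tri i, ‖grad (v i) y‖ ^ 2 := by
        refine mul_le_mul_of_nonneg_left ?_ hC.le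
        exact setIntegral_mono_set (M.integrableOn_tri i (by fun_prop))
          (ae_of_all _ fun y => by positivity) (LE.le.eventuallyLE hz)

lemma NonOverlapping.setIntegral_edge_le {i j : Fin M.N} {τ : Plane} (hO : M.NonOverlapping i j τ)
    {F : Plane → ℝ} {B : ℝ} (hB : 0 ≤ B) (hF0 : ∀ x, 0 ≤ F x) (hF : ∀ x ∈ M.edge i j τ, F x ≤ B) :
    ∫ x in M.edge i j τ, F x ∂(μH[1] : Measure Plane) ≤ B * (2 * M.h) := by
  obtain ⟨-, -, -, -, hμ, -⟩ := hO.edge_structure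
  have hh := M.h_pos_of_index i
  have h1 := norm_setIntegral_le_of_norm_le_const (hμ.trans_lt ENNReal.ofReal_lt_top)
    (f := F) (C := B) fun x hx => by rw [Real.norm_eq_abs, abs_of_nonneg (hF0 x)]; exact hF x hx
  refine (le_abs_self _).trans (h1.trans ?_)
  gcongr
  rw [Measure.real]
  exact ENNReal.toReal_le_of_le_ofReal (by positivity) hμ

open Classical in
lemma sum_edges_le {ρ : ℝ} (hρ : 0 < ρ) (hQ : M.QuasiUniform ρ) (τ : Plane) {g : Fin M.N → ℝ}
    (hg : ∀ i, 0 ≤ g i) :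
    ∑ i, ∑ j, (if (M.edge i j τ).Nonempty then g i + g j else 0) ≤ 8 / ρ ^ 2 * ∑ i, g i := by
  have := sum_relation_le (fun i j => (M.edge i j τ).Nonempty) hg (K := 4 / ρ ^ 2)
    (fun i S hS => card_le_of_edge_right hρ hQ S i τ hS)
    (fun j S hS => card_le_of_edge_left hρ hQ S j τ hS)
  exact this.trans_eq (by ring)

/-- The averages of the gradients on the edges are controlled by the broken Dirichlet form. -/
lemma exists_avgAvg_le (p : ℕ) {ρ : ℝ} (hρ : 0 < ρ) :
    ∃ C : ℝ, 0 < C ∧ ∀ (a b c d : ℝ) (M : Mesh a b c d), M.QuasiUniform ρ → 0 < M.h → ∀ v ∈ M.V p,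
      M.avgAvg v v ≤ C / M.h * M.gradForm v v := by
  obtain ⟨C, hC, H⟩ := exists_grad_sq_le p hρ
  -- The pairs with shift zero and the periodic pairs contribute `8 / ρ²` each.
  refine ⟨C * (16 / ρ ^ 2), by positivity, fun a b c d M hQ hh v hv => ?_⟩
  set g : Fin M.N → ℝ := fun i => ∫ y in M.tri i, ‖grad (v i) y‖ ^ 2 with hgdef
  have hg (i : Fin M.N) : 0 ≤ g i := integral_nonneg fun y => by positivity
  have hG : M.gradForm v v = ∑ i, g i := by
    simp only [gradForm, real_inner_self_eq_norm_sq, hgdef]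
  have hsup (i : Fin M.N) {x : Plane} (hx : x ∈ M.closedTri i) :
      ‖grad (v i) x‖ ^ 2 ≤ C / M.h ^ 2 * g i := by
    rw [div_mul_eq_mul_div, le_div_iff₀ (by positivity), mul_comm]
    exact H a b c d M hQ v hv i x hx
  classical
  have hedge {i j : Fin M.N} {τ : Plane} (hO : M.NonOverlapping i j τ) :
      ∫ x in M.edge i j τ, inner ℝ (M.avgGrad v i j τ x) (M.avgGrad v i j τ x)
          ∂(μH[1] : Measure Plane) ≤
        C / M.h * (if (M.edge i j τ).Nonempty then g i + g j else 0) := by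
    split_ifs with hne
    -- The pointwise bound is of order `h⁻²` and the edge has length at most `2 h`, which leaves `1
    -- / h`.
    · refine (hO.setIntegral_edge_le (B := 1 / 2 * (C / M.h ^ 2 * g i + C / M.h ^ 2 * g j)) ?_
        (fun x => real_inner_self_nonneg) fun x hx => ?_).trans_eq ?_
      · have := hg i; have := hg j; positivity
      · rw [real_inner_self_eq_norm_sq]
        refine (norm_half_smul_add_sq_le _ _).trans ?_
        have h1 := hsup i hx.1
        have h2 := hsup j hx.2
        gcongr
      · field_simp
    · rw [Set.not_nonempty_iff_eq_empty] at hne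
      simp [hne]
  have hnn {i j : Fin M.N} {τ : Plane} :
      0 ≤ C / M.h * (if (M.edge i j τ).Nonempty then g i + g j else 0) := by
    have := hg i; have := hg j
    split_ifs <;> positivity
  unfold avgAvg sumEdges
  calc _ ≤ (∑ i, ∑ j, C / M.h * (if (M.edge i j 0).Nonempty then g i + g j else 0)) +
        ∑ i, ∑ j, C / M.h * (if (M.edge i j M.period).Nonempty then g i + g j else 0) := by
        refine add_le_add (Finset.sum_le_sum fun i _ => Finset.sum_le_sum fun j _ => ?_)
          (Finset.sum_le_sum fun i _ => Finset.sum_le_sum fun j _ => hedge (nonOverlapping_period i j))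
        by_cases hij : i < j
        · rw [if_pos hij]
          exact hedge (nonOverlapping_zero hij.ne)
        · rw [if_neg hij]
          exact hnn
    _ = C / M.h * ((∑ i, ∑ j, if (M.edge i j 0).Nonempty then g i + g j else 0) +
        ∑ i, ∑ j, if (M.edge i j M.period).Nonempty then g i + g j else 0) := by
        simp only [Finset.mul_sum, mul_add]
    _ ≤ C / M.h * (8 / ρ ^ 2 * ∑ i, g i + 8 / ρ ^ 2 * ∑ i, g i) := by
        gcongr
        · exact sum_edges_le hρ hQ 0 hg
        · exact sum_edges_le hρ hQ M.period hg
    _ = _ := by rw [hG]; ring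

/-! ### Edges on the horizontal sides -/

lemma exists_weights {i : Fin M.N} {x : Plane} (hx : x ∈ M.closedTri i) :
    ∃ w : Fin 3 → ℝ, (∀ k, 0 ≤ w k) ∧ w 0 + w 1 + w 2 = 1 ∧
      ∀ l, x l = w 0 * M.vert i 0 l + w 1 * M.vert i 1 l + w 2 * M.vert i 2 l := by
  let S : Set Plane := {x | ∃ w : Fin 3 → ℝ, (∀ k, 0 ≤ w k) ∧ w 0 + w 1 + w 2 = 1 ∧
      ∀ l, x l = w 0 * M.vert i 0 l + w 1 * M.vert i 1 l + w 2 * M.vert i 2 l}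
  have hS : M.closedTri i ⊆ S := by
    refine convexHull_min ?_ ?_
    · rintro _ ⟨k, rfl⟩
      refine ⟨Pi.single k 1, fun l => ?_, ?_, fun l => ?_⟩
      · by_cases h : l = k
        · subst h; simp
        · simp [h]
      · fin_cases k <;> simp
      · fin_cases k <;> simp
    · rintro x ⟨w, hw, hw1, hxw⟩ y ⟨w', hw', hw1', hyw⟩ s t hs ht hst
      refine ⟨fun k => s * w k + t * w' k, fun k => ?_, ?_, fun l => ?_⟩
      · have := hw k; have := hw' k; positivity
      · simp only
        linear_combination s * hw1 + t * hw1' + hst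
      · simp only [PiLp.add_apply, PiLp.smul_apply, smul_eq_mul, hxw l, hyw l]
        ring
  exact hS hx

/-- If a triangle lies on one side of a horizontal line and meets it in a segment, then the segment
is at least as long as the radius of any ball contained in the triangle. -/
lemma radius_le_base_length {i : Fin M.N} {s σ : ℝ} (hσ : σ ≠ 0)
    (hside : ∀ x ∈ M.closedTri i, 0 ≤ σ * (x 1 - s)) {l r : ℝ} (hl : !₂[l, s] ∈ M.closedTri i)
    (hr : !₂[r, s] ∈ M.closedTri i) (hlr : l < r)
    (hmax : ∀ t, !₂[t, s] ∈ M.closedTri i → l ≤ t ∧ t ≤ r) {z : Plane} {ε : ℝ} (hε : 0 < ε)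
    (hball : Metric.ball z ε ⊆ M.closedTri i) : ε ≤ r - l := by
  set V := M.vert i
  set H : Fin 3 → ℝ := fun k => σ * (V k 1 - s) with hH
  have hH0 (k : Fin 3) : 0 ≤ H k := hside _ (M.vert_mem i k)
  -- Of the three nonnegative heights over the line, two are zero or two are positive; `k₁` and `k₂`
  -- denote such a pair. In the first case they span the base; in the second the slice is at most
  -- one point.
  obtain ⟨k₀, k₁, k₂, hperm, hcase⟩ : ∃ k₀ k₁ k₂ : Fin 3,
      (∀ f : Fin 3 → ℝ, f 0 + f 1 + f 2 = f k₀ + f k₁ + f k₂) ∧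
      ((H k₁ = 0 ∧ H k₂ = 0) ∨ (0 < H k₁ ∧ 0 < H k₂)) := by
    have e1 : ∀ f : Fin 3 → ℝ, f 0 + f 1 + f 2 = f 2 + f 0 + f 1 := fun f => by ring
    have e2 : ∀ f : Fin 3 → ℝ, f 0 + f 1 + f 2 = f 1 + f 0 + f 2 := fun f => by ring
    rcases (hH0 0).eq_or_lt with h0 | h0 <;> rcases (hH0 1).eq_or_lt with h1 | h1
    · exact ⟨2, 0, 1, e1, Or.inl ⟨h0.symm, h1.symm⟩⟩
    · rcases (hH0 2).eq_or_lt with h2 | h2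
      · exact ⟨1, 0, 2, e2, Or.inl ⟨h0.symm, h2.symm⟩⟩
      · exact ⟨0, 1, 2, fun f => rfl, Or.inr ⟨h1, h2⟩⟩
    · rcases (hH0 2).eq_or_lt with h2 | h2
      · exact ⟨0, 1, 2, fun f => rfl, Or.inl ⟨h1.symm, h2.symm⟩⟩
      · exact ⟨1, 0, 2, e2, Or.inr ⟨h0, h2⟩⟩
    · exact ⟨2, 0, 1, e1, Or.inr ⟨h0, h1⟩⟩
  have hw {x : Plane} (hx : x ∈ M.closedTri i) : ∃ w : Fin 3 → ℝ, (∀ k, 0 ≤ w k) ∧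
      w k₀ + w k₁ + w k₂ = 1 ∧ x 0 = w k₀ * V k₀ 0 + w k₁ * V k₁ 0 + w k₂ * V k₂ 0 ∧
      σ * (x 1 - s) = w k₀ * H k₀ + w k₁ * H k₁ + w k₂ * H k₂ := by
    obtain ⟨w, hw0, hw1, hwx⟩ := exists_weights hx
    have h1 := hperm w
    have h2 := hperm fun k => w k * V k 0
    have h3 := hperm fun k => w k * H k
    simp only [hH] at h2 h3 ⊢
    refine ⟨w, hw0, h1 ▸ hw1, (hwx 0).trans h2, ?_⟩
    rw [← h3, hwx 1]
    linear_combination σ * s * hw1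
  rcases hcase with ⟨h1, h2⟩ | ⟨h1, h2⟩
  · have hVs {k : Fin 3} (hk : H k = 0) : l ≤ V k 0 ∧ V k 0 ≤ r := by
      apply hmax
      have hy : V k 1 = s := by
        have := (mul_eq_zero.1 hk).resolve_left hσ
        linarith
      have : (!₂[V k 0, s] : Plane) = V k := by apply plane_ext <;> simp [hy]
      rw [this]
      exact M.vert_mem i k
    have hmem (w : Plane) (hw : ‖w‖ = 1) : z + (ε / 2) • w ∈ M.closedTri i := by
      apply hball
      rw [Metric.mem_ball, dist_eq_norm, add_sub_cancel_left, norm_smul, hw, mul_one,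
        Real.norm_eq_abs, abs_of_pos (by positivity)]
      linarith
    have hunit {x y : ℝ} (hxy : x ^ 2 + y ^ 2 = 1) : ‖(!₂[x, y] : Plane)‖ = 1 := by
      rw [← sq_eq_sq₀ (norm_nonneg _) zero_le_one, norm_sq_plane]
      simpa using hxy
    -- The first two points are the ends of a horizontal chord of length `ε`; the third has a
    -- different height and excludes that all vertices lie on the line.
    obtain ⟨w, hw0, hw1, hwx, hwy⟩ := hw (hmem !₂[1, 0] (hunit (by norm_num)))
    obtain ⟨w', hw0', hw1', hwx', hwy'⟩ := hw (hmem !₂[-1, 0] (hunit (by norm_num)))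
    obtain ⟨w'', -, -, -, hwy''⟩ := hw (hmem !₂[0, 1] (hunit (by norm_num)))
    simp only [PiLp.add_apply, PiLp.smul_apply, smul_eq_mul, h1, h2, mul_zero, add_zero,
      Matrix.cons_val_zero, Matrix.cons_val_one, mul_one] at hwx hwy hwx' hwy' hwy''
    have hH0' : H k₀ ≠ 0 := fun h => by
      rw [h, mul_zero] at hwy hwy''
      have := (mul_eq_zero.1 hwy).resolve_left hσ
      have := (mul_eq_zero.1 hwy'').resolve_left hσ
      linarith
    have heq : w k₀ = w' k₀ := mul_right_cancel₀ hH0' (hwy.symm.trans hwy')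
    -- Points of equal height have the same weight at the apex `k₀`, so the chord is a multiple, of
    -- modulus at most one, of the vector between the base vertices.
    have hδ : ε = (w k₁ - w' k₁) * (V k₁ 0 - V k₂ 0) := by
      have e1 : w k₂ = 1 - w k₀ - w k₁ := by linarith
      have e2 : w' k₂ = 1 - w k₀ - w' k₁ := by linarith
      rw [e1] at hwx
      rw [e2, ← heq] at hwx'
      linear_combination hwx - hwx'
    have b1 : |w k₁ - w' k₁| ≤ 1 := by
      rw [abs_le]
      constructor <;> linarith [hw0 k₀, hw0 k₁, hw0 k₂, hw0' k₀, hw0' k₁, hw0' k₂]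
    have b2 : |V k₁ 0 - V k₂ 0| ≤ r - l := by
      have := hVs h1
      have := hVs h2
      rw [abs_le]
      constructor <;> linarith
    calc ε = |(w k₁ - w' k₁) * (V k₁ 0 - V k₂ 0)| := by rw [← hδ, abs_of_pos hε]
      _ = |w k₁ - w' k₁| * |V k₁ 0 - V k₂ 0| := abs_mul _ _
      _ ≤ 1 * (r - l) := mul_le_mul b1 b2 (abs_nonneg _) zero_le_one
      _ = r - l := one_mul _
  · exfalso
    have hpt {t : ℝ} (ht : !₂[t, s] ∈ M.closedTri i) : t = V k₀ 0 := by
      obtain ⟨w, hw0, hw1, hwx, hwy⟩ := hw ht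
      simp only [Matrix.cons_val_zero, Matrix.cons_val_one, sub_self, mul_zero] at hwx hwy
      have g0 := mul_nonneg (hw0 k₀) (hH0 k₀)
      have g1 := mul_nonneg (hw0 k₁) (hH0 k₁)
      have g2 := mul_nonneg (hw0 k₂) (hH0 k₂)
      have z1 : w k₁ = 0 := (mul_eq_zero.1 (by linarith : w k₁ * H k₁ = 0)).resolve_right h1.ne'
      have z2 : w k₂ = 0 := (mul_eq_zero.1 (by linarith : w k₂ * H k₂ = 0)).resolve_right h2.ne'
      have z0 : w k₀ = 1 := by linarith
      rw [z0, z1, z2] at hwx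
      linarith
    linarith [hpt hl, hpt hr]

lemma isCompact_slice (i : Fin M.N) (s : ℝ) :
    IsCompact {t : ℝ | (!₂[t, s] : Plane) ∈ M.closedTri i} := by
  have hcl : IsClosed {t : ℝ | (!₂[t, s] : Plane) ∈ M.closedTri i} :=
    (M.isClosed_closedTri i).preimage (f := fun t : ℝ => (!₂[t, s] : Plane)) (by fun_prop)
  refine ((M.isCompact_closedTri i).image (f := fun x : Plane => x 0) (by fun_prop)).of_isClosed_subset
    hcl fun t ht => ⟨_, ht, by simp⟩

/-- The slice of a triangle at height `s` is the segment between its end points. -/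
lemma slice_of_leftEnd_lt_rightEnd {i : Fin M.N} {s : ℝ} (hlr : M.leftEnd i s < M.rightEnd i s) :
    !₂[M.leftEnd i s, s] ∈ M.closedTri i ∧ !₂[M.rightEnd i s, s] ∈ M.closedTri i ∧
      (∀ t ∈ Set.Icc (M.leftEnd i s) (M.rightEnd i s), !₂[t, s] ∈ M.closedTri i) ∧
      ∀ t, !₂[t, s] ∈ M.closedTri i → M.leftEnd i s ≤ t ∧ t ≤ M.rightEnd i s := by
  have hK := M.isCompact_slice i s
  have hne : {t : ℝ | (!₂[t, s] : Plane) ∈ M.closedTri i}.Nonempty := by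
    by_contra h
    -- For an empty slice both ends take the default value `0`, so the strict inequality excludes
    -- this case.
    rw [Set.not_nonempty_iff_eq_empty] at h
    simp [leftEnd, rightEnd, h] at hlr
  have h1 : !₂[M.leftEnd i s, s] ∈ M.closedTri i := hK.sInf_mem hne
  have h2 : !₂[M.rightEnd i s, s] ∈ M.closedTri i := hK.sSup_mem hne
  refine ⟨h1, h2, fun t ht => ?_, fun t ht => ⟨csInf_le hK.bddBelow ht, le_csSup hK.bddAbove ht⟩⟩
  have hpos : 0 < M.rightEnd i s - M.leftEnd i s := sub_pos.2 hlr
  have hmem := (M.convex_closedTri i) h1 h2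
    (a := (M.rightEnd i s - t) / (M.rightEnd i s - M.leftEnd i s))
    (b := (t - M.leftEnd i s) / (M.rightEnd i s - M.leftEnd i s))
    (div_nonneg (by linarith [ht.2]) hpos.le) (div_nonneg (by linarith [ht.1]) hpos.le)
    (by field_simp; ring)
  convert hmem using 1
  apply plane_ext
  · simp
    field_simp
    ring
  · simp
    field_simp
    ring

/-- The triangle lies in the rectangle, hence on one side of the line carrying the horizontal side;
the sign `σ` treats bottom and top alike. -/
lemma rho_h_le_base (hab : a < b) (hcd : c < d) {ρ : ℝ} (hρ : 0 < ρ) (hQ : M.QuasiUniform ρ)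
    {i : Fin M.N} {s : ℝ} (hs : s = c ∨ s = d) (hlr : M.leftEnd i s < M.rightEnd i s) :
    ρ * M.h ≤ M.rightEnd i s - M.leftEnd i s := by
  obtain ⟨h1, h2, -, h4⟩ := slice_of_leftEnd_lt_rightEnd hlr
  obtain ⟨z, hz⟩ := hQ i
  have hh := M.h_pos_of_index i
  obtain ⟨σ, hσ, hside⟩ : ∃ σ : ℝ, σ ≠ 0 ∧ ∀ x ∈ M.closedTri i, 0 ≤ σ * (x 1 - s) := by
    rcases hs with rfl | rfl
    · refine ⟨1, one_ne_zero, fun x hx => ?_⟩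
      linarith [((mem_closure_Omega_iff hab hcd).1 (M.closedTri_subset i hx)).2.1]
    · refine ⟨-1, by norm_num, fun x hx => ?_⟩
      linarith [((mem_closure_Omega_iff hab hcd).1 (M.closedTri_subset i hx)).2.2]
  exact radius_le_base_length hσ hside h1 h2 hlr h4 (by positivity) (hz.trans (M.tri_subset i))

lemma mem_Gamma1 (hab : a < b) (hcd : c < d) {i : Fin M.N} {t s : ℝ} (hs : s = c ∨ s = d)
    (ht : !₂[t, s] ∈ M.closedTri i) : !₂[t, s] ∈ M.closedTri i ∩ Gamma1 a b c d := by
  refine ⟨ht, ?_, by simpa using hs⟩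
  exact ((mem_closure_Omega_iff hab hcd).1 (M.closedTri_subset i ht)).1

lemma setIntegral_slice_le (hab : a < b) (hcd : c < d) {i : Fin M.N} {s : ℝ} (hs : s = c ∨ s = d)
    {A : Set ℝ} (hA : ∀ t ∈ A, !₂[t, s] ∈ M.closedTri i) {F : Plane → ℝ} (hF : Continuous F)
    (hF0 : ∀ x, 0 ≤ F x) :
    ∫ t in A, F !₂[t, s] ≤ ∫ x in M.closedTri i ∩ Gamma1 a b c d, F x ∂(μH[1] : Measure Plane) :=
  integral_section_le (s := fun t => !₂[t, s]) (by fun_prop) (fun t => by simp)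
    (fun t ht => mem_Gamma1 hab hcd hs (hA t ht)) hF hF0 (M.integrableOn_Gamma1 i hF)

/-- Every partner contains the right end of `i` or, through the identification of the corners, the
point `(a, s)`. Each of these two points lies in at most `1 / ρ²` closed triangles. -/
lemma card_ridge_right {ρ : ℝ} (hρ : 0 < ρ) (hQ : M.QuasiUniform ρ) (s : ℝ) (i : Fin M.N)
    (S : Finset (Fin M.N)) (hS : ∀ j ∈ S, M.IsRidge s i j) : (S.card : ℝ) ≤ 2 / ρ ^ 2 := by
  classical
  have hsub : S ⊆ S.filter (fun j => !₂[M.rightEnd i s, s] ∈ M.closedTri j) ∪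
      S.filter (fun j => !₂[a, s] ∈ M.closedTri j) := fun j hj => by
    obtain ⟨-, h2, h3⟩ := hS j hj
    have := (slice_of_leftEnd_lt_rightEnd h2).1
    rw [Finset.mem_union, Finset.mem_filter, Finset.mem_filter]
    rcases h3 with h3 | ⟨-, h3⟩
    · exact Or.inl ⟨hj, h3 ▸ this⟩
    · rw [h3] at this
      exact Or.inr ⟨hj, this⟩
  have h1 := card_le_of_mem hρ hQ (S.filter (fun j => !₂[M.rightEnd i s, s] ∈ M.closedTri j))
    (fun j hj => (Finset.mem_filter.1 hj).2)
  have h2 := card_le_of_mem hρ hQ (S.filter (fun j => !₂[a, s] ∈ M.closedTri j))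
    (fun j hj => (Finset.mem_filter.1 hj).2)
  have h3 : (S.card : ℝ) ≤ _ :=
    Nat.cast_le.2 ((Finset.card_le_card hsub).trans (Finset.card_union_le _ _))
  push_cast at h3
  calc _ ≤ _ := h3
    _ ≤ 1 / ρ ^ 2 + 1 / ρ ^ 2 := add_le_add h1 h2
    _ = _ := by ring

lemma card_ridge_left {ρ : ℝ} (hρ : 0 < ρ) (hQ : M.QuasiUniform ρ) (s : ℝ) (j : Fin M.N)
    (S : Finset (Fin M.N)) (hS : ∀ i ∈ S, M.IsRidge s i j) : (S.card : ℝ) ≤ 2 / ρ ^ 2 := by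
  classical
  have hsub : S ⊆ S.filter (fun i => !₂[M.leftEnd j s, s] ∈ M.closedTri i) ∪
      S.filter (fun i => !₂[b, s] ∈ M.closedTri i) := fun i hi => by
    obtain ⟨h2, -, h3⟩ := hS i hi
    have := (slice_of_leftEnd_lt_rightEnd h2).2.1
    rw [Finset.mem_union, Finset.mem_filter, Finset.mem_filter]
    rcases h3 with h3 | ⟨h3, -⟩
    · exact Or.inl ⟨hi, h3 ▸ this⟩
    · rw [h3] at this
      exact Or.inr ⟨hi, this⟩
  have h1 := card_le_of_mem hρ hQ (S.filter (fun i => !₂[M.leftEnd j s, s] ∈ M.closedTri i))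
    (fun i hi => (Finset.mem_filter.1 hi).2)
  have h2 := card_le_of_mem hρ hQ (S.filter (fun i => !₂[b, s] ∈ M.closedTri i))
    (fun i hi => (Finset.mem_filter.1 hi).2)
  have h3 : (S.card : ℝ) ≤ _ :=
    Nat.cast_le.2 ((Finset.card_le_card hsub).trans (Finset.card_union_le _ _))
  push_cast at h3
  calc _ ≤ _ := h3
    _ ≤ 1 / ρ ^ 2 + 1 / ρ ^ 2 := add_le_add h1 h2
    _ = _ := by ring

/-- The averages of the tangential gradients at the ridges are controlled by the tangential
Dirichlet form. -/
lemma exists_ridgeAvgAvg_le (p : ℕ) {ρ : ℝ} (hρ : 0 < ρ) :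
    ∃ C : ℝ, 0 < C ∧ ∀ (a b c d : ℝ) (M : Mesh a b c d), a < b → c < d → M.QuasiUniform ρ →
      ∀ v ∈ M.V p, M.ridgeAvgAvg v v ≤ C / M.h * M.tangForm v v := by
  obtain ⟨C, hC, H⟩ := exists_inverse_inequality_line p
  -- `C / (ρ h)` is the pointwise bound on an edge of length at least `ρ h`; the average contributes
  -- `1 / 2`, and each of the two sides contributes `4 / ρ²`.
  refine ⟨C / ρ * (4 / ρ ^ 2), by positivity, fun a b c d M hab hcd hQ v hv => ?_⟩
  have hh := M.h_pos hab hcd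
  set g : Fin M.N → ℝ := fun i =>
    ∫ x in M.closedTri i ∩ Gamma1 a b c d, ‖tangGrad (v i) x‖ ^ 2 ∂(μH[1] : Measure Plane) with hgdef
  have hg (i : Fin M.N) : 0 ≤ g i := integral_nonneg fun y => by positivity
  have hG : M.tangForm v v = ∑ i, g i := by
    simp only [tangForm, sumGamma1, real_inner_self_eq_norm_sq, hgdef]
  have hpt {i : Fin M.N} {s : ℝ} (hs : s = c ∨ s = d) (hlr : M.leftEnd i s < M.rightEnd i s) {t : ℝ}
      (ht : t ∈ Set.Icc (M.leftEnd i s) (M.rightEnd i s)) :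
      ‖tangGrad (v i) !₂[t, s]‖ ^ 2 ≤ C / (ρ * M.h) * g i := by
    have h1 := H _ (totalDegree_pderiv_le (totalDegree_le_of_mem_V hv i) 0) _ _ s hlr t ht
    have h2 := setIntegral_slice_le hab hcd hs (slice_of_leftEnd_lt_rightEnd hlr).2.2.1
      (F := fun x => ‖tangGrad (v i) x‖ ^ 2) (by fun_prop) (fun x => by positivity)
    simp_rw [← tangGrad_norm_sq] at h1
    have h3 := rho_h_le_base hab hcd hρ hQ hs hlr
    rw [div_mul_eq_mul_div, le_div_iff₀ (by positivity), mul_comm]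
    calc ρ * M.h * ‖tangGrad (v i) !₂[t, s]‖ ^ 2
        ≤ (M.rightEnd i s - M.leftEnd i s) * ‖tangGrad (v i) !₂[t, s]‖ ^ 2 := by gcongr
      _ ≤ _ := h1
      _ ≤ C * g i := by gcongr
  classical
  have hridge (s : ℝ) (hs : s = c ∨ s = d) (i j : Fin M.N) :
      (if M.IsRidge s i j then inner ℝ (M.ridgeAvg v s i j) (M.ridgeAvg v s i j) else 0) ≤
        1 / 2 * (C / (ρ * M.h)) * (if M.IsRidge s i j then g i + g j else 0) := by
    split_ifs with hR
    · rw [real_inner_self_eq_norm_sq]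
      refine (norm_half_smul_add_sq_le _ _).trans ?_
      have h1 := hpt hs hR.1 (Set.right_mem_Icc.2 hR.1.le)
      have h2 := hpt hs hR.2.1 (Set.left_mem_Icc.2 hR.2.1.le)
      linarith
    · simp
  have hsum (s : ℝ) : ∑ i, ∑ j, (if M.IsRidge s i j then g i + g j else 0) ≤
      2 * (2 / ρ ^ 2) * ∑ i, g i :=
    sum_relation_le (fun i j => M.IsRidge s i j) hg (card_ridge_right hρ hQ s)
      (card_ridge_left hρ hQ s)
  unfold ridgeAvgAvg sumRidges
  calc _ ≤ ∑ i, ∑ j, (1 / 2 * (C / (ρ * M.h)) * (if M.IsRidge c i j then g i + g j else 0) +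
        1 / 2 * (C / (ρ * M.h)) * (if M.IsRidge d i j then g i + g j else 0)) := by
        refine Finset.sum_le_sum fun i _ => Finset.sum_le_sum fun j _ => ?_
        convert add_le_add (hridge c (Or.inl rfl) i j) (hridge d (Or.inr rfl) i j)
    _ = 1 / 2 * (C / (ρ * M.h)) * ((∑ i, ∑ j, if M.IsRidge c i j then g i + g j else 0) +
        ∑ i, ∑ j, if M.IsRidge d i j then g i + g j else 0) := by
        simp only [Finset.mul_sum, mul_add, Finset.sum_add_distrib]
    _ ≤ 1 / 2 * (C / (ρ * M.h)) * (2 * (2 / ρ ^ 2) * ∑ i, g i + 2 * (2 / ρ ^ 2) * ∑ i, g i) := by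
        gcongr
        · exact hsum c
        · exact hsum d
    _ = _ := by rw [hG]; field_simp; ring

end Mesh
/-! ### Chains of intervals -/

/-- A family of intervals `[l i, r i]`, `i ∈ S`, with disjoint interiors that covers `[c, d]`. -/
structure IsIntervalPartition {ι : Type*} (S : Finset ι) (l r : ι → ℝ) (c d : ℝ) : Prop where
  lt : ∀ i ∈ S, l i < r i
  le_left : ∀ i ∈ S, c ≤ l i
  right_le : ∀ i ∈ S, r i ≤ d
  cover : ∀ y ∈ Set.Icc c d, ∃ i ∈ S, l i ≤ y ∧ y ≤ r i
  disjoint : ∀ i ∈ S, ∀ j ∈ S, i ≠ j → Disjoint (Set.Ioo (l i) (r i)) (Set.Ioo (l j) (r j))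

namespace IsIntervalPartition

variable {ι : Type*} {S : Finset ι} {l r : ι → ℝ} {c d : ℝ}

/-- Take `y` to the left of `l j` but to the right of every right end below `l j`. The interval that
contains `y` must reach `l j`, and disjointness of the interiors prevents it from going further. -/
lemma exists_pred (hP : IsIntervalPartition S l r c d) {j : ι} (hj : j ∈ S) (hcj : c < l j) :
    ∃ k ∈ S, l k < l j ∧ r k = l j := by
  have h1 : ∀ᶠ y in nhdsWithin (l j) (Set.Iio (l j)), ∀ k ∈ S, r k < l j → r k < y := by
    rw [Filter.eventually_all_finset]
    intro k _
    by_cases hk : r k < l j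
    · filter_upwards [Ioo_mem_nhdsLT hk] with y hy _ using hy.1
    · exact Filter.Eventually.of_forall fun y h => absurd h hk
  obtain ⟨y, hy, hcy, hyl⟩ := (h1.and (Ioo_mem_nhdsLT hcj)).exists
  have hjd : l j ≤ d := (hP.lt j hj).le.trans (hP.right_le j hj)
  obtain ⟨k, hk, hlk, hrk⟩ := hP.cover y ⟨hcy.le, hyl.le.trans hjd⟩
  have hlkj : l k < l j := hlk.trans_lt hyl
  have hge : l j ≤ r k := by
    by_contra! h
    exact absurd (hy k hk h) (not_lt.2 hrk)
  refine ⟨k, hk, hlkj, le_antisymm ?_ hge⟩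
  by_contra! h
  obtain ⟨t, ht1, ht2⟩ := exists_between (lt_min h (hP.lt j hj))
  have hne : k ≠ j := fun h => absurd hlkj (by rw [h]; exact lt_irrefl _)
  exact Set.disjoint_left.1 (hP.disjoint k hk j hj hne)
    (show t ∈ Set.Ioo (l k) (r k) from ⟨hlkj.trans ht1, ht2.trans_le (min_le_left _ _)⟩)
    ⟨ht1, ht2.trans_le (min_le_right _ _)⟩

/-- A piecewise function is bounded by its value at the left end, its oscillations and its jumps. -/
lemma abs_le (hP : IsIntervalPartition S l r c d) {w : ι → ℝ → ℝ} {D J : ι → ℝ} {A : ℝ}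
    (hD : ∀ i ∈ S, ∀ y ∈ Set.Icc (l i) (r i), |w i y - w i (l i)| ≤ D i)
    (hD' : ∀ i ∈ S, |w i (r i) - w i (l i)| ≤ D i)
    (hJ0 : ∀ i ∈ S, 0 ≤ J i)
    (hJ : ∀ i ∈ S, ∀ k ∈ S, k ≠ i → r k = l i → |w i (l i) - w k (l i)| ≤ J i)
    (hA : ∀ i ∈ S, l i = c → |w i c| ≤ A) {j : ι} (hj : j ∈ S) {y : ℝ}
    (hy : y ∈ Set.Icc (l j) (r j)) : |w j y| ≤ A + ∑ i ∈ S, (D i + J i) := by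
  classical
  have hDJ (i : ι) (hi : i ∈ S) : 0 ≤ D i + J i :=
    add_nonneg ((abs_nonneg _).trans (hD' i hi)) (hJ0 i hi)
  -- Induction on the number of intervals to the left of `j`. The sum is restricted to intervals up
  -- to `j`, so that the step from the predecessor adds exactly the new term `D j + J j`.
  have main : ∀ (n : ℕ) (j : ι), j ∈ S → (S.filter fun i => l i < l j).card ≤ n →
      ∀ y ∈ Set.Icc (l j) (r j), |w j y| ≤ A + ∑ i ∈ S.filter (fun i => l i ≤ l j), (D i + J i) := by
    intro n
    induction n with
    | zero =>
      intro j hj hn y hy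
      have hcj : l j = c := by
        by_contra hne
        obtain ⟨k, hk, hkj, -⟩ := hP.exists_pred hj (lt_of_le_of_ne (hP.le_left j hj) (Ne.symm hne))
        rw [Nat.le_zero, Finset.card_eq_zero, Finset.filter_eq_empty_iff] at hn
        exact hn hk hkj
      have h1 := hA j hj hcj
      have h2 := hD j hj y hy
      have h3 : D j + J j ≤ ∑ i ∈ S.filter (fun i => l i ≤ l j), (D i + J i) :=
        Finset.single_le_sum (f := fun i => D i + J i)
          (fun i hi => hDJ i (Finset.mem_filter.1 hi).1) (Finset.mem_filter.2 ⟨hj, le_rfl⟩)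
      have h4 := abs_sub_abs_le_abs_sub (w j y) (w j (l j))
      rw [hcj] at h2 h4
      linarith [hJ0 j hj]
    | succ n ih =>
      intro j hj hn y hy
      have h2 := hD j hj y hy
      have h4 := abs_sub_abs_le_abs_sub (w j y) (w j (l j))
      rcases (hP.le_left j hj).eq_or_lt with hcj | hcj
      · have h1 := hA j hj hcj.symm
        have h3 : D j + J j ≤ ∑ i ∈ S.filter (fun i => l i ≤ l j), (D i + J i) :=
          Finset.single_le_sum (f := fun i => D i + J i)
            (fun i hi => hDJ i (Finset.mem_filter.1 hi).1) (Finset.mem_filter.2 ⟨hj, le_rfl⟩)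
        rw [← hcj] at h2 h4 h3 ⊢
        linarith [hJ0 j hj]
      · obtain ⟨k, hk, hkj, hrk⟩ := hP.exists_pred hj hcj
        have hne : k ≠ j := fun h => absurd hkj (by rw [h]; exact lt_irrefl _)
        have hcard : (S.filter fun i => l i < l k).card ≤ n := by
          refine Nat.lt_succ_iff.1 (lt_of_lt_of_le (Finset.card_lt_card ?_) hn)
          refine Finset.ssubset_iff_of_subset (fun i hi => ?_) |>.2
            ⟨k, Finset.mem_filter.2 ⟨hk, hkj⟩, by simp⟩
          rw [Finset.mem_filter] at hi ⊢
          exact ⟨hi.1, hi.2.trans hkj⟩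
        have h5 := ih k hk hcard (r k) (Set.right_mem_Icc.2 (hP.lt k hk).le)
        have h6 := hJ j hj k hk hne hrk
        have h7 := abs_sub_abs_le_abs_sub (w j (l j)) (w k (l j))
        rw [hrk] at h5
        have hnot : j ∉ S.filter (fun i => l i ≤ l k) := by
          simp [hkj]
        have h8 : (D j + J j) + ∑ i ∈ S.filter (fun i => l i ≤ l k), (D i + J i) ≤
            ∑ i ∈ S.filter (fun i => l i ≤ l j), (D i + J i) := by
          refine (Finset.sum_insert (f := fun i => D i + J i) hnot).symm.trans_le ?_
          refine Finset.sum_le_sum_of_subset_of_nonneg (fun i hi => ?_)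
            fun i hi _ => hDJ i (Finset.mem_filter.1 hi).1
          rw [Finset.mem_insert] at hi
          rcases hi with rfl | hi
          · exact Finset.mem_filter.2 ⟨hj, le_rfl⟩
          · rw [Finset.mem_filter] at hi ⊢
            exact ⟨hi.1, hi.2.trans hkj.le⟩
        linarith
  refine (main _ j hj le_rfl y hy).trans (add_le_add le_rfl ?_)
  exact Finset.sum_le_sum_of_subset_of_nonneg (Finset.filter_subset _ _) fun i hi _ => hDJ i hi

/-- The quadratic form of `IsIntervalPartition.abs_le`. -/
lemma sq_le (hP : IsIntervalPartition S l r c d) {w : ι → ℝ → ℝ} {D J : ι → ℝ} {A : ℝ}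
    (hD : ∀ i ∈ S, ∀ y ∈ Set.Icc (l i) (r i), (w i y - w i (l i)) ^ 2 ≤ D i)
    (hJ : ∀ i ∈ S, ∀ k ∈ S, k ≠ i → r k = l i → (w i (l i) - w k (l i)) ^ 2 ≤ J i)
    (hA : ∀ i ∈ S, l i = c → w i c ^ 2 ≤ A) {j : ι} (hj : j ∈ S)
    (hA0 : 0 ≤ A) (hD0 : ∀ i ∈ S, 0 ≤ D i) (hJ0 : ∀ i ∈ S, 0 ≤ J i) {y : ℝ}
    (hy : y ∈ Set.Icc (l j) (r j)) :
    w j y ^ 2 ≤ 3 * (A + S.card * ∑ i ∈ S, D i + S.card * ∑ i ∈ S, J i) := by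
  have h1 := hP.abs_le (w := w) (D := fun i => √(D i)) (J := fun i => √(J i)) (A := √A)
    (fun i hi y hy => Real.abs_le_sqrt (hD i hi y hy))
    (fun i hi => Real.abs_le_sqrt (hD i hi _ (Set.right_mem_Icc.2 (hP.lt i hi).le)))
    (fun i _ => Real.sqrt_nonneg _)
    (fun i hi k hk hne hkr => Real.abs_le_sqrt (hJ i hi k hk hne hkr))
    (fun i hi hic => Real.abs_le_sqrt (hA i hi hic)) hj hy
  have h2 := sq_sum_le_card_mul_sum_sq (s := S) (f := fun i => √(D i))
  have h3 := sq_sum_le_card_mul_sum_sq (s := S) (f := fun i => √(J i))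
  rw [Finset.sum_congr rfl fun i hi => Real.sq_sqrt (hD0 i hi)] at h2
  rw [Finset.sum_congr rfl fun i hi => Real.sq_sqrt (hJ0 i hi)] at h3
  rw [Finset.sum_add_distrib] at h1
  have h4 : w j y ^ 2 ≤ (√A + (∑ i ∈ S, √(D i) + ∑ i ∈ S, √(J i))) ^ 2 := by
    rw [← sq_abs]
    exact pow_le_pow_left₀ (abs_nonneg _) h1 2
  have h5 := Real.sq_sqrt hA0
  nlinarith [sq_nonneg (√A - ∑ i ∈ S, √(D i)), sq_nonneg (√A - ∑ i ∈ S, √(J i)),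
    sq_nonneg (∑ i ∈ S, √(D i) - ∑ i ∈ S, √(J i))]

end IsIntervalPartition

/-! ### Vertical derivatives -/

lemma hasDerivAt_val_vertical (q : MvPolynomial (Fin 2) ℝ) (x y : ℝ) :
    HasDerivAt (fun y => val q !₂[x, y]) (val (MvPolynomial.pderiv 1 q) !₂[x, y]) y := by
  induction q using MvPolynomial.induction_on with
  | C t => simpa [val] using hasDerivAt_const y t
  | add q₁ q₂ h₁ h₂ => simpa [val] using h₁.fun_add h₂
  | mul_X q k hq =>
    fin_cases k
    · have := hq.mul_const x
      simpa [val, Derivation.leibniz, mul_comm] using this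
    · have := hq.fun_mul (hasDerivAt_id' y)
      simpa [val, Derivation.leibniz, mul_comm, add_comm] using this

/-- Cauchy-Schwarz, obtained by expanding the nonnegative integral of `((t - s) f - I)²`. -/
lemma sq_intervalIntegral_le {f : ℝ → ℝ} (hf : Continuous f) {s t : ℝ} (hst : s ≤ t) :
    (∫ y in s..t, f y) ^ 2 ≤ (t - s) * ∫ y in s..t, f y ^ 2 := by
  set I := ∫ y in s..t, f y
  rcases hst.eq_or_lt with rfl | hlt
  · simp [I]
  have h0 : 0 ≤ ∫ y in s..t, ((t - s) * f y - I) ^ 2 :=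
    intervalIntegral.integral_nonneg hst fun y _ => sq_nonneg _
  have h1 : ∫ y in s..t, ((t - s) * f y - I) ^ 2 =
      (t - s) ^ 2 * (∫ y in s..t, f y ^ 2) - 2 * (t - s) * I * I + (t - s) * I ^ 2 := by
    have e : ∀ y, ((t - s) * f y - I) ^ 2 =
        (t - s) ^ 2 * f y ^ 2 - 2 * (t - s) * I * f y + I ^ 2 := fun y => by ring
    simp_rw [e]
    rw [intervalIntegral.integral_add (Continuous.intervalIntegrable (by fun_prop) _ _)
      (Continuous.intervalIntegrable (by fun_prop) _ _),
      intervalIntegral.integral_sub (Continuous.intervalIntegrable (by fun_prop) _ _)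
      (Continuous.intervalIntegrable (by fun_prop) _ _), intervalIntegral.integral_const_mul,
      intervalIntegral.integral_const_mul, intervalIntegral.integral_const, smul_eq_mul]
  have hpos : 0 < t - s := sub_pos.2 hlt
  refine le_of_mul_le_mul_left ?_ hpos
  rw [h1] at h0
  linarith

lemma sq_val_sub_le (q : MvPolynomial (Fin 2) ℝ) (x : ℝ) {l r y : ℝ} (hy : y ∈ Set.Icc l r) :
    (val q !₂[x, y] - val q !₂[x, l]) ^ 2 ≤
      (r - l) * ∫ t in Set.Ioo l r, val (MvPolynomial.pderiv 1 q) !₂[x, t] ^ 2 := by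
  have h1 : ∫ t in l..y, val (MvPolynomial.pderiv 1 q) !₂[x, t] = val q !₂[x, y] - val q !₂[x, l] :=
    intervalIntegral.integral_eq_sub_of_hasDerivAt (fun t _ => hasDerivAt_val_vertical q x t)
      (Continuous.intervalIntegrable (by fun_prop) _ _)
  have hlr : l ≤ r := hy.1.trans hy.2
  rw [← h1, ← integral_Ioc_eq_integral_Ioo, ← intervalIntegral.integral_of_le hlr]
  have hcont : Continuous fun t : ℝ => val (MvPolynomial.pderiv 1 q) !₂[x, t] := by fun_prop
  refine (sq_intervalIntegral_le hcont hy.1).trans ?_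
  have h2 : ∫ t in l..y, val (MvPolynomial.pderiv 1 q) !₂[x, t] ^ 2 ≤
      ∫ t in l..r, val (MvPolynomial.pderiv 1 q) !₂[x, t] ^ 2 :=
    intervalIntegral.integral_mono_interval le_rfl hy.1 hy.2 (ae_of_all _ fun t => sq_nonneg _)
      (Continuous.intervalIntegrable (by fun_prop) _ _)
  have h3 : 0 ≤ ∫ t in l..y, val (MvPolynomial.pderiv 1 q) !₂[x, t] ^ 2 :=
    intervalIntegral.integral_nonneg hy.1 fun t _ => sq_nonneg _
  exact mul_le_mul (by linarith [hy.2]) h2 h3 (by linarith)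

/-! ### Integration over vertical lines -/

lemma integral_plane {F : Plane → ℝ} (hF : Integrable F) :
    ∫ x, F x = ∫ s : ℝ, ∫ t : ℝ, F !₂[s, t] := by
  have hmp := measurePreserving_coords.symm coords
  rw [← hmp.integral_comp' F, Measure.volume_eq_prod, integral_prod]
  · rfl
  · exact (hmp.integrable_comp_emb coords.symm.measurableEmbedding).2 hF

lemma integrable_integral_vertical {F : Plane → ℝ} (hF : Integrable F) :
    Integrable fun s : ℝ => ∫ t : ℝ, F !₂[s, t] := by
  have hmp := measurePreserving_coords.symm coords
  exact ((hmp.integrable_comp_emb coords.symm.measurableEmbedding).2 hF).integral_prod_left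

/-! ### Slices of triangles by vertical lines -/

namespace Mesh

variable {a b c d : ℝ} {M : Mesh a b c d}

/-- Lower end of the slice of triangle `i` at the abscissa `x`. -/
def lower (M : Mesh a b c d) (x : ℝ) (i : Fin M.N) : ℝ :=
  sInf {y : ℝ | (!₂[x, y] : Plane) ∈ M.closedTri i}

/-- Upper end of the slice of triangle `i` at the abscissa `x`. -/
def upper (M : Mesh a b c d) (x : ℝ) (i : Fin M.N) : ℝ :=
  sSup {y : ℝ | (!₂[x, y] : Plane) ∈ M.closedTri i}

/-- Since `x` is not the abscissa of a vertex, some vertices lie strictly to the left and some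
strictly to the right. Interior points near two such vertices are joined by a segment in the
interior, which crosses the line. -/
lemma exists_mem_tri_of_abscissa {i : Fin M.N} {x : ℝ} (hx : ∀ k, M.vert i k 0 ≠ x)
    {y : ℝ} (hy : !₂[x, y] ∈ M.closedTri i) : ∃ y', !₂[x, y'] ∈ M.tri i := by
  obtain ⟨w, hw0, hw1, hwx⟩ := exists_weights hy
  have hwx0 := hwx 0
  simp only [Matrix.cons_val_zero] at hwx0
  have hcl (k : Fin 3) : M.vert i k ∈ closure (M.tri i) := by
    rw [M.closure_tri]; exact M.vert_mem i k
  have hleft : ∃ k, M.vert i k 0 < x := by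
    by_contra! h
    have h' (k : Fin 3) : x < M.vert i k 0 := lt_of_le_of_ne (h k) (hx k).symm
    have e0 := mul_nonneg (hw0 0) (sub_pos.2 (h' 0)).le
    have e1 := mul_nonneg (hw0 1) (sub_pos.2 (h' 1)).le
    have e2 := mul_nonneg (hw0 2) (sub_pos.2 (h' 2)).le
    have hsum : w 0 * (M.vert i 0 0 - x) + w 1 * (M.vert i 1 0 - x) + w 2 * (M.vert i 2 0 - x) = 0 := by
      linear_combination (-1 : ℝ) * hwx0 - x * hw1
    have z0 := (mul_eq_zero.1 (by linarith : w 0 * (M.vert i 0 0 - x) = 0)).resolve_right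
      (sub_pos.2 (h' 0)).ne'
    have z1 := (mul_eq_zero.1 (by linarith : w 1 * (M.vert i 1 0 - x) = 0)).resolve_right
      (sub_pos.2 (h' 1)).ne'
    have z2 := (mul_eq_zero.1 (by linarith : w 2 * (M.vert i 2 0 - x) = 0)).resolve_right
      (sub_pos.2 (h' 2)).ne'
    linarith
  have hright : ∃ k, x < M.vert i k 0 := by
    by_contra! h
    have h' (k : Fin 3) : M.vert i k 0 < x := lt_of_le_of_ne (h k) (hx k)
    have e0 := mul_nonneg (hw0 0) (sub_pos.2 (h' 0)).le
    have e1 := mul_nonneg (hw0 1) (sub_pos.2 (h' 1)).le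
    have e2 := mul_nonneg (hw0 2) (sub_pos.2 (h' 2)).le
    have hsum : w 0 * (x - M.vert i 0 0) + w 1 * (x - M.vert i 1 0) + w 2 * (x - M.vert i 2 0) = 0 := by
      linear_combination hwx0 + x * hw1
    have z0 := (mul_eq_zero.1 (by linarith : w 0 * (x - M.vert i 0 0) = 0)).resolve_right
      (sub_pos.2 (h' 0)).ne'
    have z1 := (mul_eq_zero.1 (by linarith : w 1 * (x - M.vert i 1 0) = 0)).resolve_right
      (sub_pos.2 (h' 1)).ne'
    have z2 := (mul_eq_zero.1 (by linarith : w 2 * (x - M.vert i 2 0) = 0)).resolve_right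
      (sub_pos.2 (h' 2)).ne'
    linarith
  obtain ⟨k, hk⟩ := hleft
  obtain ⟨k', hk'⟩ := hright
  have hcont : Continuous fun z : Plane => z 0 := by fun_prop
  obtain ⟨o, ho, hoT⟩ := mem_closure_iff.1 (hcl k) _ (isOpen_Iio.preimage hcont) hk
  obtain ⟨o', ho', hoT'⟩ := mem_closure_iff.1 (hcl k') _ (isOpen_Ioi.preimage hcont) hk'
  have ho1 : o 0 < x := ho
  have ho1' : x < o' 0 := ho'
  have hpos : 0 < o' 0 - o 0 := by linarith
  have hmem := (M.convex_closedTri i).interior hoT hoT' (a := (o' 0 - x) / (o' 0 - o 0))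
    (b := (x - o 0) / (o' 0 - o 0)) (div_nonneg (by linarith) hpos.le)
    (div_nonneg (by linarith) hpos.le) (by field_simp; ring)
  set z : Plane := ((o' 0 - x) / (o' 0 - o 0)) • o + ((x - o 0) / (o' 0 - o 0)) • o' with hz
  refine ⟨z 1, ?_⟩
  have : (!₂[x, z 1] : Plane) = z := by
    apply plane_ext
    · simp [hz]
      field_simp
      ring
    · simp
  rw [this]
  exact hmem

/-- Avoiding the abscissae of the vertices makes the slice nondegenerate, and the slice of the open
triangle is then exactly the open interval. Disjointness of open triangles thus passes to the
intervals. -/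
lemma vertical_slice {i : Fin M.N} {x : ℝ} (hx : ∀ k, M.vert i k 0 ≠ x)
    (hne : ∃ y, !₂[x, y] ∈ M.closedTri i) :
    M.lower x i < M.upper x i ∧ M.upper x i - M.lower x i ≤ M.h ∧
      (∀ y, !₂[x, y] ∈ M.closedTri i ↔ y ∈ Set.Icc (M.lower x i) (M.upper x i)) ∧
      ∀ y, !₂[x, y] ∈ M.tri i ↔ y ∈ Set.Ioo (M.lower x i) (M.upper x i) := by
  obtain ⟨y₀, hy₀⟩ := hne
  obtain ⟨y₁, hy₁⟩ := exists_mem_tri_of_abscissa hx hy₀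
  set Y : Set ℝ := {y : ℝ | (!₂[x, y] : Plane) ∈ M.closedTri i} with hYdef
  set O : Set ℝ := {y : ℝ | (!₂[x, y] : Plane) ∈ M.tri i} with hOdef
  have hcont : Continuous fun y : ℝ => (!₂[x, y] : Plane) := by fun_prop
  have hOY : O ⊆ Y := fun y hy => M.tri_subset i hy
  have hOopen : IsOpen O := (M.isOpen_tri i).preimage hcont
  have hK : IsCompact Y :=
    ((M.isCompact_closedTri i).image (f := fun z : Plane => z 1) (by fun_prop)).of_isClosed_subset
      ((M.isClosed_closedTri i).preimage hcont) fun y hy => ⟨_, hy, by simp⟩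
  have hne : Y.Nonempty := ⟨y₀, hy₀⟩
  have hl : M.lower x i ∈ Y := hK.sInf_mem hne
  have hr : M.upper x i ∈ Y := hK.sSup_mem hne
  have hYsub : Y ⊆ Set.Icc (M.lower x i) (M.upper x i) := fun y hy =>
    ⟨csInf_le hK.bddBelow hy, le_csSup hK.bddAbove hy⟩
  have hOsub : O ⊆ Set.Ioo (M.lower x i) (M.upper x i) := by
    rw [← interior_Icc]
    exact interior_maximal (hOY.trans hYsub) hOopen
  have hpt (s t y y' : ℝ) (hst : s + t = 1) :
      s • (!₂[x, y] : Plane) + t • (!₂[x, y'] : Plane) = !₂[x, s * y + t * y'] := by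
    apply plane_ext
    · simp
      linear_combination x * hst
    · simp
  -- A segment from an interior point to a point of a convex set stays in the interior, except
  -- possibly at its far end.
  have hIoo : Set.Ioo (M.lower x i) (M.upper x i) ⊆ O := by
    have hend (e y : ℝ) (he : e ∈ Y) (hy : y ∈ openSegment ℝ y₁ e) : y ∈ O := by
      obtain ⟨s, t, hs, ht, hst, rfl⟩ := hy
      have := (M.convex_closedTri i).combo_interior_self_mem_interior hy₁ he hs ht.le hst
      rwa [hpt s t _ _ hst] at this
    intro y hy
    rcases lt_trichotomy y y₁ with h | h | h
    · refine hend _ y hl ?_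
      rw [openSegment_symm, openSegment_eq_Ioo (hy.1.trans h)]
      exact ⟨hy.1, h⟩
    · rw [h]; exact hy₁
    · refine hend _ y hr ?_
      rw [openSegment_eq_Ioo (h.trans hy.2)]
      exact ⟨h, hy.2⟩
  have hlt : M.lower x i < M.upper x i := (hOsub hy₁).1.trans (hOsub hy₁).2
  refine ⟨hlt, ?_, fun y => ⟨fun hy => hYsub hy, fun hy => ?_⟩, fun y =>
    ⟨fun hy => hOsub hy, fun hy => hIoo hy⟩⟩
  · have h1 := abs_coord_sub_le !₂[x, M.upper x i] !₂[x, M.lower x i] 1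
    simp only [Matrix.cons_val_one] at h1
    exact (le_abs_self _).trans (h1.trans (M.dist_le_h hr hl))
  · rcases hy.1.eq_or_lt with h | h
    · rw [← h]; exact hl
    · rcases hy.2.eq_or_lt with h' | h'
      · rw [h']; exact hr
      · exact hOY (hIoo ⟨h, h'⟩)

open Classical in
/-- The triangles met by the vertical line at the abscissa `x`. -/
def column (M : Mesh a b c d) (x : ℝ) : Finset (Fin M.N) :=
  Finset.univ.filter fun i => ∃ y, !₂[x, y] ∈ M.closedTri i

lemma mem_column {x : ℝ} {i : Fin M.N} : i ∈ M.column x ↔ ∃ y, !₂[x, y] ∈ M.closedTri i := by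
  simp [column]

lemma isIntervalPartition_column (hab : a < b) (hcd : c < d) {x : ℝ} (hx : x ∈ Set.Ioo a b)
    (hxv : ∀ i k, M.vert i k 0 ≠ x) :
    IsIntervalPartition (M.column x) (M.lower x) (M.upper x) c d := by
  have hsl (i : Fin M.N) (hi : i ∈ M.column x) := vertical_slice (hxv i) (mem_column.1 hi)
  have hrect {i : Fin M.N} {y : ℝ} (hy : !₂[x, y] ∈ M.closedTri i) : y ∈ Set.Icc c d := by
    simpa using ((mem_closure_Omega_iff hab hcd).1 (M.closedTri_subset i hy)).2
  refine ⟨fun i hi => (hsl i hi).1, fun i hi => ?_, fun i hi => ?_, fun y hy => ?_,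
    fun i hi j hj hij => Set.disjoint_left.2 fun y hyi hyj => ?_⟩
  · exact (hrect (((hsl i hi).2.2.1 _).2 (Set.left_mem_Icc.2 (hsl i hi).1.le))).1
  · exact (hrect (((hsl i hi).2.2.1 _).2 (Set.right_mem_Icc.2 (hsl i hi).1.le))).2
  · obtain ⟨i, hi⟩ := M.exists_mem_closedTri (x := !₂[x, y])
      ((mem_closure_Omega_iff hab hcd).2 ⟨by simpa using Set.Ioo_subset_Icc_self hx, by simpa using hy⟩)
    have hic : i ∈ M.column x := mem_column.2 ⟨y, hi⟩
    exact ⟨i, hic, ((hsl i hic).2.2.1 y).1 hi⟩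
  · exact Set.disjoint_left.1 (M.disjoint_tri hij) (((hsl i hi).2.2.2 y).2 hyi)
      (((hsl j hj).2.2.2 y).2 hyj)

/-! ### Jumps over the edges -/

lemma NonOverlapping.setIntegral_jump_sq {i j : Fin M.N} {τ : Plane} (hO : M.NonOverlapping i j τ)
    (v : M.PiecewisePoly) :
    ∫ x in M.edge i j τ, inner ℝ (M.jump v i j τ x) (M.jump v i j τ x) ∂(μH[1] : Measure Plane) =
      ∫ x in M.edge i j τ, (val (v i) x - val (v j) (x + τ)) ^ 2 ∂(μH[1] : Measure Plane) := by
  obtain ⟨n, u, hn, -, -, hjump⟩ := hO.edge_structure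
  refine integral_congr_ae ?_
  filter_upwards [hjump v] with x hx
  rw [hx, real_inner_self_eq_norm_sq, norm_smul, hn, mul_one, Real.norm_eq_abs, sq_abs]

/-- The squared jump over the edge shared by triangles `i` and `j`. -/
def edgeJumpSq (v : M.PiecewisePoly) (i j : Fin M.N) : ℝ :=
  ∫ x in M.edge i j 0, (val (v i) x - val (v j) x) ^ 2 ∂(μH[1] : Measure Plane)

lemma edgeJumpSq_comm (v : M.PiecewisePoly) (i j : Fin M.N) :
    edgeJumpSq v i j = edgeJumpSq v j i := by
  have h1 : M.edge i j 0 = M.edge j i 0 := by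
    simp only [edge_eq, add_zero, Set.preimage_id']
    exact Set.inter_comm _ _
  unfold edgeJumpSq
  rw [h1]
  congr 1
  ext x
  ring

/-- Each unordered pair is counted twice on the left. The periodic edges on the right are
nonnegative and are discarded, since a vertical line never crosses the periodic boundary. -/
lemma sum_edgeJumpSq_le (v : M.PiecewisePoly) :
    ∑ i, ∑ j, (if i ≠ j then edgeJumpSq v i j else 0) ≤ 2 * M.jumpJump v v := by
  have h1 : ∑ i, ∑ j, (if i ≠ j then edgeJumpSq v i j else 0) =
      ∑ i, ∑ j, (if i < j then edgeJumpSq v i j else 0) +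
        ∑ j, ∑ i, (if j < i then edgeJumpSq v i j else 0) := by
    rw [Finset.sum_comm (f := fun j i => if j < i then edgeJumpSq v i j else 0),
      ← Finset.sum_add_distrib]
    refine Finset.sum_congr rfl fun i _ => ?_
    rw [← Finset.sum_add_distrib]
    refine Finset.sum_congr rfl fun j _ => ?_
    rcases lt_trichotomy i j with h | h | h
    · simp [h, h.ne, h.le]
    · simp [h]
    · simp [h, h.ne', h.le]
  have h2 : ∑ j, ∑ i, (if j < i then edgeJumpSq v i j else 0) =
      ∑ i, ∑ j, (if i < j then edgeJumpSq v i j else 0) :=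
    Finset.sum_congr rfl fun i _ => Finset.sum_congr rfl fun j _ => by rw [edgeJumpSq_comm]
  have h3 : ∑ i, ∑ j, (if i < j then edgeJumpSq v i j else 0) ≤ M.jumpJump v v := by
    unfold jumpJump sumEdges
    refine le_add_of_le_of_nonneg (Finset.sum_le_sum fun i _ => Finset.sum_le_sum fun j _ => ?_)
      (Finset.sum_nonneg fun i _ => Finset.sum_nonneg fun j _ =>
        integral_nonneg fun x => real_inner_self_nonneg)
    split_ifs with hij
    · rw [(nonOverlapping_zero hij.ne).setIntegral_jump_sq]
      simp [edgeJumpSq]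
    · rfl
  rw [h1, h2]
  linarith

lemma exists_section_edge {i j : Fin M.N} (hij : i ≠ j) :
    ∃ (s : ℝ → Plane) (bad : Set ℝ), Continuous s ∧ (∀ t, s t 0 = t) ∧ bad.Finite ∧
      ∀ x y, x ∉ bad → !₂[x, y] ∈ M.edge i j 0 → s x = !₂[x, y] := by
  obtain ⟨n, u, hn, hline, -, -⟩ := (nonOverlapping_zero hij).edge_structure
  have hn2 : n 0 ^ 2 + n 1 ^ 2 = 1 := by rw [← norm_sq_plane, hn, one_pow]
  -- For `n 1 ≠ 0` the edge is a graph. For `n 1 = 0` it is vertical and met only at the abscissa `u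
  -- / n 0`, which is declared bad; the section is then irrelevant. Division by zero in the unused
  -- case is harmless.
  refine ⟨fun t => !₂[t, (u - n 0 * t) / n 1], {u / n 0}, by fun_prop, fun t => by simp,
    Set.finite_singleton _, fun x y hx hxy => ?_⟩
  have h1 := hline _ hxy
  simp only [inner_plane, Matrix.cons_val_zero, Matrix.cons_val_one] at h1
  by_cases hn1 : n 1 = 0
  · exfalso
    have hn0 : n 0 ≠ 0 := fun h => by simp [h, hn1] at hn2
    apply hx
    rw [Set.mem_singleton_iff, eq_div_iff hn0]
    rw [hn1] at h1
    linarith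
  · apply plane_ext
    · simp
    · change (u - n 0 * x) / n 1 = y
      rw [div_eq_iff hn1]
      linarith

/-! ### A broken Poincaré inequality -/

lemma integrable_indicator_section {E : Set Plane} (hE : IsCompact E) {s : ℝ → Plane}
    (hs : Continuous s) (hs0 : ∀ t, s t 0 = t) {F : Plane → ℝ} (hF : Continuous F) :
    Integrable (Set.indicator {t | s t ∈ E} fun t => F (s t)) := by
  have hK : IsCompact {t | s t ∈ E} :=
    (hE.image (f := fun x : Plane => x 0) (by fun_prop)).of_isClosed_subset
      (hE.isClosed.preimage hs) fun t ht => ⟨_, ht, hs0 t⟩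
  rw [integrable_indicator_iff hK.measurableSet]
  exact integrableOn_of_continuous_of_isCompact hK hK.measure_lt_top (by fun_prop)

lemma integral_indicator_section_le {E : Set Plane} (hE : IsCompact E) {s : ℝ → Plane}
    (hs : Continuous s) (hs0 : ∀ t, s t 0 = t) {F : Plane → ℝ} (hF : Continuous F)
    (hF0 : ∀ x, 0 ≤ F x) (hFint : IntegrableOn F E (μH[1] : Measure Plane)) :
    ∫ t, Set.indicator {t | s t ∈ E} (fun t => F (s t)) t ≤
      ∫ x in E, F x ∂(μH[1] : Measure Plane) := by
  have hmeas : MeasurableSet {t | s t ∈ E} := (hE.isClosed.preimage hs).measurableSet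
  rw [integral_indicator hmeas]
  exact integral_section_le hs hs0 (fun t ht => ht) hF hF0 hFint

/-- The estimate on a single vertical line. -/
lemma column_estimate (hab : a < b) (hcd : c < d) {ρ : ℝ} (hρ : 0 < ρ) (hQ : M.QuasiUniform ρ)
    (v : M.PiecewisePoly) {x : ℝ} (hx : x ∈ Set.Ioo a b) (hxv : ∀ i k, M.vert i k 0 ≠ x)
    {J : Fin M.N → Fin M.N → ℝ} (hJ0 : ∀ i k, 0 ≤ J i k)
    (hJ : ∀ i k, i ≠ k → ∀ y, !₂[x, y] ∈ M.edge i k 0 →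
      (val (v i) !₂[x, y] - val (v k) !₂[x, y]) ^ 2 ≤ J i k) :
    ∑ j, ∫ y, (M.tri j).indicator (fun z => val (v j) z ^ 2) !₂[x, y] ≤
      3 * ((d - c) / ρ ^ 2) *
        (∑ i, Set.indicator {t | !₂[t, c] ∈ M.closedTri i} (fun t => val (v i) !₂[t, c] ^ 2) x +
        (d - c) / ρ ^ 2 * (∑ i, ∫ y, (M.tri i).indicator
          (fun z => val (MvPolynomial.pderiv 1 (v i)) z ^ 2) !₂[x, y]) +
        (d - c) / ρ ^ 2 / M.h * ∑ i, ∑ k, J i k) := by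
  have hh := M.h_pos hab hcd
  set S := M.column x with hS
  set B : Fin M.N → ℝ := fun i =>
    Set.indicator {t | !₂[t, c] ∈ M.closedTri i} (fun t => val (v i) !₂[t, c] ^ 2) x with hB
  set P : Fin M.N → ℝ := fun i => ∫ y, (M.tri i).indicator
    (fun z => val (MvPolynomial.pderiv 1 (v i)) z ^ 2) !₂[x, y] with hP
  have hB0 (i : Fin M.N) : 0 ≤ B i := Set.indicator_nonneg (fun t _ => sq_nonneg _) x
  have hP0 (i : Fin M.N) : 0 ≤ P i :=
    integral_nonneg fun y => Set.indicator_nonneg (fun t _ => sq_nonneg _) _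
  have hpart := isIntervalPartition_column (M := M) hab hcd hx hxv
  have hsl (i : Fin M.N) (hi : i ∈ S) := vertical_slice (hxv i) (mem_column.1 hi)
  have hcard : S.card * M.h ≤ (d - c) / ρ ^ 2 :=
    card_mul_h_le_of_abscissa hab hcd hρ hQ S x fun i hi => by
      obtain ⟨y, hy⟩ := mem_column.1 hi
      exact ⟨_, hy, by simp⟩
  have hind (i : Fin M.N) (hi : i ∈ S) (F : Plane → ℝ) (y : ℝ) :
      (M.tri i).indicator F !₂[x, y] =
        (Set.Ioo (M.lower x i) (M.upper x i)).indicator (fun y => F !₂[x, y]) y := by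
    by_cases hy : !₂[x, y] ∈ M.tri i
    · rw [Set.indicator_of_mem hy, Set.indicator_of_mem (((hsl i hi).2.2.2 y).1 hy)]
    · rw [Set.indicator_of_notMem hy,
        Set.indicator_of_notMem fun h => hy (((hsl i hi).2.2.2 y).2 h)]
  have hPeq (i : Fin M.N) (hi : i ∈ S) :
      P i = ∫ y in Set.Ioo (M.lower x i) (M.upper x i),
        val (MvPolynomial.pderiv 1 (v i)) !₂[x, y] ^ 2 := by
    simp only [hP, hind i hi]
    rw [integral_indicator measurableSet_Ioo]
  -- Uniform bound for the squared values on the line: the bottom value plus the sums of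
  -- oscillations and jumps, each with the factor `S.card` from Cauchy-Schwarz.
  set R := 3 * (∑ i, B i + S.card * ∑ i ∈ S, M.h * P i + S.card * ∑ i ∈ S, ∑ k, J i k) with hR
  have hR0 : 0 ≤ R := by
    have h1 : 0 ≤ ∑ i, B i := Finset.sum_nonneg fun i _ => hB0 i
    have h2 : 0 ≤ ∑ i ∈ S, M.h * P i := Finset.sum_nonneg fun i _ => mul_nonneg hh.le (hP0 i)
    have h3 : 0 ≤ ∑ i ∈ S, ∑ k, J i k :=
      Finset.sum_nonneg fun i _ => Finset.sum_nonneg fun k _ => hJ0 i k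
    positivity
  have hpt (j : Fin M.N) (hj : j ∈ S) (y : ℝ) (hy : y ∈ Set.Icc (M.lower x j) (M.upper x j)) :
      val (v j) !₂[x, y] ^ 2 ≤ R := by
    refine hpart.sq_le (w := fun i y => val (v i) !₂[x, y]) (D := fun i => M.h * P i)
      (J := fun i => ∑ k, J i k) (A := ∑ i, B i) ?_ ?_ ?_ hj
      (Finset.sum_nonneg fun i _ => hB0 i) (fun i _ => mul_nonneg hh.le (hP0 i))
      (fun i _ => Finset.sum_nonneg fun k _ => hJ0 i k) hy
    · intro i hi y hy
      refine (sq_val_sub_le (v i) x hy).trans ?_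
      rw [← hPeq i hi]
      exact mul_le_mul_of_nonneg_right (hsl i hi).2.1 (hP0 i)
    · intro i hi k hk hne hkr
      have hmem : !₂[x, M.lower x i] ∈ M.edge i k 0 := by
        refine ⟨((hsl i hi).2.2.1 _).2 (Set.left_mem_Icc.2 (hsl i hi).1.le), ?_⟩
        rw [add_zero, ← hkr]
        exact ((hsl k hk).2.2.1 _).2 (Set.right_mem_Icc.2 (hsl k hk).1.le)
      exact (hJ i k hne.symm _ hmem).trans
        (Finset.single_le_sum (f := fun k => J i k) (fun k _ => hJ0 i k) (Finset.mem_univ k))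
    · intro i hi hic
      have hmem : !₂[x, c] ∈ M.closedTri i :=
        ((hsl i hi).2.2.1 _).2 ⟨hic.le, hic.ge.trans (hsl i hi).1.le⟩
      have hBi : B i = val (v i) !₂[x, c] ^ 2 := by
        simp only [hB]
        exact Set.indicator_of_mem (s := {t | !₂[t, c] ∈ M.closedTri i}) hmem _
      rw [← hBi]
      exact Finset.single_le_sum (f := B) (fun k _ => hB0 k) (Finset.mem_univ i)
  have hterm (j : Fin M.N) : ∫ y, (M.tri j).indicator (fun z => val (v j) z ^ 2) !₂[x, y] ≤
      if j ∈ S then M.h * R else 0 := by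
    split_ifs with hj
    · simp only [hind j hj]
      have hlt := (hsl j hj).1
      calc ∫ y, (Set.Ioo (M.lower x j) (M.upper x j)).indicator
            (fun y => val (v j) !₂[x, y] ^ 2) y
          ≤ ∫ y, (Set.Ioo (M.lower x j) (M.upper x j)).indicator (fun _ => R) y := by
            refine integral_mono_of_nonneg
              (ae_of_all _ fun y => Set.indicator_nonneg (fun t _ => sq_nonneg _) y) ?_
              (ae_of_all _ fun y => ?_)
            · rw [integrable_indicator_iff measurableSet_Ioo]
              exact integrableOn_const (by simp)
            · by_cases hy : y ∈ Set.Ioo (M.lower x j) (M.upper x j)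
              · rw [Set.indicator_of_mem hy, Set.indicator_of_mem hy]
                exact hpt j hj y (Set.Ioo_subset_Icc_self hy)
              · rw [Set.indicator_of_notMem hy, Set.indicator_of_notMem hy]
        _ = (M.upper x j - M.lower x j) * R := by
            rw [integral_indicator measurableSet_Ioo, setIntegral_const, Measure.real,
              Real.volume_Ioo, ENNReal.toReal_ofReal (by linarith), smul_eq_mul]
        _ ≤ M.h * R := mul_le_mul_of_nonneg_right (hsl j hj).2.1 hR0
    · have hz : ∀ y, (M.tri j).indicator (fun z => val (v j) z ^ 2) !₂[x, y] = 0 := fun y =>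
        Set.indicator_of_notMem (fun h => hj (mem_column.2 ⟨y, M.tri_subset j h⟩)) _
      simp [hz]
  have hCn : 0 ≤ (d - c) / ρ ^ 2 := div_nonneg (by linarith) (by positivity)
  have hsumP : ∑ i ∈ S, P i ≤ ∑ i, P i :=
    Finset.sum_le_sum_of_subset_of_nonneg (Finset.subset_univ _) fun i _ _ => hP0 i
  have hsumJ : ∑ i ∈ S, ∑ k, J i k ≤ ∑ i, ∑ k, J i k :=
    Finset.sum_le_sum_of_subset_of_nonneg (Finset.subset_univ _) fun i _ _ =>
      Finset.sum_nonneg fun k _ => hJ0 i k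
  -- The oscillation terms carry a factor `h` that compensates `S.card`; the jump terms do not,
  -- which leaves `1 / h` in front of them.
  have hcard' : (S.card : ℝ) ≤ (d - c) / ρ ^ 2 / M.h := by rwa [le_div_iff₀ hh]
  have hRle : R ≤ 3 * (∑ i, B i + (d - c) / ρ ^ 2 * ∑ i, P i +
      (d - c) / ρ ^ 2 / M.h * ∑ i, ∑ k, J i k) := by
    rw [hR]
    have e1 : S.card * ∑ i ∈ S, M.h * P i = S.card * M.h * ∑ i ∈ S, P i := by
      rw [← Finset.mul_sum, mul_assoc]
    rw [e1]
    have f1 : S.card * M.h * ∑ i ∈ S, P i ≤ (d - c) / ρ ^ 2 * ∑ i, P i :=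
      mul_le_mul hcard hsumP (Finset.sum_nonneg fun i _ => hP0 i) hCn
    have f2 : S.card * ∑ i ∈ S, ∑ k, J i k ≤ (d - c) / ρ ^ 2 / M.h * ∑ i, ∑ k, J i k :=
      mul_le_mul hcard' hsumJ (Finset.sum_nonneg fun i _ => Finset.sum_nonneg fun k _ => hJ0 i k)
        (by positivity)
    linarith
  calc ∑ j, ∫ y, (M.tri j).indicator (fun z => val (v j) z ^ 2) !₂[x, y]
      ≤ ∑ j, if j ∈ S then M.h * R else 0 := Finset.sum_le_sum fun j _ => hterm j
    _ = S.card * M.h * R := by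
        rw [Finset.sum_ite_mem, Finset.univ_inter, Finset.sum_const, nsmul_eq_mul, mul_assoc]
    _ ≤ (d - c) / ρ ^ 2 * R := mul_le_mul_of_nonneg_right hcard hR0
    _ ≤ (d - c) / ρ ^ 2 * _ := mul_le_mul_of_nonneg_left hRle hCn
    _ = _ := by ring

/-- The broken Poincaré inequality, with a constant that does not depend on the degree. -/
theorem innerOmega_le (hab : a < b) (hcd : c < d) {ρ : ℝ} (hρ : 0 < ρ) (hQ : M.QuasiUniform ρ)
    (v : M.PiecewisePoly) :
    M.innerOmega v v ≤ 3 * ((d - c) / ρ ^ 2) * (M.innerGamma1 v v +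
      (d - c) / ρ ^ 2 * M.gradForm v v + (d - c) / ρ ^ 2 / M.h * (2 * M.jumpJump v v)) := by
  have hh := M.h_pos hab hcd
  set Cn := (d - c) / ρ ^ 2 with hCndef
  have hCn : 0 ≤ Cn := div_nonneg (by linarith) (by positivity)
  -- The diagonal pairs receive a dummy section, so that sections can be chosen for all pairs at
  -- once.
  have hsec (i k : Fin M.N) : ∃ (s : ℝ → Plane) (bad : Set ℝ), Continuous s ∧ (∀ t, s t 0 = t) ∧
      bad.Finite ∧ (i ≠ k → ∀ x y, x ∉ bad → !₂[x, y] ∈ M.edge i k 0 → s x = !₂[x, y]) := by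
    by_cases hik : i = k
    · exact ⟨fun t => !₂[t, 0], ∅, by fun_prop, fun t => by simp, Set.finite_empty,
        fun h => absurd hik h⟩
    · obtain ⟨s, bad, h1, h2, h3, h4⟩ := exists_section_edge (M := M) hik
      exact ⟨s, bad, h1, h2, h3, fun _ => h4⟩
  choose s bad hs hs0 hbad hsec using hsec
  set A : ℝ → ℝ := fun x => ∑ j, ∫ y, (M.tri j).indicator (fun z => val (v j) z ^ 2) !₂[x, y]
  set B : Fin M.N → ℝ → ℝ := fun i =>
    Set.indicator {t | !₂[t, c] ∈ M.closedTri i} (fun t => val (v i) !₂[t, c] ^ 2) with hB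
  set P : Fin M.N → ℝ → ℝ := fun i x => ∫ y, (M.tri i).indicator
    (fun z => val (MvPolynomial.pderiv 1 (v i)) z ^ 2) !₂[x, y] with hP
  set G : Fin M.N → Fin M.N → ℝ → ℝ := fun i k x => if i ≠ k then
    Set.indicator {t | s i k t ∈ M.edge i k 0}
      (fun t => (val (v i) (s i k t) - val (v k) (s i k t)) ^ 2) x else 0 with hG
  have hG0 (i k : Fin M.N) (x : ℝ) : 0 ≤ G i k x := by
    simp only [hG]
    split_ifs
    · exact Set.indicator_nonneg (fun t _ => sq_nonneg _) x
    · exact le_rfl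
  have hintA (q : Fin M.N → MvPolynomial (Fin 2) ℝ) (j : Fin M.N) :
      Integrable ((M.tri j).indicator fun z => val (q j) z ^ 2) := by
    rw [integrable_indicator_iff (M.isOpen_tri j).measurableSet]
    exact M.integrableOn_tri j (by fun_prop)
  have hintB (i : Fin M.N) : Integrable (B i) :=
    integrable_indicator_section (M.isCompact_closedTri i) (s := fun t => !₂[t, c]) (by fun_prop)
      (fun t => by simp) (F := fun z => val (v i) z ^ 2) (by fun_prop)
  have hintP (i : Fin M.N) : Integrable (P i) :=
    integrable_integral_vertical (hintA (fun i => MvPolynomial.pderiv 1 (v i)) i)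
  have hintG (i k : Fin M.N) : Integrable (G i k) := by
    by_cases hik : i = k
    · simp [hG, hik]
    · simp only [hG, ne_eq, hik, not_false_eq_true, if_true]
      exact integrable_indicator_section (M.isCompact_edge i k 0) (hs i k) (hs0 i k)
        (F := fun z => (val (v i) z - val (v k) z) ^ 2) (by fun_prop)
  have hA_int : ∫ x, A x = M.innerOmega v v := by
    rw [integral_finsetSum _ fun j _ => integrable_integral_vertical (hintA v j)]
    refine Finset.sum_congr rfl fun j _ => ?_
    rw [← integral_plane (hintA v j), integral_indicator (M.isOpen_tri j).measurableSet]
    simp only [sq]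
  -- Only finitely many abscissae are excluded: the sides of the rectangle, the vertices, and the
  -- vertical edges.
  have hae : ∀ᵐ x : ℝ, A x ≤ 3 * Cn * (∑ i, B i x + Cn * ∑ i, P i x + Cn / M.h * ∑ i, ∑ k, G i k x) := by
    have hfin : ({a, b} ∪ (⋃ i, ⋃ k, {M.vert i k 0}) ∪ ⋃ i, ⋃ k, bad i k : Set ℝ).Finite :=
      ((Set.toFinite _).union (Set.finite_iUnion fun i => Set.finite_iUnion fun k =>
        Set.finite_singleton _)).union (Set.finite_iUnion fun i => Set.finite_iUnion fun k => hbad i k)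
    filter_upwards [measure_eq_zero_iff_ae_notMem.1 (hfin.measure_zero volume)] with x hx
    simp only [Set.mem_union, not_or, Set.mem_iUnion, not_exists, Set.mem_insert_iff,
      Set.mem_singleton_iff] at hx
    obtain ⟨⟨⟨hxa, hxb⟩, hxv⟩, hxbad⟩ := hx
    by_cases hxab : x ∈ Set.Ioo a b
    · refine column_estimate hab hcd hρ hQ v hxab (fun i k h => hxv i k h.symm)
        (J := fun i k => G i k x) (fun i k => hG0 i k x) fun i k hik y hy => ?_
      have hsx := hsec i k hik x y (hxbad i k) hy
      have hmem : x ∈ {t | s i k t ∈ M.edge i k 0} := by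
        change s i k x ∈ M.edge i k 0
        rw [hsx]
        exact hy
      simp only [hG, ne_eq, hik, not_false_eq_true, if_true]
      rw [Set.indicator_of_mem hmem, hsx]
    · have hA0 : A x = 0 := by
        refine Finset.sum_eq_zero fun j _ => ?_
        have hz : ∀ y, (M.tri j).indicator (fun z => val (v j) z ^ 2) !₂[x, y] = 0 := fun y =>
          Set.indicator_of_notMem (fun h => hxab (by simpa using (M.tri_subset_Omega j h).1)) _
        simp [hz]
      rw [hA0]
      have h1 : 0 ≤ ∑ i, B i x := Finset.sum_nonneg fun i _ =>
        Set.indicator_nonneg (fun t _ => sq_nonneg _) x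
      have h2 : 0 ≤ ∑ i, P i x := Finset.sum_nonneg fun i _ =>
        integral_nonneg fun y => Set.indicator_nonneg (fun t _ => sq_nonneg _) _
      have h3 : 0 ≤ ∑ i, ∑ k, G i k x :=
        Finset.sum_nonneg fun i _ => Finset.sum_nonneg fun k _ => hG0 i k x
      positivity
  have hiB : Integrable fun x => ∑ i, B i x := integrable_finsetSum _ fun i _ => hintB i
  have hiP : Integrable fun x => ∑ i, P i x := integrable_finsetSum _ fun i _ => hintP i
  have hiG : Integrable fun x => ∑ i, ∑ k, G i k x :=
    integrable_finsetSum _ fun i _ => integrable_finsetSum _ fun k _ => hintG i k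
  have hBle : ∫ x, ∑ i, B i x ≤ M.innerGamma1 v v := by
    rw [integral_finsetSum _ fun i _ => hintB i]
    refine Finset.sum_le_sum fun i _ => ?_
    have h1 := setIntegral_slice_le hab hcd (Or.inl rfl : c = c ∨ c = d)
      (A := {t | !₂[t, c] ∈ M.closedTri i}) (fun t ht => ht) (F := fun z => val (v i) z ^ 2)
      (by fun_prop) (fun z => sq_nonneg _)
    have hmeas : MeasurableSet {t : ℝ | !₂[t, c] ∈ M.closedTri i} :=
      ((M.isClosed_closedTri i).preimage (f := fun t : ℝ => (!₂[t, c] : Plane))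
        (by fun_prop)).measurableSet
    simp only [hB]
    rw [integral_indicator hmeas]
    simpa only [sq] using h1
  have hPle : ∫ x, ∑ i, P i x ≤ M.gradForm v v := by
    rw [integral_finsetSum _ fun i _ => hintP i]
    refine Finset.sum_le_sum fun i _ => ?_
    simp only [hP]
    rw [← integral_plane (hintA (fun i => MvPolynomial.pderiv 1 (v i)) i),
      integral_indicator (M.isOpen_tri i).measurableSet]
    refine integral_mono (M.integrableOn_tri i (by fun_prop)) (M.integrableOn_tri i (by fun_prop))
      fun z => ?_
    simp only [real_inner_self_eq_norm_sq, grad_norm_sq]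
    exact le_add_of_nonneg_left (sq_nonneg _)
  have hGle : ∫ x, ∑ i, ∑ k, G i k x ≤ 2 * M.jumpJump v v := by
    refine le_trans ?_ (sum_edgeJumpSq_le v)
    rw [integral_finsetSum _ fun i _ => integrable_finsetSum _ fun k _ => hintG i k]
    refine Finset.sum_le_sum fun i _ => ?_
    rw [integral_finsetSum _ fun k _ => hintG i k]
    refine Finset.sum_le_sum fun k _ => ?_
    by_cases hik : i = k
    · simp [hG, hik]
    · simp only [hG, ne_eq, hik, not_false_eq_true, if_true]
      exact integral_indicator_section_le (M.isCompact_edge i k 0) (hs i k) (hs0 i k)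
        (F := fun z => (val (v i) z - val (v k) z) ^ 2) (by fun_prop) (fun z => sq_nonneg _)
        ((nonOverlapping_zero hik).integrableOn_edge (by fun_prop))
  rw [← hA_int]
  calc ∫ x, A x
      ≤ ∫ x, 3 * Cn * (∑ i, B i x + Cn * ∑ i, P i x + Cn / M.h * ∑ i, ∑ k, G i k x) :=
        integral_mono_ae (integrable_finsetSum _ fun j _ => integrable_integral_vertical (hintA v j))
          (((hiB.add (hiP.const_mul _)).add (hiG.const_mul _)).const_mul _) hae
    _ = 3 * Cn * ((∫ x, ∑ i, B i x) + Cn * (∫ x, ∑ i, P i x) +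
          Cn / M.h * ∫ x, ∑ i, ∑ k, G i k x) := by
        have hiBP : Integrable fun x => ∑ i, B i x + Cn * ∑ i, P i x := hiB.add (hiP.const_mul _)
        rw [integral_const_mul, integral_add hiBP (hiG.const_mul _),
          integral_add hiB (hiP.const_mul _), integral_const_mul, integral_const_mul]
    _ ≤ _ := by gcongr

end Mesh
-- Young's inequality and the pairing with the sources
-- Expand `‖t x - y‖² ≥ 0` and divide by `t`.
lemma two_inner_le {E : Type*} [NormedAddCommGroup E] [InnerProductSpace ℝ E] (x y : E) {t : ℝ}
    (ht : 0 < t) : 2 * inner ℝ x y ≤ t * inner ℝ x x + t⁻¹ * inner ℝ y y := by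
  have h1 := sq_nonneg ‖t • x - y‖
  rw [norm_sub_sq_real, norm_smul, real_inner_smul_left, mul_pow, Real.norm_eq_abs, sq_abs] at h1
  rw [real_inner_self_eq_norm_sq, real_inner_self_eq_norm_sq]
  refine le_of_mul_le_mul_left ?_ ht
  have h2 : t * (t * ‖x‖ ^ 2 + t⁻¹ * ‖y‖ ^ 2) = t ^ 2 * ‖x‖ ^ 2 + ‖y‖ ^ 2 := by field_simp
  rw [h2]
  linarith

/-- Integrals over sets that overlap at most `m` times. -/
lemma sum_setIntegral_le_of_multiplicity {X ι : Type*} [MeasurableSpace X] [Fintype ι]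
    {μ : Measure X} {U : Set X} (hU : MeasurableSet U) {A : ι → Set X} (hA : ∀ i, MeasurableSet (A i))
    (hAU : ∀ i, A i ⊆ U) {m : ℝ}
    (hm : ∀ (x : X) (S : Finset ι), (∀ i ∈ S, x ∈ A i) → (S.card : ℝ) ≤ m) {F : X → ℝ}
    (hF0 : ∀ x, 0 ≤ F x) (hF : IntegrableOn F U μ) :
    ∑ i, ∫ x in A i, F x ∂μ ≤ m * ∫ x in U, F x ∂μ := by
  classical
  have hFint (i : ι) : Integrable ((A i).indicator F) μ :=
    (integrable_indicator_iff (hA i)).2 (hF.mono_set (hAU i))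
  have hintU : Integrable (U.indicator F) μ := (integrable_indicator_iff hU).2 hF
  simp_rw [← integral_indicator (hA _)]
  rw [← integral_indicator hU, ← integral_finsetSum _ fun i _ => hFint i, ← integral_const_mul]
  refine integral_mono (integrable_finsetSum _ fun i _ => hFint i) (hintU.const_mul m) fun x => ?_
  simp only [Set.indicator_apply]
  rw [← Finset.sum_filter, Finset.sum_const, nsmul_eq_mul]
  have hc := hm x (Finset.univ.filter fun i => x ∈ A i) (by simp)
  by_cases hx : x ∈ U
  · rw [if_pos hx]
    exact mul_le_mul_of_nonneg_right hc (hF0 x)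
  · have : (Finset.univ.filter fun i => x ∈ A i) = ∅ :=
      Finset.filter_eq_empty_iff.2 fun i _ h => hx (hAU i h)
    simp [hx, this]

/-- Young's inequality on each piece. The function `f` is global while `w` depends on the piece, so
the possible overlap of the pieces costs the factor `m` only in the term with `f`. -/
lemma two_sum_setIntegral_mul_le {X ι : Type*} [MeasurableSpace X] [Fintype ι]
    {μ : Measure X} {U : Set X} (hU : MeasurableSet U) {A : ι → Set X} (hA : ∀ i, MeasurableSet (A i))
    (hAU : ∀ i, A i ⊆ U) {m : ℝ}
    (hm : ∀ (x : X) (S : Finset ι), (∀ i ∈ S, x ∈ A i) → (S.card : ℝ) ≤ m) {f : X → ℝ}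
    (hf : MemLp f 2 (μ.restrict U)) {w : ι → X → ℝ} (hw : ∀ i, MemLp (w i) 2 (μ.restrict (A i)))
    {t : ℝ} (ht : 0 < t) :
    2 * ∑ i, ∫ x in A i, f x * w i x ∂μ ≤
      t⁻¹ * (m * ∫ x in U, f x ^ 2 ∂μ) + t * ∑ i, ∫ x in A i, w i x * w i x ∂μ := by
  have hfA (i : ι) : MemLp f 2 (μ.restrict (A i)) :=
    hf.mono_measure (Measure.restrict_mono (hAU i) le_rfl)
  have h1 := sum_setIntegral_le_of_multiplicity hU hA hAU hm (F := fun x => f x ^ 2)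
    (fun x => sq_nonneg _) hf.integrable_sq
  have hterm (i : ι) : 2 * ∫ x in A i, f x * w i x ∂μ ≤
      t⁻¹ * (∫ x in A i, f x ^ 2 ∂μ) + t * ∫ x in A i, w i x * w i x ∂μ := by
    have hww : Integrable (fun x => w i x * w i x) (μ.restrict (A i)) := (hw i).integrable_mul (hw i)
    rw [← integral_const_mul, ← integral_const_mul, ← integral_const_mul,
      ← integral_add ((hfA i).integrable_sq.const_mul _) (hww.const_mul _)]
    refine integral_mono (((hfA i).integrable_mul (hw i)).const_mul 2)
      (((hfA i).integrable_sq.const_mul _).add (hww.const_mul _)) fun x => ?_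
    have := two_inner_le (w i x) (f x) ht
    simp at this
    linarith
  calc 2 * ∑ i, ∫ x in A i, f x * w i x ∂μ = ∑ i, 2 * ∫ x in A i, f x * w i x ∂μ := by
        rw [Finset.mul_sum]
    _ ≤ ∑ i, (t⁻¹ * (∫ x in A i, f x ^ 2 ∂μ) + t * ∫ x in A i, w i x * w i x ∂μ) :=
        Finset.sum_le_sum fun i _ => hterm i
    _ = t⁻¹ * (∑ i, ∫ x in A i, f x ^ 2 ∂μ) + t * ∑ i, ∫ x in A i, w i x * w i x ∂μ := by
        rw [Finset.sum_add_distrib, Finset.mul_sum, Finset.mul_sum]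
    _ ≤ _ := by gcongr

namespace Mesh

variable {a b c d : ℝ} {M : Mesh a b c d}

/-! ### Nonnegativity -/

lemma innerOmega_self_nonneg (v : M.PiecewisePoly) : 0 ≤ M.innerOmega v v :=
  Finset.sum_nonneg fun _ _ => integral_nonneg fun _ => mul_self_nonneg _

lemma innerGamma1_self_nonneg (v : M.PiecewisePoly) : 0 ≤ M.innerGamma1 v v := by
  unfold innerGamma1 sumGamma1
  exact Finset.sum_nonneg fun _ _ => integral_nonneg fun _ => mul_self_nonneg _

lemma gradForm_self_nonneg (v : M.PiecewisePoly) : 0 ≤ M.gradForm v v :=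
  Finset.sum_nonneg fun _ _ => integral_nonneg fun _ => real_inner_self_nonneg

lemma tangForm_self_nonneg (v : M.PiecewisePoly) : 0 ≤ M.tangForm v v := by
  unfold tangForm sumGamma1
  exact Finset.sum_nonneg fun _ _ => integral_nonneg fun _ => real_inner_self_nonneg

lemma sumEdges_nonneg {F : Fin M.N → Fin M.N → Plane → Plane → ℝ} (hF : ∀ i j τ x, 0 ≤ F i j τ x) :
    0 ≤ M.sumEdges F := by
  refine add_nonneg (Finset.sum_nonneg fun i _ => Finset.sum_nonneg fun j _ => ?_)
    (Finset.sum_nonneg fun i _ => Finset.sum_nonneg fun j _ => integral_nonneg fun x => hF _ _ _ x)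
  split_ifs
  · exact integral_nonneg fun x => hF _ _ _ x
  · exact le_rfl

lemma jumpJump_self_nonneg (v : M.PiecewisePoly) : 0 ≤ M.jumpJump v v :=
  sumEdges_nonneg fun _ _ _ _ => real_inner_self_nonneg

lemma avgAvg_self_nonneg (v : M.PiecewisePoly) : 0 ≤ M.avgAvg v v :=
  sumEdges_nonneg fun _ _ _ _ => real_inner_self_nonneg

lemma sumRidges_nonneg {F : ℝ → Fin M.N → Fin M.N → ℝ} (hF : ∀ s i j, 0 ≤ F s i j) :
    0 ≤ M.sumRidges F := by
  refine Finset.sum_nonneg fun i _ => Finset.sum_nonneg fun j _ => add_nonneg ?_ ?_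
  · split_ifs
    · exact hF _ _ _
    · exact le_rfl
  · split_ifs
    · exact hF _ _ _
    · exact le_rfl

lemma ridgeJumpJump_self_nonneg (v : M.PiecewisePoly) : 0 ≤ M.ridgeJumpJump v v :=
  sumRidges_nonneg fun _ _ _ => real_inner_self_nonneg

lemma ridgeAvgAvg_self_nonneg (v : M.PiecewisePoly) : 0 ≤ M.ridgeAvgAvg v v :=
  sumRidges_nonneg fun _ _ _ => real_inner_self_nonneg

/-! ### Coercivity -/

/-- The pointwise Young inequality is integrated. The jump involves a choice of normal and is not
visibly measurable; integrability follows because it agrees almost everywhere with a continuous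
function. -/
lemma NonOverlapping.two_setIntegral_jump_avg_le {i j : Fin M.N} {τ : Plane}
    (hO : M.NonOverlapping i j τ) (v : M.PiecewisePoly) {t : ℝ} (ht : 0 < t) :
    2 * ∫ x in M.edge i j τ, inner ℝ (M.jump v i j τ x) (M.avgGrad v i j τ x)
        ∂(μH[1] : Measure Plane) ≤
      t * (∫ x in M.edge i j τ, inner ℝ (M.jump v i j τ x) (M.jump v i j τ x)
        ∂(μH[1] : Measure Plane)) +
      t⁻¹ * ∫ x in M.edge i j τ, inner ℝ (M.avgGrad v i j τ x) (M.avgGrad v i j τ x)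
        ∂(μH[1] : Measure Plane) := by
  obtain ⟨n, u, hn, -, -, hjump⟩ := hO.edge_structure
  have hae := hjump v
  have hA : Continuous (M.avgGrad v i j τ) := by
    unfold avgGrad
    fun_prop
  have hAA : Integrable (fun x => inner ℝ (M.avgGrad v i j τ x) (M.avgGrad v i j τ x))
      ((μH[1] : Measure Plane).restrict (M.edge i j τ)) := hO.integrableOn_edge (by fun_prop)
  have hJA : Integrable (fun x => inner ℝ (M.jump v i j τ x) (M.avgGrad v i j τ x))
      ((μH[1] : Measure Plane).restrict (M.edge i j τ)) := by
    have h1 : IntegrableOn (fun x => inner ℝ ((val (v i) x - val (v j) (x + τ)) • n)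
      (M.avgGrad v i j τ x)) (M.edge i j τ) (μH[1] : Measure Plane) :=
      hO.integrableOn_edge (by fun_prop)
    refine h1.congr ?_
    filter_upwards [hae] with x hx
    rw [hx]
  have hJJ : Integrable (fun x => inner ℝ (M.jump v i j τ x) (M.jump v i j τ x))
      ((μH[1] : Measure Plane).restrict (M.edge i j τ)) := by
    have h1 : IntegrableOn (fun x => inner ℝ ((val (v i) x - val (v j) (x + τ)) • n)
      ((val (v i) x - val (v j) (x + τ)) • n)) (M.edge i j τ) (μH[1] : Measure Plane) :=
      hO.integrableOn_edge (by fun_prop)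
    refine h1.congr ?_
    filter_upwards [hae] with x hx
    rw [hx]
  rw [← integral_const_mul, ← integral_const_mul, ← integral_const_mul,
    ← integral_add (hJJ.const_mul _) (hAA.const_mul _)]
  exact integral_mono (hJA.const_mul 2) ((hJJ.const_mul _).add (hAA.const_mul _))
    fun x => two_inner_le _ _ ht

lemma two_jumpAvg_le (v : M.PiecewisePoly) {t : ℝ} (ht : 0 < t) :
    2 * M.jumpAvg v v ≤ t * M.jumpJump v v + t⁻¹ * M.avgAvg v v := by
  unfold jumpAvg jumpJump avgAvg sumEdges
  simp only [mul_add, Finset.mul_sum]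
  rw [add_add_add_comm]
  simp only [← Finset.sum_add_distrib]
  refine Finset.sum_le_sum fun i _ => Finset.sum_le_sum fun j _ => add_le_add ?_
    ((nonOverlapping_period i j).two_setIntegral_jump_avg_le v ht)
  split_ifs with hij
  · exact (nonOverlapping_zero hij.ne).two_setIntegral_jump_avg_le v ht
  · simp

lemma two_ridgeJumpAvg_le (v : M.PiecewisePoly) {t : ℝ} (ht : 0 < t) :
    2 * M.ridgeJumpAvg v v ≤ t * M.ridgeJumpJump v v + t⁻¹ * M.ridgeAvgAvg v v := by
  unfold ridgeJumpAvg ridgeJumpJump ridgeAvgAvg sumRidges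
  simp only [Finset.mul_sum]
  simp only [← Finset.sum_add_distrib]
  refine Finset.sum_le_sum fun i _ => Finset.sum_le_sum fun j _ => ?_
  simp only [mul_add]
  rw [add_add_add_comm]
  refine add_le_add ?_ ?_
  · split_ifs
    · exact two_inner_le _ _ ht
    · simp
  · split_ifs
    · exact two_inner_le _ _ ht
    · simp

/-- Coercivity of the interior penalty form for a large penalty parameter. -/
lemma exists_coercive (p : ℕ) {ρ : ℝ} (hρ : 0 < ρ) :
    ∃ γ₀ : ℝ, 1 ≤ γ₀ ∧ ∀ γ, γ₀ ≤ γ → ∀ (a b c d : ℝ) (M : Mesh a b c d), a < b → c < d →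
      M.QuasiUniform ρ → ∀ (α β : ℝ), 0 < α → 0 < β → ∀ v ∈ M.V p,
        1 / 2 * M.energySq α β γ v ≤ M.Ah α β γ v v := by
  obtain ⟨C₁, hC₁, H₁⟩ := exists_avgAvg_le p hρ
  obtain ⟨C₂, hC₂, H₂⟩ := exists_ridgeAvgAvg_le p hρ
  -- This makes `C₁ / γ` and `C₂ / γ` at most `1 / 8`; the summand `1` ensures `γ ≥ 1`, which the
  -- Poincaré estimate uses.
  refine ⟨1 + 8 * C₁ + 8 * C₂, by linarith, fun γ hγ a b c d M hab hcd hQ α β hα hβ v hv => ?_⟩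
  have hh := M.h_pos hab hcd
  have hγ0 : 0 < γ := by linarith
  set σ := γ / M.h with hσdef
  have hσ : 0 < σ := by positivity
  have hG := M.gradForm_self_nonneg v
  have hT := M.tangForm_self_nonneg v
  have hΓ := M.innerGamma1_self_nonneg v
  -- The weight `σ / 2` spends half of the penalty. The remaining half gives the jump part of the
  -- energy, and the averages, with total factor `5 / 2` after rearrangement, are paid for by half
  -- of the Dirichlet term since `5 / 16 ≤ 1 / 2`.
  have h1 := two_jumpAvg_le v (half_pos hσ)
  have h2 := two_ridgeJumpAvg_le v (half_pos hσ)
  have hinv : (σ / 2)⁻¹ = 2 * (1 / σ) := by rw [inv_div]; ring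
  have hAA : 1 / σ * M.avgAvg v v ≤ 1 / 8 * M.gradForm v v := by
    calc 1 / σ * M.avgAvg v v ≤ 1 / σ * (C₁ / M.h * M.gradForm v v) := by
          gcongr
          exact H₁ a b c d M hQ hh v hv
      _ = C₁ / γ * M.gradForm v v := by rw [hσdef]; field_simp
      _ ≤ 1 / 8 * M.gradForm v v := by
          refine mul_le_mul_of_nonneg_right ?_ hG
          rw [div_le_div_iff₀ hγ0 (by norm_num)]
          linarith
  have hRR : 1 / σ * M.ridgeAvgAvg v v ≤ 1 / 8 * M.tangForm v v := by
    calc 1 / σ * M.ridgeAvgAvg v v ≤ 1 / σ * (C₂ / M.h * M.tangForm v v) := by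
          gcongr
          exact H₂ a b c d M hab hcd hQ v hv
      _ = C₂ / γ * M.tangForm v v := by rw [hσdef]; field_simp
      _ ≤ 1 / 8 * M.tangForm v v := by
          refine mul_le_mul_of_nonneg_right ?_ hT
          rw [div_le_div_iff₀ hγ0 (by norm_num)]
          linarith
  rw [hinv] at h1 h2
  have hB : 1 / 2 * (M.gradForm v v + σ * M.jumpJump v v + 1 / σ * M.avgAvg v v) ≤ M.Bh σ v v := by
    unfold Bh
    linarith
  have hb : 1 / 2 * (M.tangForm v v + σ * M.ridgeJumpJump v v + 1 / σ * M.ridgeAvgAvg v v) ≤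
      M.bh σ v v := by
    unfold bh
    linarith
  have hb' := mul_le_mul_of_nonneg_left hb hβ.le
  have hαΓ := mul_nonneg hα.le hΓ
  unfold Ah energySq
  rw [← hσdef]
  have e : β / σ * M.ridgeAvgAvg v v = β * (1 / σ * M.ridgeAvgAvg v v) := by ring
  rw [e]
  linarith

/-! ### The energy estimate -/

/-- The difference of the two sides is the integral of `(w - u)² / (2 Δt)`, the numerical
dissipation of the backward Euler step. -/
lemma innerOmega_step_le (u w : M.PiecewisePoly) {Δt : ℝ} (hΔ : 0 < Δt) :
    1 / (2 * Δt) * (M.innerOmega w w - M.innerOmega u u) ≤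
      M.innerOmega (Δt⁻¹ • (w - u)) w := by
  unfold innerOmega
  rw [← Finset.sum_sub_distrib, Finset.mul_sum]
  refine Finset.sum_le_sum fun i _ => ?_
  rw [← integral_sub (M.integrableOn_tri i (by fun_prop)) (M.integrableOn_tri i (by fun_prop)),
    ← integral_const_mul]
  refine integral_mono (M.integrableOn_tri i (by fun_prop)) (M.integrableOn_tri i (by fun_prop))
    fun x => ?_
  simp only [Pi.smul_apply, Pi.sub_apply, val_smul, val_sub]
  have h1 : Δt⁻¹ * (val (w i) x - val (u i) x) * val (w i) x -
      1 / (2 * Δt) * (val (w i) x * val (w i) x - val (u i) x * val (u i) x) =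
      1 / (2 * Δt) * (val (w i) x - val (u i) x) ^ 2 := by
    field_simp
    ring
  have h2 : 0 ≤ 1 / (2 * Δt) * (val (w i) x - val (u i) x) ^ 2 := by positivity
  linarith

lemma innerGamma1_step_le (u w : M.PiecewisePoly) {Δt : ℝ} (hΔ : 0 < Δt) :
    1 / (2 * Δt) * (M.innerGamma1 w w - M.innerGamma1 u u) ≤
      M.innerGamma1 (Δt⁻¹ • (w - u)) w := by
  unfold innerGamma1 sumGamma1
  rw [← Finset.sum_sub_distrib, Finset.mul_sum]
  refine Finset.sum_le_sum fun i _ => ?_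
  rw [← integral_sub (M.integrableOn_Gamma1 i (by fun_prop)) (M.integrableOn_Gamma1 i (by fun_prop)),
    ← integral_const_mul]
  refine integral_mono (M.integrableOn_Gamma1 i (by fun_prop)) (M.integrableOn_Gamma1 i (by fun_prop))
    fun x => ?_
  simp only [Pi.smul_apply, Pi.sub_apply, val_smul, val_sub]
  have h1 : Δt⁻¹ * (val (w i) x - val (u i) x) * val (w i) x -
      1 / (2 * Δt) * (val (w i) x * val (w i) x - val (u i) x * val (u i) x) =
      1 / (2 * Δt) * (val (w i) x - val (u i) x) ^ 2 := by
    field_simp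
    ring
  have h2 : 0 ≤ 1 / (2 * Δt) * (val (w i) x - val (u i) x) ^ 2 := by positivity
  linarith

lemma two_pairOmega_le {ρ : ℝ} (hρ : 0 < ρ) (hQ : M.QuasiUniform ρ) {f : Plane → ℝ}
    (hf : MemLp f 2 (volume.restrict (Omega a b c d))) (v : M.PiecewisePoly) {t : ℝ} (ht : 0 < t) :
    2 * M.pairOmega f v ≤ t⁻¹ * (1 / ρ ^ 2 * normSqOmega a b c d f) + t * M.innerOmega v v :=
  two_sum_setIntegral_mul_le (isOpen_Omega a b c d).measurableSet
    (fun i => (M.isOpen_tri i).measurableSet) M.tri_subset_Omega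
    (fun _ S hS => card_le_of_mem hρ hQ S fun i hi => M.tri_subset i (hS i hi)) hf
    (w := fun i => val (v i))
    (fun i => (memLp_two_iff_integrable_sq (continuous_val _).aestronglyMeasurable).2
      (M.integrableOn_tri i (by fun_prop))) ht

lemma two_pairGamma1_le {ρ : ℝ} (hρ : 0 < ρ) (hQ : M.QuasiUniform ρ) {g : Plane → ℝ}
    (hg : MemLp g 2 ((μH[1] : Measure Plane).restrict (Gamma1 a b c d))) (v : M.PiecewisePoly)
    {t : ℝ} (ht : 0 < t) :
    2 * M.pairGamma1 g v ≤ t⁻¹ * (1 / ρ ^ 2 * normSqGamma1 a b c d g) + t * M.innerGamma1 v v :=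
  two_sum_setIntegral_mul_le (isClosed_Gamma1 a b c d).measurableSet
    (fun i => (M.isCompact_closedTri_inter_Gamma1 i).measurableSet) (fun _ => Set.inter_subset_right)
    (fun _ S hS => card_le_of_mem hρ hQ S fun i hi => (hS i hi).1) hg
    (w := fun i => val (v i))
    (fun i => (memLp_two_iff_integrable_sq (continuous_val _).aestronglyMeasurable).2
      (M.integrableOn_Gamma1 i (by fun_prop))) ht

/-- The energy norm controls the `L²` norm. -/
lemma innerOmega_le_energySq (hab : a < b) (hcd : c < d) {ρ : ℝ} (hρ : 0 < ρ)
    (hQ : M.QuasiUniform ρ) {α β γ : ℝ} (hα : 0 < α) (hβ : 0 < β) (hγ : 1 ≤ γ) (v : M.PiecewisePoly) :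
    α * M.innerGamma1 v v ≤ M.energySq α β γ v ∧
      M.innerOmega v v ≤ 3 * ((d - c) / ρ ^ 2) * (1 / α + 3 * ((d - c) / ρ ^ 2)) *
        M.energySq α β γ v := by
  have hh := M.h_pos hab hcd
  have hCn : 0 < (d - c) / ρ ^ 2 := div_pos (by linarith) (by positivity)
  set Cn := (d - c) / ρ ^ 2
  have hG := M.gradForm_self_nonneg v
  have hT := mul_nonneg hβ.le (M.tangForm_self_nonneg v)
  have hΓ := mul_nonneg hα.le (M.innerGamma1_self_nonneg v)
  have hσ : 0 < γ / M.h := by positivity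
  have hJ := mul_nonneg hσ.le (M.jumpJump_self_nonneg v)
  have hA := mul_nonneg (one_div_pos.2 hσ).le (M.avgAvg_self_nonneg v)
  have hR := mul_nonneg (mul_pos hβ hσ).le (M.ridgeJumpJump_self_nonneg v)
  have hRA := mul_nonneg (div_pos hβ hσ).le (M.ridgeAvgAvg_self_nonneg v)
  have h1 : α * M.innerGamma1 v v ≤ M.energySq α β γ v := by unfold energySq; linarith
  have h2 : M.gradForm v v ≤ M.energySq α β γ v := by unfold energySq; linarith
  have h3 : γ / M.h * M.jumpJump v v ≤ M.energySq α β γ v := by unfold energySq; linarith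
  -- Because `γ ≥ 1`, the penalty controls the jumps with weight `1 / h`, with a constant
  -- independent of `γ`.
  have h4 : 1 / M.h * M.jumpJump v v ≤ M.energySq α β γ v := by
    refine le_trans ?_ h3
    exact mul_le_mul_of_nonneg_right (by gcongr) (M.jumpJump_self_nonneg v)
  have h5 : M.innerGamma1 v v ≤ 1 / α * M.energySq α β γ v := by
    rw [one_div, le_inv_mul_iff₀ hα]
    exact h1
  refine ⟨h1, (innerOmega_le hab hcd hρ hQ v).trans ?_⟩
  have h6 : Cn / M.h * (2 * M.jumpJump v v) = 2 * Cn * (1 / M.h * M.jumpJump v v) := by ring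
  rw [h6, mul_assoc (3 * Cn) (1 / α + 3 * Cn)]
  refine mul_le_mul_of_nonneg_left ?_ (by positivity)
  calc _ ≤ 1 / α * M.energySq α β γ v + Cn * M.energySq α β γ v +
        2 * Cn * M.energySq α β γ v := by gcongr
    _ = _ := by ring

end Mesh
end DG

end

/-! ### The stability estimate -/

theorem mainTheorem4 (a b c d : ℝ) (hab : a < b) (hcd : c < d)
    (α β lam : ℝ) (hα : 0 < α) (hβ : 0 < β) (hlam : 0 < lam) (ρ : ℝ) (hρ : 0 < ρ) :
    ∃ C : ℝ, 0 < C ∧ ∀ p : ℕ, 1 ≤ p → ∃ γ₀ : ℝ, 0 < γ₀ ∧ ∀ γ : ℝ, γ₀ ≤ γ →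
      ∀ M : DG.Mesh a b c d, M.QuasiUniform ρ →
      ∀ (T Δt : ℝ) (K : ℕ), 0 < T → 0 < Δt → K * Δt = T →
      ∀ f g : ℝ → Plane → ℝ,
        (∀ k ∈ Finset.Icc 1 K,
          MemLp (f (k * Δt)) 2 (volume.restrict (DG.Omega a b c d)) ∧
          MemLp (g (k * Δt)) 2 ((μH[1] : Measure Plane).restrict (DG.Gamma1 a b c d))) →
      ∀ u : ℕ → M.PiecewisePoly, M.IsBackwardEulerSolution α β lam γ p Δt K f g u →
        M.normSqLam lam (u K) + Δt * ∑ k ∈ Finset.Icc 1 K, M.energySq α β γ (u k) ≤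
          C * (M.normSqLam lam (u 0) +
            Δt * ∑ k ∈ Finset.Icc 1 K,
              (DG.normSqOmega a b c d (f (k * Δt)) + DG.normSqGamma1 a b c d (g (k * Δt)))) := by
  have hCn : 0 < (d - c) / ρ ^ 2 := div_pos (by linarith) (by positivity)
  -- `CP` bounds the squared `L²(Ω)` norm by the squared energy norm. Like `C₃`, it is fixed before
  -- the degree `p`.
  set CP := 3 * ((d - c) / ρ ^ 2) * (1 / α + 3 * ((d - c) / ρ ^ 2)) with hCP
  have hCP0 : 0 < CP := by positivity
  set C₃ := 2 * CP / ρ ^ 2 + 2 / (α * ρ ^ 2) with hC₃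
  have hC₃0 : 0 < C₃ := by positivity
  refine ⟨2 + 4 * C₃, by positivity, fun p _ => ?_⟩
  obtain ⟨γ₀, hγ₀, hcoer⟩ := DG.Mesh.exists_coercive p hρ
  refine ⟨γ₀, by linarith, fun γ hγ M hQ T Δt K _ hΔ _ f g hfg u hu => ?_⟩
  set F : ℕ → ℝ := fun k =>
    DG.normSqOmega a b c d (f (k * Δt)) + DG.normSqGamma1 a b c d (g (k * Δt)) with hF
  have hF0 (k : ℕ) : 0 ≤ F k :=
    add_nonneg (integral_nonneg fun x => sq_nonneg _) (integral_nonneg fun x => sq_nonneg _)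
  have he0 (k : ℕ) : 0 ≤ M.normSqLam lam (u k) :=
    add_nonneg (M.innerOmega_self_nonneg _) (mul_nonneg hlam.le (M.innerGamma1_self_nonneg _))
  have hstep (k : ℕ) (hk : k < K) : M.normSqLam lam (u (k + 1)) +
      Δt / 2 * M.energySq α β γ (u (k + 1)) ≤ M.normSqLam lam (u k) + 2 * C₃ * Δt * F (k + 1) := by
    set w := u (k + 1) with hw
    have hwV : w ∈ M.V p := hu.1 (k + 1) hk
    obtain ⟨hfk, hgk⟩ := hfg (k + 1) (Finset.mem_Icc.2 ⟨by omega, hk⟩)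
    have heq := hu.2 k hk w hwV
    have hO := DG.Mesh.innerOmega_step_le (u k) w hΔ
    have hΓ := mul_le_mul_of_nonneg_left (DG.Mesh.innerGamma1_step_le (u k) w hΔ) hlam.le
    have hA := hcoer γ hγ a b c d M hab hcd hQ α β hα hβ w hwV
    obtain ⟨hE1, hE2⟩ := DG.Mesh.innerOmega_le_energySq (β := β) hab hcd hρ hQ hα hβ
      (hγ₀.trans hγ) w
    -- The weights `1 / (4 CP)` and `α / 4` make the `w`-part of each source term at most `1 / 8` of
    -- the energy. Together they use `1 / 4` of the available `1 / 2`, and the inverse weights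
    -- produce the two summands of `C₃`.
    have hpf := DG.Mesh.two_pairOmega_le hρ hQ hfk w (t := 1 / (4 * CP)) (by positivity)
    have hpg := DG.Mesh.two_pairGamma1_le hρ hQ hgk w (t := α / 4) (by positivity)
    set E := M.energySq α β γ w
    set nf := DG.normSqOmega a b c d (f ((k + 1 : ℕ) * Δt)) with hnf
    set ng := DG.normSqGamma1 a b c d (g ((k + 1 : ℕ) * Δt)) with hng
    have hnf0 : 0 ≤ nf := integral_nonneg fun x => sq_nonneg _
    have hng0 : 0 ≤ ng := integral_nonneg fun x => sq_nonneg _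
    have hE2' : 1 / (4 * CP) * M.innerOmega w w ≤ 1 / 4 * E := by
      calc 1 / (4 * CP) * M.innerOmega w w ≤ 1 / (4 * CP) * (CP * E) := by gcongr
        _ = 1 / 4 * E := by field_simp
    have hpf' : M.pairOmega (f ((k + 1 : ℕ) * Δt)) w ≤ 2 * CP / ρ ^ 2 * nf + 1 / 8 * E := by
      have e : (1 / (4 * CP))⁻¹ * (1 / ρ ^ 2 * nf) = 2 * (2 * CP / ρ ^ 2 * nf) := by
        field_simp
        ring
      rw [e] at hpf
      linarith
    have hpg' : M.pairGamma1 (g ((k + 1 : ℕ) * Δt)) w ≤ 2 / (α * ρ ^ 2) * ng + 1 / 8 * E := by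
      have e : (α / 4)⁻¹ * (1 / ρ ^ 2 * ng) = 2 * (2 / (α * ρ ^ 2) * ng) := by
        field_simp
        ring
      rw [e] at hpg
      linarith
    have hsum : 2 * CP / ρ ^ 2 * nf + 2 / (α * ρ ^ 2) * ng ≤ C₃ * F (k + 1) := by
      have h1 : 0 ≤ 2 * CP / ρ ^ 2 * ng := by positivity
      have h2 : 0 ≤ 2 / (α * ρ ^ 2) * nf := by positivity
      have h3 : C₃ * F (k + 1) = (2 * CP / ρ ^ 2 + 2 / (α * ρ ^ 2)) * (nf + ng) := rfl
      rw [h3]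
      linarith
    have hmain : 1 / (2 * Δt) * (M.normSqLam lam w - M.normSqLam lam (u k)) + 1 / 4 * E ≤
        C₃ * F (k + 1) := by
      have e : 1 / (2 * Δt) * (M.normSqLam lam w - M.normSqLam lam (u k)) =
          1 / (2 * Δt) * (M.innerOmega w w - M.innerOmega (u k) (u k)) +
          lam * (1 / (2 * Δt) * (M.innerGamma1 w w - M.innerGamma1 (u k) (u k))) := by
        unfold DG.Mesh.normSqLam
        ring
      rw [e]
      linarith
    have h2 := mul_le_mul_of_nonneg_left hmain (by positivity : 0 ≤ 2 * Δt)
    have e : 2 * Δt * (1 / (2 * Δt) * (M.normSqLam lam w - M.normSqLam lam (u k)) + 1 / 4 * E) =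
        M.normSqLam lam w - M.normSqLam lam (u k) + Δt / 2 * E := by
      field_simp
      ring
    rw [e] at h2
    linarith
  have hsum (n : ℕ) (hn : n ≤ K) : M.normSqLam lam (u n) +
      Δt / 2 * ∑ k ∈ Finset.Icc 1 n, M.energySq α β γ (u k) ≤
        M.normSqLam lam (u 0) + 2 * C₃ * Δt * ∑ k ∈ Finset.Icc 1 n, F k := by
    induction n with
    | zero => simp
    | succ n ih =>
      have h1 := ih (by omega)
      have h2 := hstep n (by omega)
      rw [Finset.sum_Icc_succ_top (by omega), Finset.sum_Icc_succ_top (by omega), mul_add, mul_add]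
      linarith
  have hfin := hsum K le_rfl
  have hFs : 0 ≤ Δt * ∑ k ∈ Finset.Icc 1 K, F k :=
    mul_nonneg hΔ.le (Finset.sum_nonneg fun k _ => hF0 k)
  have h4 := mul_nonneg hC₃0.le (he0 0)
  have h5 := he0 K
  -- The energy sum has only the factor `Δt / 2` so far; doubling restores `Δt` and gives `C = 2 + 4
  -- C₃`.
  calc _ ≤ 2 * (M.normSqLam lam (u K) +
        Δt / 2 * ∑ k ∈ Finset.Icc 1 K, M.energySq α β γ (u k)) := by linarith
    _ ≤ 2 * (M.normSqLam lam (u 0) + 2 * C₃ * Δt * ∑ k ∈ Finset.Icc 1 K, F k) := by linarith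
    _ ≤ (2 + 4 * C₃) * (M.normSqLam lam (u 0) + Δt * ∑ k ∈ Finset.Icc 1 K, F k) := by
        linarith
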